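/- For a finite graph $G$ let $\operatorname{diam}(G)$ denote the largest graph distance $d(x,y)$ between two vertices $x,y$ of $G$ lying in the same component. Let $G(n,p)$ be the random graph with vertex set $\{1,\dots,n\}$ in which each possible edge is present with probability $p$, independently of the others. Fix a real number $\lambda>1$, and let $\lambda_*<1$ satisfy $\lambda_* e^{-\lambda_*}=\lambda e^{-\lambda}$. Then, as $n\to\infty$, $$\operatorname{diam}(G(n,\lambda/n))=\frac{\log n}{\log\lambda}+2\,\frac{\log n}{\log(1/\lambda_*)}+O_p(1).$$ That is, the difference $X_n$ between the diameter and the two main terms is bounded in probability: for every $\delta>0$ there is a constant $C$ such that $\Pr(|X_n|>C)\le\delta$ for all sufficiently large $n$. In other words, for every function $K=K(n)\to\infty$, the probability that $|X_n|\le K(n)$ tends to $1$ as $n\to\infty$. -/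

import Mathlib

open Filter Topology MeasureTheory
open scoped ENNReal

/-- The diameter of a possibly disconnected graph: the largest distance between two vertices in the
same component. For a nonempty finite vertex set this is a maximum, see
`SimpleGraph.isGreatest_finiteDiam`; for the empty graph it is `0`. -/
noncomputable def SimpleGraph.finiteDiam {V : Type*} (G : SimpleGraph V) : ℕ :=
  sSup {d : ℕ | ∃ x y : V, G.Reachable x y ∧ G.dist x y = d}

theorem SimpleGraph.isGreatest_finiteDiam {V : Type*} [Finite V] [Nonempty V]
    (G : SimpleGraph V) :
    IsGreatest {d : ℕ | ∃ x y : V, G.Reachable x y ∧ G.dist x y = d} G.finiteDiam := by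
  have hfin : {d : ℕ | ∃ x y : V, G.Reachable x y ∧ G.dist x y = d}.Finite := by
    refine (Set.finite_range (fun q : V × V => G.dist q.1 q.2)).subset ?_
    rintro d ⟨x, y, -, rfl⟩
    exact ⟨(x, y), rfl⟩
  obtain ⟨v⟩ := ‹Nonempty V›
  exact ⟨Nat.sSup_mem ⟨_, v, v, SimpleGraph.Reachable.refl v, rfl⟩ hfin.bddAbove,
    fun d hd => le_csSup hfin.bddAbove hd⟩

/-- The law of the binomial random graph `G(n, lam / n)` on the vertex set `Fin n`. The edge
probability `lam / n` is projected to `[0, 1]`, which changes nothing once `0 ≤ lam ≤ n`. -/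
noncomputable def sparseRandomGraph (lam : ℝ) (n : ℕ) : Measure (SimpleGraph (Fin n)) :=
  SimpleGraph.binomialRandom (Fin n) (Set.projIcc (0 : ℝ) 1 zero_le_one (lam / (n : ℝ)))

/-- `X n = O_p(1)`: the sequence `X` of real random variables, with `X n` defined on the probability
space `(Ω n, μ n)`, is bounded in probability. -/
def BoundedInProbability {Ω : ℕ → Type*} [∀ n, MeasurableSpace (Ω n)]
    (μ : ∀ n, Measure (Ω n)) (X : ∀ n, Ω n → ℝ) : Prop :=
  ∀ δ : ℝ≥0∞, 0 < δ → ∃ C : ℝ, ∀ᶠ n in atTop, μ n {ω | C < |X n ω|} ≤ δ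

/-- The events `A n` in the probability spaces `(Ω n, μ n)` hold with high probability. -/
def HoldsWhp {Ω : ℕ → Type*} [∀ n, MeasurableSpace (Ω n)]
    (μ : ∀ n, Measure (Ω n)) (A : ∀ n, Set (Ω n)) : Prop :=
  Tendsto (fun n => μ n (A n)) atTop (𝓝 1)

/-- The main terms `log n / log lam + 2 log n / log (1 / lamStar)`. -/
noncomputable def diamMainTerm (lam lamStar : ℝ) (n : ℕ) : ℝ :=
  Real.log n / Real.log lam + 2 * (Real.log n / Real.log (1 / lamStar))

/-! Breadth-first levels in the graph behave like a Poisson branching process with mean `lam`, whose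
generating function `s ↦ exp (lam * (s - 1))` has extinction probability `lamStar / lam` and
derivative `lamStar` there. A process that survives but is still small after a long time has wasted
about `k` generations, at a cost of order `lamStar ^ k`. Among `n` vertices the longest such delay
is therefore about `log n / log (1 / lamStar)`. Both ends of a longest geodesic can be delayed, and
between the two delays the levels must multiply up to the scale at which they meet, which takes `log
n / log lam` steps. This gives the two main terms; bounded error requires every probability to be
controlled up to a constant factor.

Upper bound. Two levels of about `√n` vertices are joined by an edge with probability bounded away
from zero. With `b` near `√n` and `z = (1 - p) ^ b`, the expectation of `z ^ (level size)` on
survival measures how likely a level is to be thin at time `t`. Conditioning on one level after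
another (`gnpE_explore`) turns this into a difference of two iterates of the generating function
(`gnpE_grow_le`), and `exists_vit_sub_le` shows that the difference is `O(lamStar ^ t * n ^ (α /
2))` with `α = log (1 / lamStar) / log lam`. At half the main term plus a constant it is a small
multiple of `1 / n`. A pair of surviving explorations that fail to meet pays this price twice, so a
union bound over `n ^ 2` pairs closes (`gnpP_exists_far_le`). Explorations that die have already
seen their whole component.

Lower bound. Consider sets `T` attached to the rest by a single edge `vw`, with depth exactly `k`
from `v`, where `n * lamStar ^ k` is of constant order but large. Small dying explorations are
governed by the dual Poisson process with mean `lamStar`, because the weights of a finite tree under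
the two means differ only by a factor per root (`gnpP_diesSmall_le`, `le_gnpP_diesSmall`). A second
moment argument (`gnpP_not_exists_far_le`) produces two such sets whose roots `w`, `w'` have
surviving explorations and are more than `l` apart, where `lam ^ l` is a small multiple of `n`. By
the upper bound the roots lie in one component, and a path from the bottom of one set to the bottom
of the other has at least `l + 1 + 2 * (k + 1)` edges (`Pend.exists_dist`).

Probabilities are finite sums over edge sets, so independence is an algebraic identity
(`gnpE_mul_of_dep`). The measure enters only at the end, through an upper bound. -/

set_option linter.unusedSectionVars false

namespace SparseDiam

open Finset
open scoped Classical

variable {V : Type*} [Fintype V] [DecidableEq V]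

/-! ### Expectation in the binomial random graph -/

section Expectation

/-- The unordered pairs of distinct vertices. -/
noncomputable def pairs (V : Type*) [Fintype V] [DecidableEq V] : Finset (Sym2 V) :=
  univ.filter fun e => ¬ e.IsDiag

/-- The expectation of `f` in the binomial random graph with edge probability `p`. -/
noncomputable def gnpE (p : ℝ) (f : SimpleGraph V → ℝ) : ℝ :=
  ∑ s ∈ (pairs V).powerset,
    p ^ #s * (1 - p) ^ #(pairs V \ s) * f (SimpleGraph.fromEdgeSet (s : Set (Sym2 V)))

/-- The indicator of a proposition. -/
noncomputable def ind (P : Prop) : ℝ := if P then 1 else 0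

theorem ind_of {P : Prop} (h : P) : ind P = 1 := if_pos h

theorem ind_of_not {P : Prop} (h : ¬ P) : ind P = 0 := if_neg h

theorem ind_nonneg (P : Prop) : 0 ≤ ind P := by
  unfold ind; split_ifs <;> norm_num

theorem ind_le_one (P : Prop) : ind P ≤ 1 := by
  unfold ind; split_ifs <;> norm_num

theorem ind_mono {P Q : Prop} (h : P → Q) : ind P ≤ ind Q := by
  by_cases hP : P
  · rw [ind_of hP, ind_of (h hP)]
  · rw [ind_of_not hP]; exact ind_nonneg Q

theorem ind_and (P Q : Prop) : ind (P ∧ Q) = ind P * ind Q := by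
  by_cases hP : P <;> by_cases hQ : Q <;> simp [ind, hP, hQ]

theorem ind_not (P : Prop) : ind (¬ P) = 1 - ind P := by
  by_cases hP : P <;> simp [ind, hP]

/-- The probability of the event `A` in the binomial random graph with edge probability `p`. -/
noncomputable def gnpP (p : ℝ) (A : SimpleGraph V → Prop) : ℝ :=
  gnpE p fun G => ind (A G)

/-- `f G` depends only on the adjacency of the pairs `(a, b)` with `R a b`. -/
def Dep {β : Type*} (R : V → V → Prop) (f : SimpleGraph V → β) : Prop :=
  ∀ G H : SimpleGraph V, (∀ a b, R a b → (G.Adj a b ↔ H.Adj a b)) → f G = f H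

theorem Dep.mono {β : Type*} {R R' : V → V → Prop} {f : SimpleGraph V → β} (hf : Dep R f)
    (h : ∀ a b, R a b → R' a b ∨ R' b a) : Dep R' f := by
  intro G H hGH
  refine hf G H fun a b hab => ?_
  rcases h a b hab with h | h
  · exact hGH a b h
  · rw [G.adj_comm, H.adj_comm]; exact hGH b a h

theorem Dep.comp {β γ : Type*} {R : V → V → Prop} {f : SimpleGraph V → β} (hf : Dep R f)
    (g : β → γ) : Dep R (fun G => g (f G)) :=
  fun G H h => congrArg g (hf G H h)

theorem Dep.comp₂ {β γ δ : Type*} {R : V → V → Prop} {f : SimpleGraph V → β}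
    {f' : SimpleGraph V → γ} (hf : Dep R f) (hf' : Dep R f') (g : β → γ → δ) :
    Dep R (fun G => g (f G) (f' G)) :=
  fun G H h => by simp only [hf G H h, hf' G H h]

theorem Dep.const {β : Type*} (R : V → V → Prop) (c : β) :
    Dep R (fun _ : SimpleGraph V => c) := fun _ _ _ => rfl

theorem gnpE_add (p : ℝ) (f g : SimpleGraph V → ℝ) :
    gnpE p (fun G => f G + g G) = gnpE p f + gnpE p g := by
  simp only [gnpE, mul_add, sum_add_distrib]

theorem gnpE_sub (p : ℝ) (f g : SimpleGraph V → ℝ) :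
    gnpE p (fun G => f G - g G) = gnpE p f - gnpE p g := by
  simp only [gnpE, mul_sub, sum_sub_distrib]

theorem gnpE_const_mul (p c : ℝ) (f : SimpleGraph V → ℝ) :
    gnpE p (fun G => c * f G) = c * gnpE p f := by
  simp only [gnpE, mul_sum]
  exact sum_congr rfl fun _ _ => by ring

theorem gnpE_sum {ι : Type*} (p : ℝ) (s : Finset ι) (f : ι → SimpleGraph V → ℝ) :
    gnpE p (fun G => ∑ i ∈ s, f i G) = ∑ i ∈ s, gnpE p (f i) := by
  simp only [gnpE, mul_sum]
  exact sum_comm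

theorem gnpE_mono {p : ℝ} (hp : 0 ≤ p) (hp1 : p ≤ 1) {f g : SimpleGraph V → ℝ}
    (h : ∀ G, f G ≤ g G) : gnpE p f ≤ gnpE p g := by
  refine sum_le_sum fun s _ => mul_le_mul_of_nonneg_left (h _) ?_
  have : 0 ≤ 1 - p := by linarith
  positivity

theorem gnpE_one (p : ℝ) : gnpE p (fun _ : SimpleGraph V => (1 : ℝ)) = 1 := by
  have h := Finset.sum_pow_mul_eq_add_pow p (1 - p) (pairs V)
  rw [add_sub_cancel, one_pow] at h
  refine Eq.trans (sum_congr rfl fun s hs => ?_) h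
  rw [mul_one, card_sdiff_of_subset (mem_powerset.1 hs)]

theorem gnpE_const (p c : ℝ) : gnpE p (fun _ : SimpleGraph V => c) = c := by
  have := gnpE_const_mul p c (fun _ : SimpleGraph V => (1 : ℝ))
  rw [gnpE_one] at this
  simpa using this

theorem gnpE_nonneg {p : ℝ} (hp : 0 ≤ p) (hp1 : p ≤ 1) {f : SimpleGraph V → ℝ}
    (h : ∀ G, 0 ≤ f G) : 0 ≤ gnpE p f := by
  have := gnpE_mono hp hp1 h
  rwa [gnpE_const] at this

theorem gnpP_nonneg {p : ℝ} (hp : 0 ≤ p) (hp1 : p ≤ 1) (A : SimpleGraph V → Prop) :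
    0 ≤ gnpP p A :=
  gnpE_nonneg hp hp1 fun _ => ind_nonneg _

theorem gnpP_mono {p : ℝ} (hp : 0 ≤ p) (hp1 : p ≤ 1) {A B : SimpleGraph V → Prop}
    (h : ∀ G, A G → B G) : gnpP p A ≤ gnpP p B := by
  exact gnpE_mono hp hp1 fun G => ind_mono (h G)

theorem gnpP_le_one {p : ℝ} (hp : 0 ≤ p) (hp1 : p ≤ 1) (A : SimpleGraph V → Prop) :
    gnpP p A ≤ 1 := by
  have := gnpP_mono hp hp1 (A := A) (B := fun _ => True) fun _ _ => trivial
  refine this.trans ?_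
  simp [gnpP, ind, gnpE_one]

theorem gnpP_or_le {p : ℝ} (hp : 0 ≤ p) (hp1 : p ≤ 1) (A B : SimpleGraph V → Prop) :
    gnpP p (fun G => A G ∨ B G) ≤ gnpP p A + gnpP p B := by
  rw [gnpP, gnpP, gnpP, ← gnpE_add]
  refine gnpE_mono hp hp1 fun G => ?_
  by_cases hA : A G <;> by_cases hB : B G <;> simp [ind, hA, hB]

theorem gnpP_exists_le {ι : Type*} {p : ℝ} (hp : 0 ≤ p) (hp1 : p ≤ 1) (s : Finset ι)
    (A : ι → SimpleGraph V → Prop) :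
    gnpP p (fun G => ∃ i ∈ s, A i G) ≤ ∑ i ∈ s, gnpP p (A i) := by
  simp only [gnpP]
  rw [← gnpE_sum]
  refine gnpE_mono hp hp1 fun G => ?_
  by_cases h : ∃ i ∈ s, A i G
  · obtain ⟨i, hi, hA⟩ := h
    have := single_le_sum (f := fun i => ind (A i G)) (fun i _ => ind_nonneg _) hi
    rw [ind_of ⟨i, hi, hA⟩, ← ind_of hA]
    exact this
  · rw [ind_of_not h]
    exact sum_nonneg fun i _ => ind_nonneg _

theorem gnpP_not (p : ℝ) (A : SimpleGraph V → Prop) :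
    gnpP p (fun G => ¬ A G) = 1 - gnpP p A := by
  simp only [gnpP, ind_not]
  rw [gnpE_sub, gnpE_one]

/-- Functions of disjoint sets of edges are independent. -/
theorem gnpE_mul_of_dep (p : ℝ) {R R' : V → V → Prop} {f g : SimpleGraph V → ℝ}
    (hf : Dep R f) (hg : Dep R' g) (hR : ∀ a b, R a b → ¬ R' a b ∧ ¬ R' b a) :
    gnpE p (fun G => f G * g G) = gnpE p f * gnpE p g := by
  set D : Finset (Sym2 V) := (pairs V).filter fun e => ∃ a b, e = s(a, b) ∧ R a b with hD
  have hDs : D ⊆ pairs V := filter_subset _ _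
  -- An edge set splits uniquely into its part in `D`, the pairs `f` may look at, and its part
  -- outside, and the weight factorises accordingly.
  have key : ∀ F : Finset (Sym2 V) → ℝ,
      ∑ s ∈ (pairs V).powerset, p ^ #s * (1 - p) ^ #(pairs V \ s) * F s =
      ∑ s ∈ D.powerset, ∑ t ∈ (pairs V \ D).powerset,
        (p ^ #s * (1 - p) ^ #(D \ s)) *
        (p ^ #t * (1 - p) ^ #((pairs V \ D) \ t)) * F (s ∪ t) := by
    intro F
    rw [← sum_product']
    refine sum_nbij' (fun s => (s ∩ D, s \ D)) (fun q => q.1 ∪ q.2) ?_ ?_ ?_ ?_ ?_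
    · intro s hs
      simp only [mem_product, mem_powerset] at hs ⊢
      exact ⟨inter_subset_right, sdiff_subset_sdiff hs le_rfl⟩
    · intro q hq
      simp only [mem_product, mem_powerset] at hq ⊢
      exact union_subset (hq.1.trans hDs) (hq.2.trans sdiff_subset)
    · intro s _
      ext e; simp only [mem_union, mem_inter, Finset.mem_sdiff]; tauto
    · intro q hq
      simp only [mem_product, mem_powerset] at hq
      ext e
      · have h1 := @hq.1 e
        have h2 := @hq.2 e
        simp only [Finset.mem_sdiff] at h2
        simp only [mem_inter, mem_union]; tauto
      · have h1 := @hq.1 e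
        have h2 := @hq.2 e
        simp only [Finset.mem_sdiff] at h2
        simp only [Finset.mem_sdiff, mem_union]; tauto
    · intro s hs
      rw [mem_powerset] at hs
      have e1 : s ∩ D ∪ s \ D = s := by
        ext e; simp only [mem_union, mem_inter, Finset.mem_sdiff]; tauto
      have e2 : #s = #(s ∩ D) + #(s \ D) := by rw [card_inter_add_card_sdiff]
      have e3 : #(pairs V \ s) = #(D \ (s ∩ D)) + #((pairs V \ D) \ (s \ D)) := by
        rw [← card_union_of_disjoint]
        · congr 1
          ext e
          have := @hDs e
          simp only [mem_union, mem_inter, Finset.mem_sdiff]; tauto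
        · rw [disjoint_left]; intro e; simp only [Finset.mem_sdiff]; tauto
      simp only [e1]
      rw [e2, e3, pow_add, pow_add]; ring
  have hf' : ∀ s ∈ D.powerset, ∀ t ∈ (pairs V \ D).powerset,
      f (SimpleGraph.fromEdgeSet ((s ∪ t : Finset (Sym2 V)) : Set (Sym2 V))) =
        f (SimpleGraph.fromEdgeSet (s : Set (Sym2 V))) := by
    intro s hs t ht
    refine hf _ _ fun a b hab => ?_
    simp only [SimpleGraph.fromEdgeSet_adj, coe_union, Set.mem_union, mem_coe]
    refine and_congr_left fun hne => ?_
    refine or_iff_left fun h => ?_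
    have := mem_powerset.1 ht h
    simp only [Finset.mem_sdiff, hD, mem_filter, not_and, not_exists] at this
    exact this.2 this.1 a b rfl hab
  have hg' : ∀ s ∈ D.powerset, ∀ t ∈ (pairs V \ D).powerset,
      g (SimpleGraph.fromEdgeSet ((s ∪ t : Finset (Sym2 V)) : Set (Sym2 V))) =
        g (SimpleGraph.fromEdgeSet (t : Set (Sym2 V))) := by
    intro s hs t ht
    refine hg _ _ fun a b hab => ?_
    simp only [SimpleGraph.fromEdgeSet_adj, coe_union, Set.mem_union, mem_coe]
    refine and_congr_left fun hne => ?_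
    refine or_iff_right fun h => ?_
    have := mem_powerset.1 hs h
    simp only [hD, mem_filter] at this
    obtain ⟨-, c, d, hcd, hRcd⟩ := this
    rcases Sym2.eq_iff.1 hcd with ⟨rfl, rfl⟩ | ⟨rfl, rfl⟩
    · exact (hR _ _ hRcd).1 hab
    · exact (hR _ _ hRcd).2 hab
  have hone : ∀ D' : Finset (Sym2 V),
      ∑ s ∈ D'.powerset, p ^ #s * (1 - p) ^ #(D' \ s) = 1 := by
    intro D'
    have h := Finset.sum_pow_mul_eq_add_pow p (1 - p) D'
    rw [add_sub_cancel, one_pow] at h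
    refine Eq.trans (sum_congr rfl fun s hs => ?_) h
    rw [card_sdiff_of_subset (mem_powerset.1 hs)]
  have E1 : gnpE p f = ∑ s ∈ D.powerset, p ^ #s * (1 - p) ^ #(D \ s) *
      f (SimpleGraph.fromEdgeSet (s : Set (Sym2 V))) := by
    rw [gnpE, key fun s => f (SimpleGraph.fromEdgeSet (s : Set (Sym2 V)))]
    refine sum_congr rfl fun s hs => ?_
    rw [sum_congr rfl fun t ht => by rw [hf' s hs t ht], ← sum_mul, ← mul_sum, hone, mul_one]
  have E2 : gnpE p g = ∑ t ∈ (pairs V \ D).powerset, p ^ #t * (1 - p) ^ #((pairs V \ D) \ t) *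
      g (SimpleGraph.fromEdgeSet (t : Set (Sym2 V))) := by
    rw [gnpE, key fun s => g (SimpleGraph.fromEdgeSet (s : Set (Sym2 V))), sum_comm]
    refine sum_congr rfl fun t ht => ?_
    rw [sum_congr rfl fun s hs => by rw [hg' s hs t ht], ← sum_mul, ← sum_mul, hone, one_mul]
  rw [E1, E2, gnpE, key fun s => f (SimpleGraph.fromEdgeSet (s : Set (Sym2 V))) *
    g (SimpleGraph.fromEdgeSet (s : Set (Sym2 V))), sum_mul_sum]
  refine sum_congr rfl fun s hs => sum_congr rfl fun t ht => ?_
  rw [hf' s hs t ht, hg' s hs t ht]; ring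

theorem gnpP_and_of_dep (p : ℝ) {R R' : V → V → Prop} {A B : SimpleGraph V → Prop}
    (hA : Dep R A) (hB : Dep R' B) (hR : ∀ a b, R a b → ¬ R' a b ∧ ¬ R' b a) :
    gnpP p (fun G => A G ∧ B G) = gnpP p A * gnpP p B := by
  simp only [gnpP, ind_and]
  exact gnpE_mul_of_dep p (hA.comp ind) (hB.comp ind) hR

theorem gnpP_adj (p : ℝ) {a b : V} (hab : a ≠ b) : gnpP p (fun G => G.Adj a b) = p := by
  have hmem : s(a, b) ∈ pairs V := by simp [pairs, hab]
  have hins : pairs V = insert s(a, b) ((pairs V).erase s(a, b)) := (insert_erase hmem).symm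
  set D := (pairs V).erase s(a, b) with hD
  have hnot : s(a, b) ∉ D := notMem_erase _ _
  have hone : ∑ s ∈ D.powerset, p ^ #s * (1 - p) ^ #(D \ s) = 1 := by
    have h := Finset.sum_pow_mul_eq_add_pow p (1 - p) D
    rw [add_sub_cancel, one_pow] at h
    refine Eq.trans (sum_congr rfl fun s hs => ?_) h
    rw [card_sdiff_of_subset (mem_powerset.1 hs)]
  rw [gnpP, gnpE, hins, sum_powerset_insert hnot]
  rw [sum_eq_zero, zero_add]
  · calc _ = ∑ s ∈ D.powerset, p * (p ^ #s * (1 - p) ^ #(D \ s)) := by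
          refine sum_congr rfl fun s hs => ?_
          have hs' := mem_powerset.1 hs
          have h1 : s(a, b) ∉ s := fun h => hnot (hs' h)
          have h2 : insert s(a, b) D \ insert s(a, b) s = D \ s := by
            ext e; simp only [Finset.mem_sdiff, mem_insert]
            constructor
            · tauto
            · rintro ⟨h, h'⟩
              exact ⟨Or.inr h, fun h'' => h''.elim (fun h3 => hnot (h3 ▸ h)) h'⟩
          rw [card_insert_of_notMem h1, h2, ind_of (by simp [hab])]
          ring
      _ = p := by rw [← mul_sum, hone, mul_one]
  · intro s hs
    have hs' := mem_powerset.1 hs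
    have h1 : s(a, b) ∉ s := fun h => hnot (hs' h)
    rw [ind_of_not (by simp [h1]), mul_zero]

/-- The measure of an event in the binomial random graph is at most its probability as a sum. -/
theorem binomialRandom_le_gnpP (p : unitInterval) (A : Set (SimpleGraph V)) :
    SimpleGraph.binomialRandom V p A ≤ ENNReal.ofReal (gnpP (p : ℝ) fun G => G ∈ A) := by
  have hp0 : (0 : ℝ) ≤ p := p.2.1
  have hp1 : (0 : ℝ) ≤ 1 - p := by linarith [p.2.2]
  -- There are finitely many graphs, so the event is covered by singletons of known mass. Only
  -- subadditivity is used, hence measurability of `A` plays no role.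
  have hsub : A ⊆ ⋃ s ∈ (pairs V).powerset.filter
      (fun s : Finset (Sym2 V) => SimpleGraph.fromEdgeSet (s : Set (Sym2 V)) ∈ A),
      {SimpleGraph.fromEdgeSet (s : Set (Sym2 V))} := by
    intro G hG
    have hE : SimpleGraph.fromEdgeSet ((G.edgeSet.toFinset : Finset (Sym2 V)) : Set (Sym2 V)) = G := by
      simp
    simp only [Set.mem_iUnion, Set.mem_singleton_iff, mem_filter, mem_powerset, exists_prop]
    refine ⟨G.edgeSet.toFinset, ⟨fun e he => ?_, by rwa [hE]⟩, hE.symm⟩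
    rw [Set.mem_toFinset] at he
    simp [pairs, G.not_isDiag_of_mem_edgeSet he]
  refine (measure_mono hsub).trans ((measure_biUnion_finset_le _ _).trans ?_)
  rw [gnpP, gnpE, ENNReal.ofReal_sum_of_nonneg, sum_filter]
  · refine sum_le_sum fun s hs => ?_
    split_ifs with h
    · rw [SimpleGraph.binomialRandom_singleton, ind_of h, mul_one]
      have hs' := mem_powerset.1 hs
      have hes : (SimpleGraph.fromEdgeSet (s : Set (Sym2 V))).edgeSet = (s : Set (Sym2 V)) := by
        rw [SimpleGraph.edgeSet_fromEdgeSet]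
        refine sdiff_eq_left.2 ?_
        rw [Set.disjoint_left]
        intro e he hd
        have := hs' he
        simp only [pairs, mem_filter] at this
        exact this.2 hd
      have hcard : (Nat.card V).choose 2 - #s = #(pairs V \ s) := by
        rw [card_sdiff_of_subset hs']
        congr 1
        rw [Nat.card_eq_fintype_card, ← Sym2.card_subtype_not_diag, Fintype.card_subtype]
        rfl
      rw [hes, Set.ncard_coe_finset, hcard, ENNReal.ofReal_mul (by positivity),
        ENNReal.ofReal_pow hp0, ENNReal.ofReal_pow hp1]
      apply le_of_eq
      congr 2
      · rw [ENNReal.ofReal, Real.toNNReal_of_nonneg hp0]; rfl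
      · rw [ENNReal.ofReal, Real.toNNReal_of_nonneg hp1]; rfl
    · exact zero_le
  · intro s _
    have := ind_nonneg (SimpleGraph.fromEdgeSet (s : Set (Sym2 V)) ∈ A)
    positivity

end Expectation

/-! ### One step of exploration -/

section Exploration

/-- The neighbours in `U` of the vertices of `A`. -/
noncomputable def nbr (G : SimpleGraph V) (A U : Finset V) : Finset V :=
  U.filter fun u => ∃ a ∈ A, G.Adj a u

theorem mem_nbr {G : SimpleGraph V} {A U : Finset V} {u : V} :
    u ∈ nbr G A U ↔ u ∈ U ∧ ∃ a ∈ A, G.Adj a u := by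
  simp [nbr]

theorem nbr_subset (G : SimpleGraph V) (A U : Finset V) : nbr G A U ⊆ U := filter_subset _ _

theorem dep_nbr (A U : Finset V) : Dep (fun a b => a ∈ A ∧ b ∈ U) (fun G => nbr G A U) := by
  intro G H h
  ext u
  simp only [mem_nbr]
  refine and_congr_right fun hu => exists_congr fun a => and_congr_right fun ha => h a u ⟨ha, hu⟩

theorem gnpP_not_adj_star (p : ℝ) (A : Finset V) {u : V} (hu : u ∉ A) :
    gnpP p (fun G => ∀ a ∈ A, ¬ G.Adj a u) = (1 - p) ^ #A := by
  induction A using Finset.induction_on with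
  | empty => simp [gnpP, ind, gnpE_one]
  | insert a A ha ih =>
    rw [mem_insert, not_or] at hu
    have h1 : gnpP p (fun G => ∀ x ∈ insert a A, ¬ G.Adj x u) =
        gnpP p (fun G => (¬ G.Adj a u) ∧ ∀ x ∈ A, ¬ G.Adj x u) := by
      simp only [forall_mem_insert]
    rw [h1, gnpP_and_of_dep p (R := fun x y => x = a ∧ y = u) (R' := fun x y => x ∈ A ∧ y = u),
      ih hu.2, gnpP_not, gnpP_adj p (Ne.symm hu.1), card_insert_of_notMem ha, pow_succ, mul_comm]
    · intro G H h
      simp only [h a u ⟨rfl, rfl⟩]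
    · intro G H h
      refine propext (forall₂_congr fun x hx => ?_)
      rw [h x u ⟨hx, rfl⟩]
    · rintro x y ⟨rfl, rfl⟩
      exact ⟨fun h => ha h.1, fun h => hu.2 h.1⟩

/-- The probability that a vertex has a neighbour in a set of `a` other vertices. -/
noncomputable def hitProb (p : ℝ) (a : ℕ) : ℝ := 1 - (1 - p) ^ a

/-- The stars from `A` to the different vertices of `U` use disjoint sets of pairs, so the events of
being hit are independent, each of probability `hitProb p #A`. A general `φ` gives the joint law of
all hits at once. -/
theorem gnpE_prod_nbr (p : ℝ) (A U : Finset V) (hAU : Disjoint A U) (φ : V → Prop → ℝ) :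
    gnpE p (fun G => ∏ u ∈ U, φ u (∃ a ∈ A, G.Adj a u)) =
      ∏ u ∈ U, (hitProb p #A * φ u True + (1 - hitProb p #A) * φ u False) := by
  induction U using Finset.induction_on with
  | empty => simp [gnpE_one]
  | insert u U hu ih =>
    rw [disjoint_insert_right] at hAU
    have hsingle : gnpE p (fun G => φ u (∃ a ∈ A, G.Adj a u)) =
        hitProb p #A * φ u True + (1 - hitProb p #A) * φ u False := by
      have h1 : (fun G : SimpleGraph V => φ u (∃ a ∈ A, G.Adj a u)) = fun G =>
          φ u True + (φ u False - φ u True) * ind (∀ a ∈ A, ¬ G.Adj a u) := by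
        ext G
        by_cases h : ∃ a ∈ A, G.Adj a u
        · have h' : ¬ ∀ a ∈ A, ¬ G.Adj a u := by push Not; exact h
          simp only [h, ind_of_not h']; ring
        · have h' : ∀ a ∈ A, ¬ G.Adj a u := by push Not at h; exact h
          simp only [h]
          rw [ind_of h']; ring
      have h2 := gnpP_not_adj_star p A hAU.1
      rw [gnpP] at h2
      rw [h1, gnpE_add, gnpE_const, gnpE_const_mul, h2, hitProb]; ring
    simp only [prod_insert hu]
    rw [gnpE_mul_of_dep p (R := fun x y => x ∈ A ∧ y = u) (R' := fun x y => x ∈ A ∧ y ∈ U),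
      hsingle, ih hAU.2]
    · intro G H h
      have : (∃ a ∈ A, G.Adj a u) ↔ ∃ a ∈ A, H.Adj a u :=
        exists_congr fun a => and_congr_right fun ha => h a u ⟨ha, rfl⟩
      simp only [this]
    · intro G H h
      refine prod_congr rfl fun v hv => ?_
      have : (∃ a ∈ A, G.Adj a v) ↔ ∃ a ∈ A, H.Adj a v :=
        exists_congr fun a => and_congr_right fun ha => h a v ⟨ha, hv⟩
      simp only [this]
    · rintro x y ⟨hx, rfl⟩
      exact ⟨fun h => hu h.2, fun h => hAU.1 h.1⟩

/-- Take the indicator of agreement with `B` as the factor at each vertex of `U`. -/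
theorem gnpP_nbr_eq (p : ℝ) (A U : Finset V) (hAU : Disjoint A U) {B : Finset V} (hB : B ⊆ U) :
    gnpP p (fun G => nbr G A U = B) = hitProb p #A ^ #B * (1 - hitProb p #A) ^ (#U - #B) := by
  have h := gnpE_prod_nbr p A U hAU fun u P => ind (P ↔ u ∈ B)
  have h1 : (fun G : SimpleGraph V => ∏ u ∈ U, ind ((∃ a ∈ A, G.Adj a u) ↔ u ∈ B))
      = fun G => ind (nbr G A U = B) := by
    ext G
    by_cases hG : nbr G A U = B
    · rw [ind_of hG]
      refine prod_eq_one fun u hu => ind_of ?_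
      rw [← hG, mem_nbr, and_iff_right hu]
    · rw [ind_of_not hG]
      have : ∃ u ∈ U, ¬ ((∃ a ∈ A, G.Adj a u) ↔ u ∈ B) := by
        by_contra hcon
        push Not at hcon
        refine hG (Finset.ext fun u => ?_)
        by_cases hu : u ∈ U
        · rw [mem_nbr, and_iff_right hu]; exact hcon u hu
        · rw [mem_nbr]
          exact ⟨fun h' => absurd h'.1 hu, fun h' => absurd (hB h') hu⟩
      obtain ⟨u, hu, hne⟩ := this
      exact prod_eq_zero hu (ind_of_not hne)
  rw [h1] at h
  rw [gnpP, h]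
  have h2 : ∀ u ∈ U, hitProb p #A * ind (True ↔ u ∈ B) +
      (1 - hitProb p #A) * ind (False ↔ u ∈ B) =
      if u ∈ B then hitProb p #A else 1 - hitProb p #A := by
    intro u _
    by_cases hu : u ∈ B <;> simp [ind, hu]
  rw [prod_congr rfl h2, prod_ite, prod_const, prod_const]
  congr 2
  · congr 1; ext u; simp only [mem_filter]; exact ⟨fun h => h.2, fun h => ⟨hB h, h⟩⟩
  · rw [← card_sdiff_of_subset hB]; congr 1; ext u; simp [Finset.mem_sdiff]

/-- Conditioning on the neighbours of `A` in `U`. -/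
theorem gnpE_explore (p : ℝ) (A U : Finset V) (hAU : Disjoint A U)
    (Φ : Finset V → SimpleGraph V → ℝ) (R : V → V → Prop)
    (hR : ∀ a b, a ∈ A → b ∈ U → ¬ R a b ∧ ¬ R b a)
    (hΦ : ∀ B ⊆ U, Dep R (Φ B)) :
    gnpE p (fun G => Φ (nbr G A U) G) =
      ∑ B ∈ U.powerset, hitProb p #A ^ #B * (1 - hitProb p #A) ^ (#U - #B) * gnpE p (Φ B) := by
  have h1 : (fun G : SimpleGraph V => Φ (nbr G A U) G) =
      fun G => ∑ B ∈ U.powerset, ind (nbr G A U = B) * Φ B G := by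
    ext G
    simp only [ind, ite_mul, one_mul, zero_mul]
    rw [sum_ite_eq, if_pos (mem_powerset.2 (nbr_subset G A U))]
  rw [h1, gnpE_sum]
  refine sum_congr rfl fun B hB => ?_
  rw [mem_powerset] at hB
  rw [gnpE_mul_of_dep p ((dep_nbr A U).comp fun C => ind (C = B)) (hΦ B hB)
    (fun a b h => hR a b h.1 h.2)]
  congr 1
  exact gnpP_nbr_eq p A U hAU hB

theorem gnpP_no_edges (p : ℝ) (A U : Finset V) (hAU : Disjoint A U) :
    gnpP p (fun G => ∀ a ∈ A, ∀ u ∈ U, ¬ G.Adj a u) = (1 - p) ^ (#A * #U) := by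
  have h := gnpP_nbr_eq p A U hAU (empty_subset U)
  rw [card_empty, pow_zero, one_mul, Nat.sub_zero, hitProb, sub_sub_cancel, ← pow_mul] at h
  rw [← h]
  congr 1
  ext G
  rw [Finset.eq_empty_iff_forall_notMem]
  simp only [mem_nbr, not_and, not_exists]
  exact ⟨fun h u hu a ha => h a ha u hu, fun h a ha u hu => h u hu a ha⟩

/-- Binomial theorem for sums over subsets. -/
theorem sum_powerset_pgf (U : Finset V) (π s : ℝ) :
    ∑ B ∈ U.powerset, π ^ #B * (1 - π) ^ (#U - #B) * s ^ #B = (1 - (1 - s) * π) ^ #U := by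
  have h := Finset.sum_pow_mul_eq_add_pow (π * s) (1 - π) U
  rw [show 1 - (1 - s) * π = π * s + (1 - π) by ring, ← h]
  exact sum_congr rfl fun B _ => by rw [mul_pow]; ring

end Exploration

/-! ### Stopped exploration -/

section Stopping

/-- Breadth-first exploration from `A` inside `A ∪ U`, stopped after `t` steps or when a level
contains at least `cap` vertices. The value is the last level and the set of unexplored vertices. -/
noncomputable def grow (cap : ℕ) : ℕ → SimpleGraph V → Finset V → Finset V → Finset V × Finset V
  | 0, _, A, U => (A, U)
  | t + 1, G, A, U =>
      if cap ≤ #A then (A, U) else grow cap t G (nbr G A U) (U \ nbr G A U)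

/-- Both vertices lie in `W`. -/
def Within (W : Finset V) (a b : V) : Prop := a ∈ W ∧ b ∈ W

theorem grow_subset (cap t : ℕ) (G : SimpleGraph V) (A U : Finset V) :
    (grow cap t G A U).1 ∪ (grow cap t G A U).2 ⊆ A ∪ U := by
  induction t generalizing A U with
  | zero => exact le_rfl
  | succ t ih =>
    rw [grow]
    split_ifs
    · exact le_rfl
    · refine (ih _ _).trans ?_
      rw [union_sdiff_of_subset (nbr_subset G A U)]
      exact subset_union_right

theorem grow_disjoint (cap t : ℕ) (G : SimpleGraph V) {A U : Finset V} (h : Disjoint A U) :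
    Disjoint (grow cap t G A U).1 (grow cap t G A U).2 := by
  induction t generalizing A U with
  | zero => exact h
  | succ t ih =>
    rw [grow]
    split_ifs
    · exact h
    · exact ih disjoint_sdiff

theorem dep_grow (cap t : ℕ) (A U : Finset V) :
    Dep (Within (A ∪ U)) (fun G => grow cap t G A U) := by
  induction t generalizing A U with
  | zero => exact Dep.const _ _
  | succ t ih =>
    intro G H h
    have h1 : nbr G A U = nbr H A U := dep_nbr A U G H fun a b hab =>
      h a b ⟨mem_union_left _ hab.1, mem_union_right _ hab.2⟩
    simp only [grow, h1]
    split_ifs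
    · rfl
    · refine ih _ _ G H fun a b hab => h a b ?_
      rw [Within, union_sdiff_of_subset (nbr_subset H A U)] at hab
      exact ⟨mem_union_right _ hab.1, mem_union_right _ hab.2⟩

theorem dep_grow_comp (cap t : ℕ) (A U : Finset V) {β : Type*}
    (Ψ : Finset V → Finset V → SimpleGraph V → β) (hΨ : ∀ A U, Dep (Within (A ∪ U)) (Ψ A U)) :
    Dep (Within (A ∪ U)) (fun G => Ψ (grow cap t G A U).1 (grow cap t G A U).2 G) := by
  intro G H h
  have h1 : grow cap t G A U = grow cap t H A U := dep_grow cap t A U G H h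
  simp only [h1]
  exact hΨ _ _ G H fun a b hab =>
    h a b ⟨grow_subset _ _ _ _ _ hab.1, grow_subset _ _ _ _ _ hab.2⟩

/-- The growth iteration `v ↦ 1 - exp (-l v)`. -/
noncomputable def vit (l : ℝ) : ℕ → ℝ → ℝ
  | 0, v => v
  | t + 1, v => 1 - Real.exp (-(l * vit l t v))

theorem vit_mem {l : ℝ} (hl : 0 ≤ l) (t : ℕ) {v : ℝ} (h0 : 0 ≤ v) (h1 : v ≤ 1) :
    0 ≤ vit l t v ∧ vit l t v ≤ 1 := by
  induction t with
  | zero => exact ⟨h0, h1⟩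
  | succ t ih =>
    rw [vit]
    have := mul_nonneg hl ih.1
    have h2 : Real.exp (-(l * vit l t v)) ≤ 1 := Real.exp_le_one_iff.2 (by linarith)
    have h3 := Real.exp_pos (-(l * vit l t v))
    constructor <;> linarith

theorem vit_mono {l : ℝ} (hl : 0 ≤ l) (t : ℕ) {v w : ℝ} (h : v ≤ w) : vit l t v ≤ vit l t w := by
  induction t with
  | zero => exact h
  | succ t ih =>
    rw [vit, vit]
    have := mul_le_mul_of_nonneg_left ih hl
    have := Real.exp_le_exp.2 (neg_le_neg this)
    linarith

/-- One generation of binomial offspring is compared with one of Poisson offspring. The comparison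
is made on a difference of generating function values, since this difference is eventually of order
`1 / n`, far below the error in each value separately. It follows by comparing derivatives in `x`:
the bound on `N * π` controls the prefactor, and the bound on `(N - 1) * π` the power `N - 1` left
by differentiation. -/
theorem one_step_sub_le {π l κ u v : ℝ} {a N : ℕ} (hπ0 : 0 ≤ π) (hπ1 : π ≤ 1) (hN : 1 ≤ N)
    (h1 : l * a ≤ (N - 1) * π) (h2 : N * π ≤ κ * (l * a)) (hu : 0 ≤ u)
    (huv : u ≤ v) (hv : v ≤ 1) :
    (1 - u * π) ^ N - (1 - v * π) ^ N ≤
      κ * (Real.exp (-(l * u)) ^ a - Real.exp (-(l * v)) ^ a) := by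
  -- The claim says that `H` is monotone between `u` and `v`.
  set H : ℝ → ℝ := fun x => (1 - x * π) ^ N - κ * Real.exp (-(l * a * x)) with hH
  have hder : ∀ x, HasDerivAt H (N * (1 - x * π) ^ (N - 1) * (-π) -
      κ * (Real.exp (-(l * a * x)) * (-(l * a)))) x := by
    intro x
    have e1 : HasDerivAt (fun x : ℝ => 1 - x * π) (-π) x := by
      simpa using ((hasDerivAt_id x).mul_const π).const_sub 1
    have e2 : HasDerivAt (fun x : ℝ => -(l * a * x)) (-(l * a)) x := by
      simpa using ((hasDerivAt_id x).const_mul (l * a)).fun_neg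
    exact (e1.fun_pow N).sub (e2.exp.const_mul κ)
  have hmono : MonotoneOn H (Set.Icc 0 1) := by
    refine monotoneOn_of_deriv_nonneg (convex_Icc 0 1)
      (fun x _ => (hder x).continuousAt.continuousWithinAt)
      (fun x _ => (hder x).differentiableAt.differentiableWithinAt) ?_
    intro x hx
    rw [interior_Icc] at hx
    rw [(hder x).deriv]
    have hxπ : x * π ≤ 1 := by nlinarith [hx.1, hx.2]
    have e3 : (1 - x * π) ^ (N - 1) ≤ Real.exp (-(l * a * x)) := by
      calc (1 - x * π) ^ (N - 1) ≤ Real.exp (-(x * π)) ^ (N - 1) := by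
            refine pow_le_pow_left₀ (by linarith) ?_ _
            have := Real.add_one_le_exp (-(x * π)); linarith
        _ = Real.exp (-(x * ((N - 1) * π))) := by
            rw [← Real.exp_nat_mul, Nat.cast_sub hN]; congr 1; push_cast; ring
        _ ≤ _ := by
            refine Real.exp_le_exp.2 (neg_le_neg ?_)
            have := mul_le_mul_of_nonneg_left h1 hx.1.le
            linarith
    have e4 : (N : ℝ) * π * (1 - x * π) ^ (N - 1) ≤ κ * (l * a) * Real.exp (-(l * a * x)) := by
      refine mul_le_mul h2 e3 (pow_nonneg (by linarith) _) ?_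
      exact le_trans (by positivity) h2
    nlinarith
  have := hmono ⟨hu, huv.trans hv⟩ ⟨hu.trans huv, hv⟩ huv
  simp only [hH] at this
  rw [← Real.exp_nat_mul, ← Real.exp_nat_mul]
  have r1 : (a : ℝ) * -(l * u) = -(l * a * u) := by ring
  have r2 : (a : ℝ) * -(l * v) = -(l * a * v) := by ring
  rw [r1, r2]; linarith

theorem hitProb_nonneg {p : ℝ} (hp : 0 ≤ p) (hp1 : p ≤ 1) (a : ℕ) : 0 ≤ hitProb p a := by
  have : (1 - p) ^ a ≤ 1 := pow_le_one₀ (by linarith) (by linarith)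
  rw [hitProb]; linarith

theorem hitProb_le_one {p : ℝ} (hp1 : p ≤ 1) (a : ℕ) : hitProb p a ≤ 1 := by
  have : 0 ≤ (1 - p) ^ a := pow_nonneg (by linarith) _
  rw [hitProb]; linarith

/-- Lower tail bound for the size of the level at which the exploration is stopped. -/
theorem gnpE_grow_le {p : ℝ} (hp : 0 ≤ p) (hp1 : p ≤ 1) {l κ z η K : ℝ} {cap N0 : ℕ}
    (hl : 0 ≤ l) (hκ : 0 ≤ κ) (hz : 0 ≤ z) (hz1 : z ≤ 1) (hη : z ^ cap ≤ η) (hK : 0 ≤ K)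
    (hN0 : 1 ≤ N0)
    (hstep : ∀ a N : ℕ, 1 ≤ a → a < cap → N0 ≤ N → N ≤ Fintype.card V →
      l * a ≤ (N - 1) * hitProb p a ∧ N * hitProb p a ≤ κ * (l * a))
    (Ψ : Finset V → Finset V → SimpleGraph V → ℝ)
    (hdep : ∀ A U, Dep (Within (A ∪ U)) (Ψ A U))
    (hΨ : ∀ A U, Disjoint A U → N0 ≤ #(A ∪ U) →
      gnpE p (Ψ A U) ≤ if A = ∅ then 0 else K * z ^ min #A cap)
    (t : ℕ) (A U : Finset V) (hAU : Disjoint A U) (hcard : N0 + (t + 1) * cap ≤ #(A ∪ U)) :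
    gnpE p (fun G => Ψ (grow cap t G A U).1 (grow cap t G A U).2 G) ≤
      K * (κ ^ t * ((1 - vit l t (1 - z)) ^ #A - (1 - vit l t 1) ^ #A) + η) := by
  have hη0 : 0 ≤ η := le_trans (pow_nonneg hz _) hη
  have hdiff : ∀ t a, 0 ≤ (1 - vit l t (1 - z)) ^ a - (1 - vit l t 1) ^ a := by
    intro t a
    have := (vit_mem hl t (v := 1) (by norm_num) le_rfl).2
    have h2 := vit_mono hl t (v := 1 - z) (w := 1) (by linarith)
    exact sub_nonneg.2 (pow_le_pow_left₀ (by linarith) (by linarith) _)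
  -- Once the cap is reached the exploration stands still, and its contribution is at most `z ^ cap
  -- ≤ η`.
  have hbig : ∀ t (A U : Finset V), Disjoint A U → N0 ≤ #(A ∪ U) → cap ≤ #A →
      gnpE p (Ψ A U) ≤ K * (κ ^ t * ((1 - vit l t (1 - z)) ^ #A - (1 - vit l t 1) ^ #A) + η) := by
    intro t A U hAU hN hA
    have h0 : 0 ≤ κ ^ t * ((1 - vit l t (1 - z)) ^ #A - (1 - vit l t 1) ^ #A) :=
      mul_nonneg (pow_nonneg hκ _) (hdiff _ _)
    refine (hΨ A U hAU hN).trans ?_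
    split_ifs
    · exact mul_nonneg hK (by linarith)
    · rw [min_eq_right hA]
      exact mul_le_mul_of_nonneg_left (by linarith) hK
  induction t generalizing A U with
  | zero =>
    simp only [grow]
    rcases le_or_gt cap #A with hA | hA
    · exact hbig 0 A U hAU (by omega) hA
    · refine (hΨ A U hAU (by omega)).trans ?_
      have h0 : 0 ≤ κ ^ 0 * ((1 - vit l 0 (1 - z)) ^ #A - (1 - vit l 0 1) ^ #A) :=
        mul_nonneg (pow_nonneg hκ _) (hdiff _ _)
      split_ifs with hA0
      · exact mul_nonneg hK (by linarith)
      · rw [min_eq_left hA.le]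
        refine mul_le_mul_of_nonneg_left ?_ hK
        have : #A ≠ 0 := by rwa [Ne, card_eq_zero]
        simp [vit, this, hη0]
  | succ t ih =>
    rcases le_or_gt cap #A with hA | hA
    · simp only [grow, if_pos hA]
      exact hbig (t + 1) A U hAU (by omega) hA
    · simp only [grow, if_neg (not_le.2 hA)]
      -- Each step discards the current level, which has fewer than `cap` vertices, so the required
      -- reserve drops by one `cap` per step.
      have hU : N0 + (t + 1) * cap ≤ #U := by
        rw [card_union_of_disjoint hAU] at hcard
        have : (t + 1 + 1) * cap = (t + 1) * cap + cap := by ring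
        omega
      have hπ0 := hitProb_nonneg hp hp1 #A
      have hπ1 := hitProb_le_one hp1 #A
      rw [gnpE_explore p A U hAU
        (fun B G => Ψ (grow cap t G B (U \ B)).1 (grow cap t G B (U \ B)).2 G) (Within U)]
      · calc _ ≤ ∑ B ∈ U.powerset, hitProb p #A ^ #B * (1 - hitProb p #A) ^ (#U - #B) *
              (K * (κ ^ t * ((1 - vit l t (1 - z)) ^ #B - (1 - vit l t 1) ^ #B) + η)) := by
              refine sum_le_sum fun B hB => mul_le_mul_of_nonneg_left ?_ ?_
              · have hB' := mem_powerset.1 hB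
                refine ih B (U \ B) disjoint_sdiff ?_
                rwa [union_sdiff_of_subset hB']
              · exact mul_nonneg (pow_nonneg hπ0 _) (pow_nonneg (by linarith) _)
          _ = K * (κ ^ t * ((1 - vit l t (1 - z) * hitProb p #A) ^ #U -
                (1 - vit l t 1 * hitProb p #A) ^ #U) + η) := by
              -- Averaging the inductive bound over the random next level evaluates binomial
              -- generating functions. The additive `η` passes through unchanged because the weights
              -- sum to one.
              have e1 := sum_powerset_pgf U (hitProb p #A) (1 - vit l t (1 - z))
              have e2 := sum_powerset_pgf U (hitProb p #A) (1 - vit l t 1)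
              have e3 := sum_powerset_pgf U (hitProb p #A) 1
              simp only [sub_sub_cancel, one_pow, mul_one, sub_self, zero_mul, sub_zero] at e1 e2 e3
              rw [← e1, ← e2]
              have : K * (κ ^ t * (∑ B ∈ U.powerset, hitProb p #A ^ #B *
                  (1 - hitProb p #A) ^ (#U - #B) * (1 - vit l t (1 - z)) ^ #B -
                  ∑ B ∈ U.powerset, hitProb p #A ^ #B *
                  (1 - hitProb p #A) ^ (#U - #B) * (1 - vit l t 1) ^ #B) + η) =
                K * (κ ^ t * (∑ B ∈ U.powerset, hitProb p #A ^ #B *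
                  (1 - hitProb p #A) ^ (#U - #B) * (1 - vit l t (1 - z)) ^ #B -
                  ∑ B ∈ U.powerset, hitProb p #A ^ #B *
                  (1 - hitProb p #A) ^ (#U - #B) * (1 - vit l t 1) ^ #B) + η *
                  ∑ B ∈ U.powerset, hitProb p #A ^ #B * (1 - hitProb p #A) ^ (#U - #B)) := by
                rw [e3, mul_one]
              rw [this, ← sum_sub_distrib, mul_sum, mul_sum, ← sum_add_distrib, mul_sum]
              exact sum_congr rfl fun B _ => by ring
          _ ≤ _ := by
              refine mul_le_mul_of_nonneg_left (add_le_add_left ?_ _) hK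
              rw [pow_succ, mul_assoc]
              refine mul_le_mul_of_nonneg_left ?_ (pow_nonneg hκ _)
              rcases Nat.eq_zero_or_pos #A with h0 | h0
              · simp [h0, hitProb]
              · obtain ⟨s1, s2⟩ := hstep #A #U h0 hA (by omega) (card_le_univ _)
                have := one_step_sub_le hπ0 hπ1 (by omega : 1 ≤ #U) s1 s2
                  (vit_mem hl t (by linarith) (by linarith)).1
                  (vit_mono hl t (by linarith : 1 - z ≤ 1))
                  (vit_mem hl t (v := 1) (by norm_num) le_rfl).2
                simpa [vit] using this
      · intro a b ha hb
        have : a ∉ U := disjoint_left.1 hAU ha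
        exact ⟨fun h => this h.1, fun h => this h.2⟩
      · intro B hB
        have := dep_grow_comp cap t B (U \ B) Ψ hdep
        rwa [union_sdiff_of_subset hB] at this

/-- The exploration dies out with probability at most `q ^ #A`. -/
theorem gnpP_grow_empty_le {p : ℝ} (hp : 0 ≤ p) (hp1 : p ≤ 1) {q : ℝ} {cap N0 : ℕ}
    (hq : 0 ≤ q)
    (hstep : ∀ a N : ℕ, 1 ≤ a → a < cap → N0 ≤ N → N ≤ Fintype.card V →
      (1 - (1 - q) * hitProb p a) ^ N ≤ q ^ a)
    (t : ℕ) (A U : Finset V) (hAU : Disjoint A U) (hcard : N0 + (t + 1) * cap ≤ #(A ∪ U)) :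
    gnpP p (fun G => (grow cap t G A U).1 = ∅) ≤ q ^ #A := by
  have hbig : ∀ A : Finset V, A ≠ ∅ → gnpP p (fun _ : SimpleGraph V => A = ∅) ≤ q ^ #A := by
    intro A hA
    simp only [gnpP, ind_of_not hA, gnpE_const]
    exact pow_nonneg hq _
  have hsmall : ∀ A : Finset V, A = ∅ → ∀ P : SimpleGraph V → Prop, gnpP p P ≤ q ^ #A := by
    rintro A rfl P
    simpa using gnpP_le_one hp hp1 P
  induction t generalizing A U with
  | zero =>
    by_cases hA : A = ∅
    · exact hsmall A hA _
    · exact hbig A hA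
  | succ t ih =>
    by_cases hA0 : A = ∅
    · exact hsmall A hA0 _
    rcases le_or_gt cap #A with hA | hA
    · simp only [grow, if_pos hA]
      exact hbig A hA0
    · simp only [grow, if_neg (not_le.2 hA)]
      have hU : N0 + (t + 1) * cap ≤ #U := by
        rw [card_union_of_disjoint hAU] at hcard
        have : (t + 1 + 1) * cap = (t + 1) * cap + cap := by ring
        omega
      have hπ0 := hitProb_nonneg hp hp1 #A
      have hπ1 := hitProb_le_one hp1 #A
      rw [gnpP, gnpE_explore p A U hAU
        (fun B G => ind ((grow cap t G B (U \ B)).1 = ∅)) (Within U)]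
      · calc _ ≤ ∑ B ∈ U.powerset, hitProb p #A ^ #B * (1 - hitProb p #A) ^ (#U - #B) *
              q ^ #B := by
              refine sum_le_sum fun B hB => mul_le_mul_of_nonneg_left ?_ ?_
              · have hB' := mem_powerset.1 hB
                refine ih B (U \ B) disjoint_sdiff ?_
                rwa [union_sdiff_of_subset hB']
              · exact mul_nonneg (pow_nonneg hπ0 _) (pow_nonneg (by linarith) _)
          _ ≤ q ^ #A := by
              -- The hypothesis `hstep` says that `q` does not increase under the one-step
              -- generating function, so `q ^ #A` is a supersolution of the extinction recursion.
              rw [sum_powerset_pgf]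
              exact hstep #A #U (card_pos.2 (nonempty_iff_ne_empty.2 hA0)) hA (by omega)
                (card_le_univ _)
      · intro a b ha hb
        have : a ∉ U := disjoint_left.1 hAU ha
        exact ⟨fun h => this h.1, fun h => this h.2⟩
      · intro B hB
        have := (dep_grow cap t B (U \ B)).comp fun s => ind (s.1 = ∅)
        rwa [union_sdiff_of_subset hB] at this

end Stopping

/-! ### Two explorations -/

section TwoExplorations

theorem edist_le_add_one_of_adj {G : SimpleGraph V} {x a b : V} {r : ℕ}
    (h : G.edist x a ≤ r) (hab : G.Adj a b) : G.edist x b ≤ ((r + 1 : ℕ) : ℕ∞) := by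
  refine (G.edist_triangle (v := a)).trans ?_
  rw [SimpleGraph.edist_eq_one_iff_adj.2 hab]
  push_cast
  gcongr

theorem grow_fst_edist_le (cap t : ℕ) (G : SimpleGraph V) {A U : Finset V} {x : V} {r : ℕ}
    (h : ∀ a ∈ A, G.edist x a ≤ r) :
    ∀ a ∈ (grow cap t G A U).1, G.edist x a ≤ ((r + t : ℕ) : ℕ∞) := by
  induction t generalizing A U r with
  | zero => exact h
  | succ t ih =>
    rw [grow]
    split_ifs
    · intro a ha
      refine (h a ha).trans ?_
      exact_mod_cast Nat.le_add_right _ _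
    · have := ih (A := nbr G A U) (U := U \ nbr G A U) (r := r + 1) fun b hb => by
        obtain ⟨-, a, ha, hab⟩ := mem_nbr.1 hb
        exact edist_le_add_one_of_adj (h a ha) hab
      rwa [show r + 1 + t = r + (t + 1) by ring] at this

theorem grow_snd_edist_le (cap t : ℕ) (G : SimpleGraph V) {A U : Finset V} {x : V} {r : ℕ}
    (hAU : Disjoint A U) (h : ∀ v, v ∉ U → G.edist x v ≤ r) :
    ∀ v, v ∉ (grow cap t G A U).2 → G.edist x v ≤ ((r + t : ℕ) : ℕ∞) := by
  induction t generalizing A U r with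
  | zero => exact h
  | succ t ih =>
    rw [grow]
    split_ifs
    · intro a ha
      refine (h a ha).trans ?_
      exact_mod_cast Nat.le_add_right _ _
    · have := ih (A := nbr G A U) (U := U \ nbr G A U) (r := r + 1) disjoint_sdiff fun v hv => by
        by_cases hvU : v ∈ U
        · have hb : v ∈ nbr G A U := by
            by_contra hn; exact hv (Finset.mem_sdiff.2 ⟨hvU, hn⟩)
          obtain ⟨-, a, ha, hab⟩ := mem_nbr.1 hb
          exact edist_le_add_one_of_adj (h a (disjoint_left.1 hAU ha)) hab
        · refine (h v hvU).trans ?_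
          exact_mod_cast Nat.le_add_right _ _
      rwa [show r + 1 + t = r + (t + 1) by ring] at this

/-- Vertices far from the root do not influence the stopped exploration. -/
theorem grow_fst_congr (cap t : ℕ) (G : SimpleGraph V) {A U₁ U₂ : Finset V} {y : V} {r : ℕ}
    (hU : U₁ ⊆ U₂) (h : ∀ a ∈ A, G.edist y a ≤ r)
    (hfar : ∀ v ∈ U₂, v ∉ U₁ → ¬ G.edist y v ≤ ((r + t : ℕ) : ℕ∞)) :
    (grow cap t G A U₁).1 = (grow cap t G A U₂).1 := by
  induction t generalizing A U₁ U₂ r with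
  | zero => rfl
  | succ t ih =>
    have hn : nbr G A U₁ = nbr G A U₂ := by
      ext v
      simp only [mem_nbr]
      constructor
      · exact fun hv => ⟨hU hv.1, hv.2⟩
      · rintro ⟨hv, a, ha, hav⟩
        refine ⟨?_, a, ha, hav⟩
        by_contra hv1
        refine hfar v hv hv1 ((edist_le_add_one_of_adj (h a ha) hav).trans ?_)
        exact_mod_cast by omega
    rw [grow, grow, hn]
    split_ifs
    · rfl
    · refine ih (r := r + 1) (sdiff_subset_sdiff hU le_rfl) ?_ ?_
      · intro b hb
        obtain ⟨-, a, ha, hab⟩ := mem_nbr.1 hb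
        exact edist_le_add_one_of_adj (h a ha) hab
      · intro v hv hv1
        rw [Finset.mem_sdiff] at hv
        have := hfar v hv.1 fun h' => hv1 (Finset.mem_sdiff.2 ⟨h', hv.2⟩)
        rwa [show r + 1 + t = r + (t + 1) by ring]

/-- Invariant of the search: a vertex explored before the last level has no neighbour left among the
unexplored ones. When the last level is empty, the explored set is therefore closed under adjacency.
-/
theorem grow_explored (cap t : ℕ) (G : SimpleGraph V) {A U : Finset V}
    (h : ∀ v, v ∉ U → v ∉ A → ∀ u ∈ U, ¬ G.Adj v u) :
    ∀ v, v ∉ (grow cap t G A U).2 → v ∉ (grow cap t G A U).1 →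
      ∀ u ∈ (grow cap t G A U).2, ¬ G.Adj v u := by
  induction t generalizing A U with
  | zero => exact h
  | succ t ih =>
    rw [grow]
    split_ifs
    · exact h
    · refine ih fun v hv hvn u hu hvu => ?_
      rw [Finset.mem_sdiff] at hv hu
      have hvU : v ∉ U := fun hvU => hv ⟨hvU, hvn⟩
      by_cases hvA : v ∈ A
      · exact hu.2 (mem_nbr.2 ⟨hu.1, v, hvA, hvu⟩)
      · exact h v hvU hvA u hu.1 hvu

theorem mem_of_reachable {G : SimpleGraph V} {C : Set V} (hC : ∀ a ∈ C, ∀ b, G.Adj a b → b ∈ C)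
    {x y : V} (hx : x ∈ C) (h : G.Reachable x y) : y ∈ C := by
  obtain ⟨w⟩ := h
  induction w with
  | nil => exact hx
  | cons hadj _ ih => exact ih (hC _ hx _ hadj)

/-- If the stopped exploration dies out, its root is close to its whole component. -/
theorem edist_le_of_grow_empty (cap t : ℕ) {G : SimpleGraph V} {x y : V}
    (h : (grow cap t G {x} {x}ᶜ).1 = ∅) (hxy : G.Reachable x y) : G.edist x y ≤ t := by
  have hdisj : Disjoint ({x} : Finset V) {x}ᶜ := disjoint_compl_right
  have h1 := grow_snd_edist_le cap t G (x := x) (r := 0) hdisj (by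
    intro v hv
    have : v = x := by simpa using hv
    simp [this])
  have h2 := grow_explored cap t G (A := {x}) (U := {x}ᶜ) (by
    intro v hv hv'
    simp only [mem_compl, not_not] at hv
    exact absurd hv hv')
  rw [zero_add] at h1
  refine h1 y ?_
  have hx : x ∉ (grow cap t G {x} {x}ᶜ).2 := by
    have key : ∀ (t : ℕ) (A U : Finset V), x ∉ U → x ∉ (grow cap t G A U).2 := by
      intro t
      induction t with
      | zero => exact fun A U h => h
      | succ t ih =>
        intro A U hU
        rw [grow]
        split_ifs
        · exact hU
        · exact ih _ _ fun h => hU (Finset.mem_sdiff.1 h).1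
    exact key t _ _ (by simp)
  exact mem_of_reachable (C := {v | v ∉ (grow cap t G {x} {x}ᶜ).2})
    (fun a ha b hab hb => h2 a ha (by simp [h]) b hb hab) hx hxy

/-- A subset of `A` with `min #A cap` elements. -/
noncomputable def thin (cap : ℕ) (A : Finset V) : Finset V :=
  (exists_subset_card_eq (min_le_left #A cap)).choose

theorem thin_subset (cap : ℕ) (A : Finset V) : thin cap A ⊆ A :=
  (exists_subset_card_eq (min_le_left #A cap)).choose_spec.1

theorem card_thin (cap : ℕ) (A : Finset V) : #(thin cap A) = min #A cap :=
  (exists_subset_card_eq (min_le_left #A cap)).choose_spec.2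

/-- The event that the exploration from `y` avoiding `thin cap A` reaches a large level that is not
joined to `thin cap A`. -/
def Unjoined (cap t b : ℕ) (y : V) (A U : Finset V) (G : SimpleGraph V) : Prop :=
  b ≤ #A ∧ y ∈ (A ∪ U) \ thin cap A ∧
    b ≤ #(grow cap t G {y} (((A ∪ U) \ thin cap A).erase y)).1 ∧
    ∀ a ∈ thin cap A, ∀ m ∈ (grow cap t G {y} (((A ∪ U) \ thin cap A).erase y)).1, ¬ G.Adj a m

theorem dep_unjoined (cap t b : ℕ) (y : V) (A U : Finset V) :
    Dep (Within (A ∪ U)) (Unjoined cap t b y A U) := by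
  intro G H h
  unfold Unjoined
  by_cases hy : y ∈ (A ∪ U) \ thin cap A
  · have hsub : {y} ∪ ((A ∪ U) \ thin cap A).erase y = (A ∪ U) \ thin cap A := by
      rw [← insert_eq, insert_erase hy]
    have h1 : grow cap t G {y} (((A ∪ U) \ thin cap A).erase y) =
        grow cap t H {y} (((A ∪ U) \ thin cap A).erase y) := by
      refine dep_grow cap t _ _ G H fun a b hab => h a b ?_
      rw [Within, hsub] at hab
      exact ⟨(Finset.mem_sdiff.1 hab.1).1, (Finset.mem_sdiff.1 hab.2).1⟩
    rw [h1]
    refine propext (and_congr_right fun _ => and_congr_right fun _ => and_congr_right fun _ =>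
      forall₂_congr fun a ha => forall₂_congr fun m hm => ?_)
    rw [h a m ⟨mem_union_left _ (thin_subset _ _ ha), ?_⟩]
    have := grow_subset _ _ _ _ _ (mem_union_left _ hm)
    rw [hsub] at this
    exact (Finset.mem_sdiff.1 this).1
  · simp [hy]

/-- If `x` and `y` are more than `2 * t + 1` apart, the two balls of radius `t` are disjoint, so
forbidding the second search to use what the first one explored changes nothing, and an edge between
the two last levels would give a path of length at most `2 * t + 1`. The point of the restricted
search is that it uses only pairs not yet examined. -/
theorem unjoined_of_far (cap t b : ℕ) {G : SimpleGraph V} {x y : V}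
    (hxy : ¬ G.edist x y ≤ ((2 * t + 1 : ℕ) : ℕ∞))
    (hbx : b ≤ #(grow cap t G {x} {x}ᶜ).1) (hby : b ≤ #(grow cap t G {y} {y}ᶜ).1) :
    Unjoined cap t b y (grow cap t G {x} {x}ᶜ).1 (grow cap t G {x} {x}ᶜ).2 G := by
  have hdisj : Disjoint ({x} : Finset V) {x}ᶜ := disjoint_compl_right
  have hd := grow_disjoint cap t G hdisj
  have h1 := grow_snd_edist_le cap t G (x := x) (r := 0) hdisj (by
    intro v hv
    have : v = x := by simpa using hv
    simp [this])
  rw [zero_add] at h1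
  set A := (grow cap t G {x} {x}ᶜ).1
  set U := (grow cap t G {x} {x}ᶜ).2
  have hyU : y ∈ U := by
    by_contra hy
    refine hxy ((h1 y hy).trans ?_)
    exact_mod_cast by omega
  have hyA : y ∉ A := disjoint_right.1 hd hyU
  have hy' : y ∈ (A ∪ U) \ thin cap A :=
    Finset.mem_sdiff.2 ⟨mem_union_right _ hyU, fun h => hyA (thin_subset _ _ h)⟩
  have hst : (grow cap t G {y} (((A ∪ U) \ thin cap A).erase y)).1 = (grow cap t G {y} {y}ᶜ).1 := by
    refine grow_fst_congr cap t G (y := y) (r := 0) ?_ (by simp) ?_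
    · intro v hv; simpa using (mem_erase.1 hv).1
    · intro v hv hv' hyv
      have hvU : v ∉ U := by
        intro hvU
        refine hv' (mem_erase.2 ⟨by simpa using hv, Finset.mem_sdiff.2 ⟨mem_union_right _ hvU, ?_⟩⟩)
        exact fun h => disjoint_right.1 hd hvU (thin_subset _ _ h)
      refine hxy ((G.edist_triangle (v := v)).trans ?_)
      rw [G.edist_comm (u := v)]
      refine (add_le_add (h1 v hvU) hyv).trans ?_
      exact_mod_cast by omega
  refine ⟨hbx, hy', by rwa [hst], ?_⟩
  intro a ha m hm ham
  rw [hst] at hm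
  have h2 := h1 a (disjoint_left.1 hd (thin_subset _ _ ha))
  have h3 := grow_fst_edist_le cap t G (A := {y}) (U := {y}ᶜ) (x := y) (r := 0) (by simp) m hm
  have h4 := edist_le_add_one_of_adj h2 ham
  refine hxy ((G.edist_triangle (v := m)).trans ?_)
  rw [G.edist_comm (u := m)]
  refine (add_le_add h4 h3).trans ?_
  exact_mod_cast by omega

/-- The error term in the lower tail bound. -/
noncomputable def tailErr (l κ z η : ℝ) (t : ℕ) : ℝ :=
  κ ^ t * ((1 - vit l t (1 - z)) - (1 - vit l t 1)) + η

theorem tailErr_nonneg {l κ z η : ℝ} (hl : 0 ≤ l) (hκ : 0 ≤ κ) (hz : 0 ≤ z)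
    (hη : 0 ≤ η) (t : ℕ) : 0 ≤ tailErr l κ z η t := by
  have := vit_mono hl t (v := 1 - z) (w := 1) (by linarith)
  have := mul_nonneg (pow_nonneg hκ t) (by linarith :
    0 ≤ (1 - vit l t (1 - z)) - (1 - vit l t 1))
  rw [tailErr]; linarith

variable {p : ℝ} {l κ z η : ℝ} {cap N0 b : ℕ}

/-- For levels of sizes `a, m ≥ b` one has `a * m + b ^ 2 ≥ b * a + b * m`, so the probability that
they are not joined is at most a constant times `z ^ a * z ^ m`. This separates the two searches.
The second factor is averaged over the search from `y` by `gnpE_grow_le`; the first is left in the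
form that `gnpE_grow_le` accepts for the search from `x`. Thinning `A` to at most `cap` vertices
keeps enough vertices for the second search. -/
theorem gnpP_unjoined_le (hp : 0 ≤ p) (hp1 : p < 1)
    (hl : 0 ≤ l) (hκ : 0 ≤ κ) (hz : z = (1 - p) ^ b) (hη : z ^ cap ≤ η) (hb : 1 ≤ b)
    (hbc : b ≤ cap) (hN0 : 1 ≤ N0)
    (hstep : ∀ a N : ℕ, 1 ≤ a → a < cap → N0 ≤ N → N ≤ Fintype.card V →
      l * a ≤ (N - 1) * hitProb p a ∧ N * hitProb p a ≤ κ * (l * a))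
    (t : ℕ) (y : V) (A U : Finset V) (hcard : N0 + (t + 2) * cap ≤ #(A ∪ U)) :
    gnpP p (Unjoined cap t b y A U) ≤
      if A = ∅ then 0 else (((1 - p) ^ b ^ 2)⁻¹ * tailErr l κ z η t) * z ^ min #A cap := by
  have hq : 0 < 1 - p := by linarith
  have hq1 : 1 - p ≤ 1 := by linarith
  have hz0 : 0 < z := by rw [hz]; positivity
  have hz1 : z ≤ 1 := by rw [hz]; exact pow_le_one₀ hq.le hq1
  have hη0 : 0 ≤ η := le_trans (pow_nonneg hz0.le _) hη
  have hT := tailErr_nonneg (κ := κ) (η := η) hl hκ hz0.le hη0 t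
  have hrhs : 0 ≤ if A = ∅ then 0 else
      (((1 - p) ^ b ^ 2)⁻¹ * tailErr l κ z η t) * z ^ min #A cap := by
    split_ifs
    · exact le_rfl
    · positivity
  by_cases hA : b ≤ #A ∧ y ∈ (A ∪ U) \ thin cap A
  swap
  · have : gnpP p (Unjoined cap t b y A U) = 0 := by
      have h0 : ∀ G, ¬ Unjoined cap t b y A U G := fun G h => hA ⟨h.1, h.2.1⟩
      simp only [gnpP, ind_of_not (h0 _), gnpE_const]
    rw [this]; exact hrhs
  obtain ⟨hbA, hy⟩ := hA
  have hA0 : A ≠ ∅ := by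
    rintro rfl; simp at hbA; omega
  rw [if_neg hA0]
  set W := (A ∪ U) \ thin cap A with hW
  have hsub : {y} ∪ W.erase y = W := by rw [← insert_eq, insert_erase hy]
  have hMW : ∀ G, (grow cap t G {y} (W.erase y)).1 ⊆ W := fun G => by
    have := subset_union_left.trans (grow_subset cap t G {y} (W.erase y))
    rwa [hsub] at this
  have hdW : Disjoint (thin cap A) W := disjoint_sdiff
  have hWcard : N0 + (t + 1) * cap ≤ #W := by
    have h1 : #W = #(A ∪ U) - #(thin cap A) :=
      card_sdiff_of_subset ((thin_subset _ _).trans subset_union_left)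
    have h2 := card_thin cap A
    have h3 : (t + 2) * cap = (t + 1) * cap + cap := by ring
    have h4 := min_le_right #A cap
    omega
  -- Split according to the last level `M` of the second search. It is determined by pairs inside
  -- `W`, hence independent of the pairs between `thin cap A` and `M`.
  have hle : ∀ G, ind (Unjoined cap t b y A U G) ≤ ∑ M ∈ W.powerset,
      ind ((grow cap t G {y} (W.erase y)).1 = M ∧ b ≤ #M) *
        ind (∀ a ∈ thin cap A, ∀ m ∈ M, ¬ G.Adj a m) := by
    intro G
    by_cases hG : Unjoined cap t b y A U G
    · obtain ⟨-, -, h3, h4⟩ := hG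
      have h5 := single_le_sum (f := fun M => ind ((grow cap t G {y} (W.erase y)).1 = M ∧ b ≤ #M) *
        ind (∀ a ∈ thin cap A, ∀ m ∈ M, ¬ G.Adj a m))
        (fun M _ => mul_nonneg (ind_nonneg _) (ind_nonneg _)) (mem_powerset.2 (hMW G))
      beta_reduce at h5
      rw [ind_of ⟨rfl, h3⟩, ind_of h4, one_mul] at h5
      exact (ind_le_one _).trans h5
    · rw [ind_of_not hG]
      exact sum_nonneg fun M _ => mul_nonneg (ind_nonneg _) (ind_nonneg _)
  have hmain : gnpE p (fun G => ind ((grow cap t G {y} (W.erase y)).1 ≠ ∅) *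
      z ^ #(grow cap t G {y} (W.erase y)).1) ≤ tailErr l κ z η t := by
    have := gnpE_grow_le hp hp1.le hl hκ hz0.le hz1 hη zero_le_one hN0 hstep
      (fun A _ _ => ind (A ≠ ∅) * z ^ #A) (fun _ _ => Dep.const _ _) (by
        intro A U _ _
        rw [gnpE_const]
        split_ifs with h
        · simp [ind, h]
        · rw [ind_of h]
          refine mul_le_mul_of_nonneg_left ?_ zero_le_one
          exact pow_le_pow_of_le_one hz0.le hz1 (min_le_left _ _)) t {y} (W.erase y)
      (by simp) (by rwa [hsub])
    simpa [tailErr] using this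
  calc gnpP p (Unjoined cap t b y A U)
      ≤ gnpE p (fun G => ∑ M ∈ W.powerset,
      ind ((grow cap t G {y} (W.erase y)).1 = M ∧ b ≤ #M) *
        ind (∀ a ∈ thin cap A, ∀ m ∈ M, ¬ G.Adj a m)) := gnpE_mono hp hp1.le hle
    _ = ∑ M ∈ W.powerset, gnpE p (fun G => ind ((grow cap t G {y} (W.erase y)).1 = M ∧ b ≤ #M)) *
        (1 - p) ^ (#(thin cap A) * #M) := by
        rw [gnpE_sum]
        refine sum_congr rfl fun M hM => ?_
        rw [mem_powerset] at hM
        rw [gnpE_mul_of_dep p (R := Within W) (R' := fun a m => a ∈ thin cap A ∧ m ∈ M)]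
        · congr 1
          exact gnpP_no_edges p _ _ (hdW.mono_right hM)
        · have := (dep_grow cap t {y} (W.erase y)).comp fun s => ind (s.1 = M ∧ b ≤ #M)
          rwa [hsub] at this
        · intro G H h
          have : (∀ a ∈ thin cap A, ∀ m ∈ M, ¬ G.Adj a m) ↔
              ∀ a ∈ thin cap A, ∀ m ∈ M, ¬ H.Adj a m :=
            forall₂_congr fun a ha => forall₂_congr fun m hm => not_congr (h a m ⟨ha, hm⟩)
          simp only [this]
        · rintro a c ⟨ha, hc⟩
          exact ⟨fun h => disjoint_left.1 hdW h.1 ha, fun h => disjoint_left.1 hdW h.1 hc⟩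
    _ ≤ ∑ M ∈ W.powerset, gnpE p (fun G => ind ((grow cap t G {y} (W.erase y)).1 = M ∧ b ≤ #M)) *
        (((1 - p) ^ b ^ 2)⁻¹ * z ^ min #A cap * z ^ #M) := by
        refine sum_le_sum fun M _ => ?_
        by_cases hM : b ≤ #M
        · refine mul_le_mul_of_nonneg_left ?_ (gnpE_nonneg hp hp1.le fun _ => ind_nonneg _)
          rw [card_thin, mul_assoc, inv_mul_eq_div, le_div_iff₀ (by positivity), hz, ← pow_mul,
            ← pow_mul, ← pow_add, ← pow_add]
          refine pow_le_pow_of_le_one hq.le hq1 ?_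
          -- The product of the two nonnegative excesses over `b` is what makes the exponent
          -- inequality true.
          have h1 : b ≤ min #A cap := le_min hbA hbc
          obtain ⟨c, hc⟩ := Nat.exists_eq_add_of_le h1
          obtain ⟨d, hd⟩ := Nat.exists_eq_add_of_le hM
          rw [hc, hd]
          nlinarith [Nat.zero_le (c * d)]
        · simp [ind, hM, gnpE_const]
    _ = ((1 - p) ^ b ^ 2)⁻¹ * z ^ min #A cap * gnpE p (fun G => ∑ M ∈ W.powerset,
        ind ((grow cap t G {y} (W.erase y)).1 = M ∧ b ≤ #M) * z ^ #M) := by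
        rw [gnpE_sum, mul_sum]
        refine sum_congr rfl fun M _ => ?_
        have : (fun G : SimpleGraph V => ind ((grow cap t G {y} (W.erase y)).1 = M ∧ b ≤ #M) *
          z ^ #M) = fun G => z ^ #M * ind ((grow cap t G {y} (W.erase y)).1 = M ∧ b ≤ #M) := by
          ext G; ring
        rw [this, gnpE_const_mul]; ring
    _ ≤ ((1 - p) ^ b ^ 2)⁻¹ * z ^ min #A cap * tailErr l κ z η t := by
        refine mul_le_mul_of_nonneg_left (le_trans (gnpE_mono hp hp1.le fun G => ?_) hmain)
          (by positivity)
        rw [sum_eq_single (grow cap t G {y} (W.erase y)).1]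
        · refine mul_le_mul_of_nonneg_right (ind_mono ?_) (by positivity)
          rintro ⟨-, h⟩ h'
          rw [h', card_empty] at h
          omega
        · intro M _ hM
          rw [ind_of_not fun h => hM h.1.symm, zero_mul]
        · intro h
          exact absurd (mem_powerset.2 (hMW G)) h
    _ = _ := by ring

/-- With high probability any two vertices whose explorations survive are at bounded distance. -/
theorem gnpP_exists_far_le (hp : 0 ≤ p) (hp1 : p < 1)
    (hl : 0 ≤ l) (hκ : 0 ≤ κ) (hz : z = (1 - p) ^ b) (hη : z ^ cap ≤ η) (hb : 1 ≤ b)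
    (hbc : b ≤ cap) (hN0 : 1 ≤ N0)
    (hstep : ∀ a N : ℕ, 1 ≤ a → a < cap → N0 ≤ N → N ≤ Fintype.card V →
      l * a ≤ (N - 1) * hitProb p a ∧ N * hitProb p a ≤ κ * (l * a))
    (t : ℕ) (hcard : N0 + (2 * t + 3) * cap ≤ Fintype.card V) :
    gnpP p (fun G : SimpleGraph V => ∃ x y, (grow cap t G {x} {x}ᶜ).1 ≠ ∅ ∧
        (grow cap t G {y} {y}ᶜ).1 ≠ ∅ ∧ ¬ G.edist x y ≤ ((2 * t + 1 : ℕ) : ℕ∞)) ≤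
      Fintype.card V * ((z ^ b)⁻¹ * tailErr l κ z η t) +
        (Fintype.card V : ℝ) ^ 2 * (((1 - p) ^ b ^ 2)⁻¹ * tailErr l κ z η t ^ 2) := by
  have hq : 0 < 1 - p := by linarith
  have hq1 : 1 - p ≤ 1 := by linarith
  have hz0 : 0 < z := by rw [hz]; positivity
  have hz1 : z ≤ 1 := by rw [hz]; exact pow_le_one₀ hq.le hq1
  have hη0 : 0 ≤ η := le_trans (pow_nonneg hz0.le _) hη
  have hT := tailErr_nonneg (κ := κ) (η := η) hl hκ hz0.le hη0 t
  have hcov : ∀ x : V, #({x} ∪ {x}ᶜ : Finset V) = Fintype.card V := fun x => by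
    rw [union_compl, card_univ]
  have hr : (2 * t + 3) * cap = (t + 2) * cap + (t + 1) * cap := by ring
  have hr2 : (t + 2) * cap = (t + 1) * cap + cap := by ring
  -- Markov's inequality: on a nonempty level with fewer than `b` vertices the variable `z ^ #A` is
  -- at least `z ^ b`.
  have hsmall : ∀ x : V, gnpP p (fun G => (grow cap t G {x} {x}ᶜ).1 ≠ ∅ ∧
      #(grow cap t G {x} {x}ᶜ).1 < b) ≤ (z ^ b)⁻¹ * tailErr l κ z η t := by
    intro x
    have := gnpE_grow_le hp hp1.le hl hκ hz0.le hz1 hη (by positivity : 0 ≤ (z ^ b)⁻¹) hN0 hstep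
      (fun A _ _ => ind (A ≠ ∅ ∧ #A < b)) (fun _ _ => Dep.const _ _) (by
        intro A U _ _
        rw [gnpE_const]
        split_ifs with h
        · simp [ind, h]
        · by_cases hA : #A < b
          · rw [inv_mul_eq_div, le_div_iff₀ (by positivity)]
            refine (mul_le_of_le_one_left (by positivity) (ind_le_one _)).trans ?_
            exact pow_le_pow_of_le_one hz0.le hz1 ((min_le_left _ _).trans hA.le)
          · rw [ind_of_not fun h => hA h.2]; positivity) t {x} {x}ᶜ disjoint_compl_right
      (by rw [hcov]; omega)
    simpa [tailErr, gnpP] using this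
  have hpair : ∀ x y : V, gnpP p (fun G => Unjoined cap t b y (grow cap t G {x} {x}ᶜ).1
      (grow cap t G {x} {x}ᶜ).2 G) ≤ ((1 - p) ^ b ^ 2)⁻¹ * tailErr l κ z η t ^ 2 := by
    intro x y
    -- The conditional bound for `y` is itself a multiple of `z ^ min #A cap`, so the same tail
    -- bound applies once more, to the search from `x`, and yields the square of `tailErr`.
    have := gnpE_grow_le (N0 := N0 + (t + 2) * cap) hp hp1.le hl hκ hz0.le hz1 hη
      (by positivity : 0 ≤ ((1 - p) ^ b ^ 2)⁻¹ * tailErr l κ z η t) (by omega)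
      (fun a N h1 h2 h3 h4 => hstep a N h1 h2 (by omega) h4)
      (fun A U G => ind (Unjoined cap t b y A U G))
      (fun A U => (dep_unjoined cap t b y A U).comp ind)
      (fun A U _ hN => gnpP_unjoined_le hp hp1 hl hκ hz hη hb hbc hN0 hstep t y A U hN)
      t {x} {x}ᶜ disjoint_compl_right (by rw [hcov]; omega)
    simp only [card_singleton, pow_one] at this
    refine le_trans this (le_of_eq ?_)
    rw [tailErr]; ring
  calc _ ≤ gnpP p (fun G : SimpleGraph V => (∃ x ∈ univ, (grow cap t G {x} {x}ᶜ).1 ≠ ∅ ∧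
        #(grow cap t G {x} {x}ᶜ).1 < b) ∨ ∃ q ∈ (univ : Finset (V × V)),
        Unjoined cap t b q.2 (grow cap t G {q.1} {q.1}ᶜ).1 (grow cap t G {q.1} {q.1}ᶜ).2 G) := by
        refine gnpP_mono hp hp1.le ?_
        rintro G ⟨x, y, hx, hy, hxy⟩
        by_cases hx' : b ≤ #(grow cap t G {x} {x}ᶜ).1
        · by_cases hy' : b ≤ #(grow cap t G {y} {y}ᶜ).1
          · exact Or.inr ⟨(x, y), mem_univ _, unjoined_of_far cap t b hxy hx' hy'⟩
          · exact Or.inl ⟨y, mem_univ _, hy, not_le.1 hy'⟩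
        · exact Or.inl ⟨x, mem_univ _, hx, not_le.1 hx'⟩
    _ ≤ _ := by
        refine (gnpP_or_le hp hp1.le _ _).trans (add_le_add ?_ ?_)
        · refine (gnpP_exists_le hp hp1.le _ _).trans ((sum_le_sum fun x _ => hsmall x).trans ?_)
          rw [sum_const, card_univ, nsmul_eq_mul]
        · refine (gnpP_exists_le hp hp1.le _ _).trans
            ((sum_le_sum fun q _ => hpair q.1 q.2).trans ?_)
          rw [sum_const, card_univ, nsmul_eq_mul, Fintype.card_prod]
          push_cast
          rw [← sq]

end TwoExplorations

/-! ### The growth iteration -/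

section Growth

theorem exp_neg_sub_exp_neg_le {a b : ℝ} (ha : 0 ≤ a) :
    Real.exp (-a) - Real.exp (-b) ≤ |b - a| := by
  have h1 : Real.exp (-b) = Real.exp (-a) * Real.exp (-(b - a)) := by
    rw [← Real.exp_add]; congr 1; ring
  have h2 := Real.add_one_le_exp (-(b - a))
  have h3 : Real.exp (-a) ≤ 1 := Real.exp_le_one_iff.2 (by linarith)
  have h4 := Real.exp_pos (-a)
  have h5 := le_abs_self (b - a)
  have h6 := abs_nonneg (b - a)
  rw [h1]
  nlinarith

/-- In terms of reciprocals the growth iteration becomes subaffine; this is the source of the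
explicit bounds on `vit`, both supercritical and subcritical. -/
theorem inv_one_sub_exp_neg_le {x : ℝ} (hx : 0 < x) : (1 - Real.exp (-x))⁻¹ ≤ x⁻¹ + 1 := by
  have h1 : Real.exp (-x) ≤ (1 + x)⁻¹ := by
    rw [Real.exp_neg]
    exact inv_anti₀ (by linarith) (by linarith [Real.add_one_le_exp x])
  have h2 : x / (1 + x) ≤ 1 - Real.exp (-x) := by
    have : x / (1 + x) = 1 - (1 + x)⁻¹ := by field_simp; ring
    linarith
  have h3 : x⁻¹ + 1 = (x / (1 + x))⁻¹ := by field_simp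
  rw [h3]
  exact inv_anti₀ (by positivity) h2

theorem vit_pos {l : ℝ} (hl : 0 < l) {v : ℝ} (hv : 0 < v) (t : ℕ) : 0 < vit l t v := by
  induction t with
  | zero => exact hv
  | succ t ih =>
    rw [vit, sub_pos, Real.exp_lt_one_iff]
    have := mul_pos hl ih
    linarith

/-- The reciprocals satisfy `1 / v' ≤ 1 / (l * v) + 1`, an affine recursion with fixed point `l / (l
- 1)`. So a small `v` grows at the full rate `l` until it reaches constant size. -/
theorem inv_vit_le {l : ℝ} (hl : 1 < l) {v : ℝ} (hv : 0 < v) (t : ℕ) :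
    (vit l t v)⁻¹ ≤ (l ^ t)⁻¹ * v⁻¹ + l / (l - 1) := by
  have hl0 : 0 < l := by linarith
  have hl1 : 0 < l - 1 := by linarith
  induction t with
  | zero =>
    have : 0 ≤ l / (l - 1) := by positivity
    simp only [vit, pow_zero, inv_one, one_mul]; linarith
  | succ t ih =>
    rw [vit]
    refine (inv_one_sub_exp_neg_le (mul_pos hl0 (vit_pos hl0 hv t))).trans ?_
    have h1 : (l * vit l t v)⁻¹ = l⁻¹ * (vit l t v)⁻¹ := mul_inv _ _
    have h2 := mul_le_mul_of_nonneg_left ih (by positivity : 0 ≤ l⁻¹)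
    have h3 : l⁻¹ * ((l ^ t)⁻¹ * v⁻¹ + l / (l - 1)) + 1 =
        (l ^ (t + 1))⁻¹ * v⁻¹ + l / (l - 1) := by
      field_simp; ring
    rw [h1]; linarith

/-- Tangent line bound for the exponential at the lower trajectory: the gap between the trajectories
shrinks by the derivative of the iteration there. -/
theorem vit_sub_succ_le (l v : ℝ) (t : ℕ) :
    vit l (t + 1) 1 - vit l (t + 1) v ≤
      l * Real.exp (-(l * vit l t v)) * (vit l t 1 - vit l t v) := by
  have h1 : Real.exp (-(l * vit l t 1)) =
      Real.exp (-(l * vit l t v)) * Real.exp (-(l * (vit l t 1 - vit l t v))) := by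
    rw [← Real.exp_add]; congr 1; ring
  have h2 := Real.add_one_le_exp (-(l * (vit l t 1 - vit l t v)))
  have h3 := Real.exp_pos (-(l * vit l t v))
  simp only [vit]
  rw [h1]
  nlinarith

theorem inv_one_sub_pow_le {ε : ℝ} (h0 : 0 ≤ ε) (h1 : ε ≤ 1 / 2) (t : ℕ) :
    ((1 - ε) ^ t)⁻¹ ≤ Real.exp (2 * (ε * t)) := by
  have h2 : (1 - ε)⁻¹ ≤ Real.exp (2 * ε) := by
    have : (1 - ε)⁻¹ ≤ 2 * ε + 1 := by
      rw [inv_eq_one_div, div_le_iff₀ (by linarith)]; nlinarith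
    exact this.trans (Real.add_one_le_exp _)
  rw [← inv_pow]
  refine (pow_le_pow_left₀ (inv_nonneg.2 (by linarith)) h2 t).trans (le_of_eq ?_)
  rw [← Real.exp_nat_mul]; congr 1; ring

variable {lam lamStar : ℝ}

set_option maxHeartbeats 1000000 in
/-- The decay rate of the difference of two trajectories of the growth iteration. -/
theorem exists_vit_sub_le (hlam : 1 < lam) (h0 : 0 < lamStar) (h1 : lamStar < 1)
    (hdual : lamStar * Real.exp (-lamStar) = lam * Real.exp (-lam)) :
    ∃ C : ℝ, 0 < C ∧ ∀ ε : ℝ, 0 ≤ ε → ε ≤ (lam - 1) / (2 * lam) → ∀ (t : ℕ) (v : ℝ),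
      0 < v → v ≤ 1 → ε * t ≤ 1 →
      vit (lam * (1 - ε)) t 1 - vit (lam * (1 - ε)) t v ≤
        C * lamStar ^ t * v ^ (-(Real.log (1 / lamStar) / Real.log lam)) := by
  have hlam0 : 0 < lam := by linarith
  -- The survival probability, positive fixed point of `v ↦ 1 - exp (-lam * v)`. The derivative of
  -- this map at `ρ` is `lamStar`.
  set ρ : ℝ := 1 - lamStar / lam with hρ
  have hfix : Real.exp (-(lam * ρ)) = 1 - ρ := by
    have e1 : -(lam * ρ) = lamStar + -lam := by rw [hρ]; field_simp; ring
    rw [e1, Real.exp_add, hρ, sub_sub_cancel, eq_div_iff hlam0.ne', mul_assoc,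
      mul_comm (Real.exp (-lam)), ← hdual, mul_comm lamStar, ← mul_assoc, ← Real.exp_add]
    simp
  have hρ0 : 0 < ρ := by
    rw [hρ, sub_pos, div_lt_one hlam0]; linarith
  have hρ1 : ρ < 1 := by
    rw [hρ]; linarith [div_pos h0 hlam0]
  -- Bound for the reciprocal of the trajectory once the initial growth phase is over: the first
  -- summand comes from the decaying term of `inv_vit_le`, the second bounds `l / (l - 1)` for all
  -- `l ≥ (lam + 1) / 2`.
  set R : ℝ := Real.exp 2 + (lam + 1) / (lam - 1) with hR
  have hlm : 0 < lam - 1 := by linarith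
  have hR0 : 0 < R := by positivity
  set c : ℝ := min R⁻¹ (min (ρ / 2) ((lam - 1) / (2 * lam))) with hc
  have hc0 : 0 < c := lt_min (by positivity) (lt_min (by positivity) (by positivity))
  have hcR : c ≤ R⁻¹ := min_le_left _ _
  have hcρ : c ≤ ρ / 2 := (min_le_right _ _).trans (min_le_left _ _)
  have hcl : c ≤ (lam - 1) / (2 * lam) := (min_le_right _ _).trans (min_le_right _ _)
  have hgc : c < 1 - Real.exp (-(lam * c)) := by
    have e1 := inv_one_sub_exp_neg_le (mul_pos hlam0 hc0)
    have e2 : 0 < 1 - Real.exp (-(lam * c)) := by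
      rw [sub_pos, Real.exp_lt_one_iff]; linarith [mul_pos hlam0 hc0]
    refine (inv_lt_inv₀ e2 hc0).1 (e1.trans_lt ?_)
    rw [mul_inv]
    have e3 : lam * c < lam - 1 := by
      rw [le_div_iff₀ (by positivity)] at hcl
      nlinarith
    have e4 : c * c⁻¹ = 1 := mul_inv_cancel₀ hc0.ne'
    have e5 : lam * lam⁻¹ = 1 := mul_inv_cancel₀ hlam0.ne'
    have : lam⁻¹ * c⁻¹ + 1 = lam⁻¹ * c⁻¹ * (1 + lam * c) := by
      field_simp
    rw [this]
    have e6 : lam⁻¹ * c⁻¹ * (1 + lam * c) < lam⁻¹ * c⁻¹ * lam :=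
      mul_lt_mul_of_pos_left (by linarith) (by positivity)
    refine e6.trans_le (le_of_eq ?_)
    field_simp
  have hρc : 0 < ρ - c := by linarith
  -- Slope of the chord of `v ↦ 1 - exp (-lam * v)` over `[c, ρ]`. It is below one because the map
  -- exceeds the identity at `c`, and by concavity the map lies above the chord. Hence the deficit
  -- below `ρ` contracts by `θ` on `[c, ρ]`.
  set θ : ℝ := (ρ - (1 - Real.exp (-(lam * c)))) / (ρ - c) with hθ
  have hθ1 : θ < 1 := by
    rw [hθ, div_lt_one hρc]; linarith
  have hθ0 : 0 ≤ θ := by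
    refine div_nonneg ?_ hρc.le
    have : Real.exp (-(lam * ρ)) ≤ Real.exp (-(lam * c)) :=
      Real.exp_le_exp.2 (neg_le_neg (mul_le_mul_of_nonneg_left (by linarith) hlam0.le))
    linarith
  have hchord : ∀ v, c ≤ v → ρ - (1 - Real.exp (-(lam * v))) ≤ θ * max (ρ - v) 0 := by
    intro v hv
    rcases le_total ρ v with hvρ | hvρ
    · rw [max_eq_right (by linarith), mul_zero]
      have : Real.exp (-(lam * v)) ≤ Real.exp (-(lam * ρ)) :=
        Real.exp_le_exp.2 (neg_le_neg (mul_le_mul_of_nonneg_left hvρ hlam0.le))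
      linarith
    · rw [max_eq_left (by linarith)]
      set τ : ℝ := (ρ - v) / (ρ - c) with hτ
      have hτ0 : 0 ≤ τ := div_nonneg (by linarith) hρc.le
      have hτ1 : τ ≤ 1 := by rw [hτ, div_le_one hρc]; linarith
      have hconv := convexOn_exp.2 (Set.mem_univ (-(lam * c))) (Set.mem_univ (-(lam * ρ))) hτ0
        (by linarith : 0 ≤ 1 - τ) (by ring)
      simp only [smul_eq_mul] at hconv
      have e1 : τ * (ρ - c) = ρ - v := by rw [hτ]; field_simp
      have e2 : τ * -(lam * c) + (1 - τ) * -(lam * ρ) = -(lam * v) := by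
        linear_combination lam * e1
      have e3 : θ * (ρ - v) = τ * (ρ - (1 - Real.exp (-(lam * c)))) := by
        rw [hθ, hτ]; field_simp
      rw [e2, hfix] at hconv
      rw [e3]; linarith
  -- Bounds the sum of all deficits below `ρ`: an initial deficit of at most one, plus perturbations
  -- `lam * ε` at each of the at most `1 / ε` steps, summed geometrically.
  set D : ℝ := (1 + lam) / (1 - θ) with hD
  have hD0 : 0 ≤ D := div_nonneg (by linarith) (by linarith)
  refine ⟨Real.exp (lam * D + lam) / lamStar, by positivity, ?_⟩
  intro ε hε0 hε1 t v hv hv1 hεt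
  set l : ℝ := lam * (1 - ε) with hl
  have hεh : ε ≤ 1 / 2 := by
    refine hε1.trans ?_
    rw [div_le_div_iff₀ (by positivity) (by norm_num)]; linarith
  have hll : (lam + 1) / 2 ≤ l := by
    rw [le_div_iff₀ (by positivity)] at hε1
    rw [hl]; linarith
  have hl1 : 1 < l := by linarith
  have hl0 : 0 < l := by linarith
  have hllam : l ≤ lam := by rw [hl]; exact mul_le_of_le_one_right hlam0.le (by linarith)
  set α : ℝ := Real.log (1 / lamStar) / Real.log lam with hα
  have hlog : 0 < Real.log lam := Real.log_pos hlam
  have hlogs : 0 < Real.log (1 / lamStar) := Real.log_pos (by rw [lt_div_iff₀ h0]; linarith)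
  -- Length of the growth phase: after `J` steps `v` has been multiplied by `lam ^ J ≥ 1 / v`. The
  -- price is `lamStar ^ (-J)`, which is `v ^ (-α)` up to the factor `1 / lamStar` caused by
  -- rounding up.
  set J : ℕ := ⌈Real.log (1 / v) / Real.log lam⌉₊ with hJ
  have hlogv : 0 ≤ Real.log (1 / v) := Real.log_nonneg (by rw [le_div_iff₀ hv]; linarith)
  have hJ1 : Real.log (1 / v) / Real.log lam ≤ J := Nat.le_ceil _
  have hJ2 : (J : ℝ) < Real.log (1 / v) / Real.log lam + 1 := Nat.ceil_lt_add_one (by positivity)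
  clear_value J α l θ c R D ρ
  have hJv : v⁻¹ ≤ lam ^ J := by
    rw [div_le_iff₀ hlog] at hJ1
    rw [← Real.exp_log hlam0, ← Real.exp_nat_mul, ← one_div, ← Real.exp_log (x := 1 / v) (by positivity)]
    exact Real.exp_le_exp.2 hJ1
  have hvα : v ^ (-α) = Real.exp (Real.log (1 / v) / Real.log lam * Real.log (1 / lamStar)) := by
    rw [Real.rpow_def_of_pos hv]
    congr 1
    rw [one_div v, Real.log_inv, hα]; ring
  have hJs : (lamStar ^ J)⁻¹ ≤ v ^ (-α) / lamStar := by
    have e1 : (lamStar ^ J)⁻¹ = Real.exp (J * Real.log (1 / lamStar)) := by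
      rw [Real.exp_nat_mul, Real.exp_log (by positivity), one_div, inv_pow]
    have e2 : v ^ (-α) / lamStar = Real.exp ((Real.log (1 / v) / Real.log lam + 1) *
        Real.log (1 / lamStar)) := by
      rw [add_mul, Real.exp_add, ← hvα, one_mul, Real.exp_log (by positivity)]; ring
    rw [e1, e2]
    exact Real.exp_le_exp.2 (mul_le_mul_of_nonneg_right hJ2.le hlogs.le)
  have hvit0 : ∀ s, 0 ≤ vit l s v := fun s => (vit_pos hl0 hv s).le
  have hvit1 : ∀ s, vit l s v ≤ 1 := fun s => (vit_mem hl0.le s hv.le hv1).2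
  have hΔ1 : ∀ s, vit l s 1 - vit l s v ≤ 1 := fun s => by
    have := (vit_mem hl0.le s (v := 1) (by norm_num) le_rfl).2
    linarith [hvit0 s]
  have hconst : 1 ≤ Real.exp (lam * D + lam) := Real.one_le_exp (by positivity)
  have hprod : ∀ m : ℝ, m ≤ 1 * (lamStar ^ t * (lamStar ^ J)⁻¹) * Real.exp (lam * D + lam) →
      m ≤ Real.exp (lam * D + lam) / lamStar * lamStar ^ t * v ^ (-α) := by
    intro m hm
    refine hm.trans ?_
    have := mul_le_mul_of_nonneg_left hJs
      (by positivity : 0 ≤ lamStar ^ t * Real.exp (lam * D + lam))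
    calc _ = lamStar ^ t * Real.exp (lam * D + lam) * (lamStar ^ J)⁻¹ := by ring
      _ ≤ _ := this
      _ = _ := by ring
  apply hprod
  -- During the growth phase the trivial bound `1` for the gap is enough.
  rcases lt_or_ge t J with htJ | htJ
  · refine (hΔ1 t).trans ?_
    have : 1 ≤ lamStar ^ t * (lamStar ^ J)⁻¹ := by
      rw [← div_eq_mul_inv, le_div_iff₀ (by positivity), one_mul]
      exact pow_le_pow_of_le_one h0.le h1.le htJ.le
    rw [one_mul]
    exact one_le_mul_of_one_le_of_one_le this hconst
  obtain ⟨m, rfl⟩ := Nat.exists_eq_add_of_le htJ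
  have hlow : ∀ s, J ≤ s → s ≤ J + m → c ≤ vit l s v := by
    intro s hs1 hs2
    have e1 := inv_vit_le hl1 hv s
    have e2 : (l ^ s)⁻¹ * v⁻¹ ≤ Real.exp 2 := by
      have f1 : (l ^ s)⁻¹ = (lam ^ s)⁻¹ * ((1 - ε) ^ s)⁻¹ := by rw [hl, mul_pow, mul_inv]
      have f2 := inv_one_sub_pow_le hε0 hεh s
      have f3 : (lam ^ s)⁻¹ * v⁻¹ ≤ 1 := by
        rw [inv_mul_le_iff₀ (by positivity), mul_one]
        exact hJv.trans (pow_le_pow_right₀ hlam.le hs1)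
      have f4 : Real.exp (2 * (ε * s)) ≤ Real.exp 2 := by
        refine Real.exp_le_exp.2 ?_
        have : ε * s ≤ ε * (J + m : ℕ) := mul_le_mul_of_nonneg_left (by exact_mod_cast hs2) hε0
        linarith
      have f5 : 0 ≤ (lam ^ s)⁻¹ * v⁻¹ := by positivity
      have f6 : 0 ≤ ((1 - ε) ^ s)⁻¹ := inv_nonneg.2 (pow_nonneg (by linarith) _)
      calc (l ^ s)⁻¹ * v⁻¹ = ((lam ^ s)⁻¹ * v⁻¹) * ((1 - ε) ^ s)⁻¹ := by rw [f1]; ring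
        _ ≤ 1 * ((1 - ε) ^ s)⁻¹ := mul_le_mul_of_nonneg_right f3 f6
        _ ≤ Real.exp 2 := by linarith
    have e3 : l / (l - 1) ≤ (lam + 1) / (lam - 1) := by
      rw [div_le_div_iff₀ (by linarith) hlm]; linarith
    have e4 : (vit l s v)⁻¹ ≤ R := by rw [hR]; linarith
    exact hcR.trans ((inv_le_comm₀ (vit_pos hl0 hv s) hR0).1 e4)
  -- Deficit below the fixed point after the growth phase. At such a step the gap shrinks by at most
  -- `lamStar * exp (lam * d i + lam * ε)`, so summability of the deficits leaves the rate `lamStar`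
  -- correct up to a constant factor.
  set d : ℕ → ℝ := fun i => max (ρ - vit l (J + i) v) 0 with hd
  have hd0 : ∀ i, 0 ≤ d i := fun i => le_max_right _ _
  have hdstep : ∀ i, i ≤ m → d (i + 1) ≤ θ * d i + lam * ε := by
    intro i hi
    have e0 : 0 ≤ θ * d i := mul_nonneg hθ0 (hd0 i)
    have e0' : 0 ≤ lam * ε := by positivity
    refine max_le ?_ (by linarith)
    have e1 := hchord (vit l (J + i) v) (hlow _ (by omega) (by omega))
    have e2 : Real.exp (-(l * vit l (J + i) v)) - Real.exp (-(lam * vit l (J + i) v)) ≤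
        lam * ε := by
      refine (exp_neg_sub_exp_neg_le (mul_nonneg hl0.le (hvit0 _))).trans ?_
      have : lam * vit l (J + i) v - l * vit l (J + i) v = lam * ε * vit l (J + i) v := by
        rw [hl]; ring
      rw [this, abs_of_nonneg (mul_nonneg e0' (hvit0 _))]
      exact mul_le_of_le_one_right e0' (hvit1 _)
    rw [← add_assoc, vit]
    simp only [hd]
    linarith
  have hsum : ∀ k, k ≤ m → (1 - θ) * ∑ i ∈ range k, d i ≤ 1 + k * (lam * ε) - d k := by
    intro k
    induction k with
    | zero =>
      intro _
      have : d 0 ≤ 1 := max_le (by linarith [hvit0 (J + 0)]) zero_le_one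
      simp; linarith
    | succ k ih =>
      intro hk
      have e1 := ih (by omega)
      have e2 := hdstep k (by omega)
      rw [sum_range_succ, mul_add]
      push_cast
      linarith
  have hstep : ∀ k, k ≤ m → vit l (J + k) 1 - vit l (J + k) v ≤
      lamStar ^ k * Real.exp (lam * ∑ i ∈ range k, d i + k * (lam * ε)) := by
    intro k
    induction k with
    | zero => intro _; simpa using hΔ1 J
    | succ k ih =>
      intro hk
      have e1 := ih (by omega)
      have e2 := vit_sub_succ_le l v (J + k)
      have e3 : l * Real.exp (-(l * vit l (J + k) v)) ≤
          lamStar * Real.exp (lam * d k + lam * ε) := by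
        have f1 : lamStar = lam * Real.exp (-(lam * ρ)) := by
          rw [hfix, hρ]; field_simp; ring
        rw [f1, mul_assoc lam (Real.exp (-(lam * ρ))), ← Real.exp_add]
        refine mul_le_mul hllam (Real.exp_le_exp.2 ?_) (Real.exp_pos _).le hlam0.le
        have f2 : lam * (ρ - vit l (J + k) v) ≤ lam * d k :=
          mul_le_mul_of_nonneg_left (le_max_left _ _) hlam0.le
        have f3 : lam * ε * vit l (J + k) v ≤ lam * ε :=
          mul_le_of_le_one_right (by positivity) (hvit1 _)
        have f4 : l * vit l (J + k) v = lam * vit l (J + k) v - lam * ε * vit l (J + k) v := by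
          rw [hl]; ring
        linarith
      have e4 : 0 ≤ vit l (J + k) 1 - vit l (J + k) v :=
        sub_nonneg.2 (vit_mono hl0.le _ hv1)
      rw [← add_assoc]
      refine e2.trans ((mul_le_mul e3 e1 e4 (by positivity)).trans (le_of_eq ?_))
      rw [sum_range_succ, pow_succ]
      have : Real.exp (lam * (∑ i ∈ range k, d i + d k) + ((k + 1 : ℕ) : ℝ) * (lam * ε)) =
          Real.exp (lam * d k + lam * ε) *
            Real.exp (lam * ∑ i ∈ range k, d i + k * (lam * ε)) := by
        rw [← Real.exp_add]; congr 1; push_cast; ring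
      rw [this]; ring
  have hm : (m : ℝ) * (lam * ε) ≤ lam := by
    have : ε * m ≤ 1 := by
      refine le_trans ?_ hεt
      exact mul_le_mul_of_nonneg_left (by push_cast; linarith [(Nat.cast_nonneg J : (0:ℝ) ≤ J)]) hε0
    calc (m : ℝ) * (lam * ε) = lam * (ε * m) := by ring
      _ ≤ lam * 1 := mul_le_mul_of_nonneg_left this hlam0.le
      _ = lam := mul_one _
  have hsumD : ∑ i ∈ range m, d i ≤ D := by
    rw [hD, le_div_iff₀ (by linarith)]
    have := hsum m le_rfl
    linarith [hd0 m]
  refine (hstep m le_rfl).trans ?_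
  have e1 : lamStar ^ (J + m) * (lamStar ^ J)⁻¹ = lamStar ^ m := by
    rw [pow_add]; field_simp
  rw [e1, one_mul]
  refine mul_le_mul_of_nonneg_left (Real.exp_le_exp.2 ?_) (by positivity)
  have := mul_le_mul_of_nonneg_left hsumD hlam0.le
  linarith

end Growth

/-! ### Asymptotics of the exploration -/

section UpperAsymptotics

/-- The level size at which explorations in a graph on `n` vertices are stopped. -/
noncomputable def levelCap (n : ℕ) : ℕ := ⌈(n : ℝ) ^ (3 / 5 : ℝ)⌉₊

/-- The relative error in the growth rate of explorations in a graph on `n` vertices. -/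
noncomputable def growthErr (n : ℕ) : ℝ := (n : ℝ) ^ (-(1 / 4) : ℝ)

theorem hitProb_le {p : ℝ} (hp1 : p ≤ 1) (a : ℕ) : hitProb p a ≤ p * a := by
  have := one_add_mul_le_pow (a := -p) (by linarith) a
  rw [hitProb, sub_eq_add_neg 1 p]
  linarith

theorem le_hitProb {p : ℝ} (hp : 0 ≤ p) (hp1 : p ≤ 1) (a : ℕ) :
    p * a / (1 + p * a) ≤ hitProb p a := by
  have hpa : 0 ≤ p * a := by positivity
  have h1 : (1 - p) ^ a ≤ (1 + p * a)⁻¹ := by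
    have e1 : (1 - p) ^ a ≤ Real.exp (-p) ^ a :=
      pow_le_pow_left₀ (by linarith) (Real.one_sub_le_exp_neg p) a
    rw [← Real.exp_nat_mul] at e1
    refine e1.trans ?_
    rw [show (a : ℝ) * -p = -(p * a) by ring, Real.exp_neg]
    exact inv_anti₀ (by linarith) (by linarith [Real.add_one_le_exp (p * a)])
  have h2 : p * a / (1 + p * a) = 1 - (1 + p * a)⁻¹ := by field_simp; ring
  rw [hitProb, h2]; linarith

/-- The relative error `ε` has to pay for the `n - N` used vertices, for the lost unit in `N - 1`,
and for multiple hits, which cost a relative amount `lam * a / n`; this is the budget in `hbd`. -/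
theorem hitProb_growth {lam ε : ℝ} {n a N : ℕ} (hlam : 0 ≤ lam) (hn : 0 < n) (hlamn : lam ≤ n)
    (hε : 0 ≤ ε) (hε1 : ε ≤ 1 / 2) (hN : N ≤ n) (hbd : (n - N : ℝ) + 1 + lam * a ≤ ε * n) :
    lam * (1 - ε) * a ≤ (N - 1) * hitProb (lam / n) a ∧
      N * hitProb (lam / n) a ≤ (1 + 2 * ε) * (lam * (1 - ε) * a) := by
  have hn' : (0 : ℝ) < n := by exact_mod_cast hn
  have hp : 0 ≤ lam / n := by positivity
  have hp1 : lam / n ≤ 1 := (div_le_one hn').2 hlamn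
  have hNn : (N : ℝ) ≤ n := by exact_mod_cast hN
  have hla : 0 ≤ lam * a := by positivity
  constructor
  · have h1 := le_hitProb hp hp1 a
    have h2 : lam / n * a * (1 - lam / n * a) ≤ lam / n * a / (1 + lam / n * a) := by
      rw [le_div_iff₀ (by positivity)]
      have : 0 ≤ (lam / n * a) ^ 3 := by positivity
      have h0 : 0 ≤ lam / n * a := by positivity
      nlinarith
    have hN1 : n - ε * n + lam * a ≤ (N : ℝ) - 1 := by linarith
    have hN0 : 0 ≤ (N : ℝ) - 1 := by nlinarith
    refine le_trans ?_ (mul_le_mul_of_nonneg_left (h2.trans h1) hN0)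
    set y := lam * a / n with hy
    have hy0 : 0 ≤ y := by positivity
    have e1 : lam / n * a = y := by rw [hy]; ring
    have e2 : lam * a = y * n := by rw [hy]; field_simp
    have hy1 : y ≤ 1 := by rw [hy, div_le_one hn']; nlinarith
    rw [e1]
    have e3 : lam * (1 - ε) * a = y * (n * (1 - ε)) := by
      rw [show lam * (1 - ε) * a = lam * a * (1 - ε) by ring, e2]; ring
    have e4 : ((n : ℝ) - ε * n + y * n) * (1 - y) ≤ ((N : ℝ) - 1) * (1 - y) := by
      refine mul_le_mul_of_nonneg_right ?_ (by linarith)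
      rw [← e2]; exact hN1
    have e5 : n * (1 - ε) ≤ ((n : ℝ) - ε * n + y * n) * (1 - y) := by
      have : 0 ≤ y * n * (ε - y) := by
        refine mul_nonneg (by positivity) ?_
        rw [sub_nonneg, hy, div_le_iff₀ hn']
        linarith
      nlinarith
    calc lam * (1 - ε) * a = y * (n * (1 - ε)) := e3
      _ ≤ y * (((N : ℝ) - 1) * (1 - y)) := mul_le_mul_of_nonneg_left (e5.trans e4) hy0
      _ = _ := by ring
  · have h1 := hitProb_le hp1 a
    have h2 := hitProb_nonneg hp hp1 a
    calc (N : ℝ) * hitProb (lam / n) a ≤ n * (lam / n * a) :=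
          mul_le_mul hNn h1 h2 hn'.le
      _ = lam * a := by field_simp
      _ ≤ _ := by
        have : 0 ≤ lam * a * (ε * (1 - 2 * ε)) :=
          mul_nonneg hla (mul_nonneg hε (by linarith))
        linarith

theorem eventually_mul_log_le_rpow (A : ℝ) {r : ℝ} (hr : 0 < r) :
    ∀ᶠ n : ℕ in atTop, A * Real.log n ≤ (n : ℝ) ^ r := by
  have h := ((isLittleO_log_rpow_atTop hr).bound (c := (|A| + 1)⁻¹) (by positivity))
  filter_upwards [tendsto_natCast_atTop_atTop.eventually h, eventually_ge_atTop 1] with n hn hn1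
  have h1 : (0 : ℝ) ≤ Real.log n := Real.log_natCast_nonneg n
  rw [Real.norm_of_nonneg h1, Real.norm_of_nonneg (by positivity),
    inv_mul_eq_div, le_div_iff₀ (by positivity)] at hn
  have h2 := le_abs_self A
  nlinarith

theorem levelCap_le {n : ℕ} (hn : 1 ≤ n) : (levelCap n : ℝ) ≤ 2 * (n : ℝ) ^ (3 / 5 : ℝ) := by
  have h1 : (levelCap n : ℝ) < (n : ℝ) ^ (3 / 5 : ℝ) + 1 := Nat.ceil_lt_add_one (by positivity)
  have h2 : (1 : ℝ) ≤ (n : ℝ) ^ (3 / 5 : ℝ) :=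
    Real.one_le_rpow (by exact_mod_cast hn) (by norm_num)
  linarith

theorem one_le_levelCap {n : ℕ} (hn : 1 ≤ n) : 1 ≤ levelCap n := by
  rw [levelCap, Nat.one_le_ceil_iff]
  positivity

theorem tendsto_growthErr : Tendsto growthErr atTop (𝓝 0) :=
  (tendsto_rpow_neg_atTop (by norm_num : (0 : ℝ) < 1 / 4)).comp tendsto_natCast_atTop_atTop

/-- Exponent bookkeeping: logarithmically many levels of size `n ^ (3 / 5)` use at most `n ^ (7 /
10)` vertices, below `growthErr n * n = n ^ (3 / 4)`. -/
theorem eventually_hitProb_growth {lam : ℝ} (hlam : 0 ≤ lam) (K : ℝ) :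
    ∀ᶠ n : ℕ in atTop, ∀ t : ℕ, (t : ℝ) ≤ K * Real.log n →
      (2 * t + 4) * levelCap n + 1 ≤ n ∧ ∀ a N : ℕ, a < levelCap n →
        n - (2 * t + 4) * levelCap n ≤ N → N ≤ n →
        lam * (1 - growthErr n) * a ≤ (N - 1) * hitProb (lam / n) a ∧
        N * hitProb (lam / n) a ≤ (1 + 2 * growthErr n) * (lam * (1 - growthErr n) * a) := by
  filter_upwards [eventually_mul_log_le_rpow (2 * (2 * K + 6 + lam))
      (by norm_num : (0 : ℝ) < 1 / 10), eventually_ge_atTop 3,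
    tendsto_natCast_atTop_atTop.eventually (eventually_ge_atTop lam),
    tendsto_growthErr.eventually (ge_mem_nhds (by norm_num : (0 : ℝ) < 1 / 2))]
    with n h1 h3 hlamn hε t ht
  have hn : (3 : ℝ) ≤ n := by exact_mod_cast h3
  have hn0 : (0 : ℝ) < n := by linarith
  have hlog : 1 ≤ Real.log n := by
    rw [Real.le_log_iff_exp_le hn0]
    linarith [Real.exp_one_lt_d9]
  have hεn : growthErr n * n = (n : ℝ) ^ (3 / 4 : ℝ) := by
    rw [growthErr, ← Real.rpow_add_one hn0.ne']; norm_num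
  have hcap := levelCap_le (n := n) (by omega)
  have hcap1 : (1 : ℝ) ≤ levelCap n := by exact_mod_cast one_le_levelCap (n := n) (by omega)
  have hmain : ((2 * t + 4) * levelCap n + 1 + lam * levelCap n : ℝ) ≤ growthErr n * n := by
    have e1 : (2 * t + 4 + 1 + lam : ℝ) ≤ (n : ℝ) ^ (1 / 10 : ℝ) / 2 := by nlinarith
    have e2 : ((2 * t + 4) * levelCap n + 1 + lam * levelCap n : ℝ) ≤
        (2 * t + 4 + 1 + lam) * levelCap n := by nlinarith
    refine e2.trans ((mul_le_mul e1 hcap (by positivity) (by positivity)).trans ?_)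
    rw [hεn]
    have e3 : (n : ℝ) ^ (1 / 10 : ℝ) / 2 * (2 * (n : ℝ) ^ (3 / 5 : ℝ)) =
        (n : ℝ) ^ (7 / 10 : ℝ) := by
      rw [show (7 / 10 : ℝ) = 1 / 10 + 3 / 5 by norm_num, Real.rpow_add hn0]; ring
    rw [e3]
    exact Real.rpow_le_rpow_of_exponent_le (by linarith) (by norm_num)
  have hε0 : 0 ≤ growthErr n := by rw [growthErr]; positivity
  have hfit : (2 * t + 4) * levelCap n + 1 ≤ n := by
    have : (((2 * t + 4) * levelCap n + 1 : ℕ) : ℝ) ≤ n := by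
      push_cast
      nlinarith [mul_nonneg hlam (by positivity : (0 : ℝ) ≤ levelCap n)]
    exact_mod_cast this
  refine ⟨hfit, fun a N ha hN hNn => ?_⟩
  refine hitProb_growth hlam (by omega) hlamn hε0 hε hNn ?_
  have e1 : (n : ℝ) ≤ N + (2 * t + 4) * levelCap n := by
    have : n ≤ N + (2 * t + 4) * levelCap n := by omega
    exact_mod_cast this
  have e2 : lam * a ≤ lam * levelCap n :=
    mul_le_mul_of_nonneg_left (by exact_mod_cast ha.le) hlam
  linarith

variable {lam lamStar : ℝ}

/-- The exploration from `A` dies out with probability at most `q ^ #A` for some `q < 1`. -/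
theorem eventually_gnpP_grow_empty_le (hlam : 1 < lam) (K : ℝ) :
    ∀ᶠ n : ℕ in atTop, ∀ (V : Type) [Fintype V] [DecidableEq V], Fintype.card V = n →
      ∀ t : ℕ, (t : ℝ) ≤ K * Real.log n → ∀ A U : Finset V, Disjoint A U →
        n ≤ #(A ∪ U) + levelCap n →
        gnpP (lam / n) (fun G => (grow (levelCap n) t G A U).1 = ∅) ≤ (2 / (1 + lam)) ^ #A := by
  have hlam0 : 0 < lam := by linarith
  have hlim : ∀ᶠ n : ℕ in atTop, growthErr n ≤ (lam - 1) / (2 * lam) :=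
    tendsto_growthErr.eventually (ge_mem_nhds (div_pos (by linarith) (by linarith)))
  filter_upwards [eventually_hitProb_growth hlam0.le K, hlim,
    tendsto_natCast_atTop_atTop.eventually (eventually_ge_atTop lam), eventually_ge_atTop 1]
    with n hgrow hε hlamn hn1 V _ _ hV t ht A U hAU hcard
  obtain ⟨hfit, hstep⟩ := hgrow t ht
  have hn0 : (0 : ℝ) < n := by exact_mod_cast hn1
  have hp : 0 ≤ lam / n := by positivity
  have hp1 : lam / n ≤ 1 := (div_le_one hn0).2 hlamn
  set q : ℝ := 2 / (1 + lam) with hq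
  have hq0 : 0 < q := by positivity
  have hq1 : q < 1 := by rw [hq, div_lt_one (by positivity)]; linarith
  have hr : (2 * t + 4) * levelCap n = (t + 1) * levelCap n + (t + 1) * levelCap n +
      2 * levelCap n := by ring
  refine gnpP_grow_empty_le (N0 := n - (2 * t + 4) * levelCap n) hp hp1 hq0.le ?_ t A U hAU ?_
  · intro a N _ ha hN hNn
    rw [hV] at hNn
    obtain ⟨h1, -⟩ := hstep a N ha hN hNn
    have hπ0 := hitProb_nonneg hp hp1 a
    have hπ1 := hitProb_le_one hp1 a
    have hl : (1 + lam) / 2 ≤ lam * (1 - growthErr n) := by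
      rw [le_div_iff₀ (by positivity)] at hε
      linarith
    have e1 : (1 - (1 - q) * hitProb (lam / n) a) ^ N ≤
        Real.exp (-((1 - q) * hitProb (lam / n) a)) ^ N :=
      pow_le_pow_left₀ (by nlinarith) (Real.one_sub_le_exp_neg _) N
    refine e1.trans ?_
    rw [← Real.exp_nat_mul]
    -- With `μ = (1 + lam) / 2` and `q = 1 / μ`, Poisson offspring of mean `μ` send `q` to `exp (-(μ
    -- - 1)) ≤ 1 / μ = q`.
    have e2 : Real.exp (-((1 + lam) / 2 - 1)) ≤ q := by
      rw [Real.exp_neg, hq, show 2 / (1 + lam) = ((1 + lam) / 2)⁻¹ from (inv_div _ _).symm]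
      exact inv_anti₀ (by positivity) (by linarith [Real.add_one_le_exp ((1 + lam) / 2 - 1)])
    refine le_trans ?_ (pow_le_pow_left₀ (Real.exp_pos _).le e2 a)
    rw [← Real.exp_nat_mul]
    refine Real.exp_le_exp.2 ?_
    have e3 : (1 + lam) / 2 * a ≤ N * hitProb (lam / n) a := by
      have := mul_le_mul_of_nonneg_right hl (Nat.cast_nonneg a : (0 : ℝ) ≤ a)
      linarith
    have e4 : (1 - q) * ((1 + lam) / 2) = (1 + lam) / 2 - 1 := by
      rw [hq]; field_simp
    have e5 := mul_le_mul_of_nonneg_left e3 (by linarith : 0 ≤ 1 - q)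
    rw [← mul_assoc, e4] at e5
    linarith
  · omega

set_option maxHeartbeats 2000000 in
/-- Any two vertices whose explorations survive for `t` steps are at distance at most `2 t + 1`, up
to a small probability, if `t` exceeds half of the main term of the diameter by a constant. -/
theorem eventually_gnpP_exists_far_le (hlam : 1 < lam) (h0 : 0 < lamStar) (h1 : lamStar < 1)
    (hdual : lamStar * Real.exp (-lamStar) = lam * Real.exp (-lam)) {δ : ℝ} (hδ : 0 < δ) :
    ∃ C : ℝ, ∀ K : ℝ, ∀ᶠ n : ℕ in atTop, ∀ (V : Type) [Fintype V] [DecidableEq V],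
      Fintype.card V = n → ∀ t : ℕ, diamMainTerm lam lamStar n / 2 + C ≤ t →
        (t : ℝ) ≤ K * Real.log n →
        gnpP (lam / n) (fun G : SimpleGraph V => ∃ x y,
          (grow (levelCap n) t G {x} {x}ᶜ).1 ≠ ∅ ∧ (grow (levelCap n) t G {y} {y}ᶜ).1 ≠ ∅ ∧
          ¬ G.edist x y ≤ ((2 * t + 1 : ℕ) : ℕ∞)) ≤ δ := by
  have hlam0 : 0 < lam := by linarith
  obtain ⟨C₁, hC₁, hvit⟩ := exists_vit_sub_le hlam h0 h1 hdual
  set α : ℝ := Real.log (1 / lamStar) / Real.log lam with hα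
  have hlog : 0 < Real.log lam := Real.log_pos hlam
  have hlogs : 0 < Real.log (1 / lamStar) := Real.log_pos (by rw [lt_div_iff₀ h0]; linarith)
  have hα0 : 0 < α := by positivity
  -- Target for `n * tailErr`. The final estimate is `exp (8 * lam) * (γ + γ ^ 2)`, where `exp (8 *
  -- lam)` bounds `(1 - p) ^ (-b ^ 2)`.
  set γ : ℝ := min 1 (δ / (4 * Real.exp (8 * lam))) with hγ
  have hγ0 : 0 < γ := lt_min one_pos (by positivity)
  obtain ⟨C, hC⟩ : ∃ C : ℝ, Real.exp 2 * (C₁ * 2 ^ α * lamStar ^ C) ≤ γ / 2 := by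
    have ht : Tendsto (fun C : ℝ => Real.exp 2 * (C₁ * 2 ^ α * lamStar ^ C)) atTop
        (𝓝 (Real.exp 2 * (C₁ * 2 ^ α * 0))) :=
      ((tendsto_rpow_atTop_of_base_lt_one lamStar (by linarith) h1).const_mul _).const_mul _
    rw [mul_zero, mul_zero] at ht
    exact (ht.eventually (ge_mem_nhds (by positivity : 0 < γ / 2))).exists
  refine ⟨C, fun K => ?_⟩
  have hlim : ∀ᶠ n : ℕ in atTop, growthErr n ≤ (lam - 1) / (2 * lam) :=
    tendsto_growthErr.eventually (ge_mem_nhds (div_pos (by linarith) (by linarith)))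
  filter_upwards [eventually_hitProb_growth hlam0.le K, hlim,
    tendsto_natCast_atTop_atTop.eventually (eventually_ge_atTop (2 * lam)),
    tendsto_natCast_atTop_atTop.eventually (eventually_ge_atTop (lam ^ 2)), eventually_ge_atTop 1,
    eventually_mul_log_le_rpow K (by norm_num : (0 : ℝ) < 1 / 4),
    eventually_mul_log_le_rpow 2 (by norm_num : (0 : ℝ) < 1 / 10),
    tendsto_natCast_atTop_atTop.eventually (eventually_ge_atTop (2 / γ))]
    with n hgrow hε hlamn hlamn2 hn1 hKlog hlog2 hnγ V _ _ hV t htl htu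
  obtain ⟨hfit, hstep⟩ := hgrow t htu
  have hn1' : (1 : ℝ) ≤ n := by exact_mod_cast hn1
  have hn0 : (0 : ℝ) < n := by linarith
  set p : ℝ := lam / n with hp
  have hp0 : 0 < p := by positivity
  have hp2 : p ≤ 1 / 2 := by rw [hp, div_le_iff₀ hn0]; linarith
  set s : ℝ := Real.sqrt n with hs
  have hs1 : 1 ≤ s := Real.one_le_sqrt.2 hn1'
  have hss : s * s = n := Real.mul_self_sqrt hn0.le
  -- With `b` near `√n`, the exponent `b ^ 2` is of order `n`, so `(1 - p) ^ b ^ 2` stays bounded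
  -- below, while `b * levelCap n ≥ n ^ (11 / 10)` makes `z ^ levelCap n` smaller than any power of
  -- `n`.
  set b : ℕ := ⌈s⌉₊ with hb
  have hb1 : s ≤ b := Nat.le_ceil s
  have hb2 : (b : ℝ) ≤ 2 * s := by
    have : (b : ℝ) < s + 1 := Nat.ceil_lt_add_one (by linarith)
    linarith
  have hb0 : 1 ≤ b := by
    have : (1 : ℝ) ≤ b := hs1.trans hb1
    exact_mod_cast this
  have hsr : s = (n : ℝ) ^ (1 / 2 : ℝ) := Real.sqrt_eq_rpow _
  have hbc : b ≤ levelCap n := by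
    rw [hb, levelCap, hsr]
    exact Nat.ceil_mono (Real.rpow_le_rpow_of_exponent_le hn1' (by norm_num))
  set ε := growthErr n with hεdef
  have hε0 : 0 ≤ ε := by rw [hεdef, growthErr]; positivity
  set z : ℝ := (1 - p) ^ b with hz
  have hz0 : 0 < z := pow_pos (by linarith) _
  set η : ℝ := z ^ levelCap n with hη
  have hη1 : η ≤ γ / (2 * n) := by
    have e1 : η ≤ Real.exp (-(n : ℝ) ^ (1 / 10 : ℝ)) := by
      rw [hη, hz, ← pow_mul]
      have f1 : (1 - p) ^ (b * levelCap n) ≤ Real.exp (-p) ^ (b * levelCap n) :=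
        pow_le_pow_left₀ (by linarith) (Real.one_sub_le_exp_neg p) _
      refine f1.trans ?_
      rw [← Real.exp_nat_mul]
      refine Real.exp_le_exp.2 ?_
      have f2 : (n : ℝ) ^ (3 / 5 : ℝ) ≤ levelCap n := Nat.le_ceil _
      have f3 : s * (n : ℝ) ^ (3 / 5 : ℝ) ≤ b * levelCap n :=
        mul_le_mul hb1 f2 (by positivity) (by positivity)
      have f4 : s * (n : ℝ) ^ (3 / 5 : ℝ) = n * (n : ℝ) ^ (1 / 10 : ℝ) := by
        rw [hsr, ← Real.rpow_add hn0, ← Real.rpow_one_add' hn0.le (by norm_num)]; norm_num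
      have f5 : (n : ℝ) ^ (1 / 10 : ℝ) ≤ p * (n * (n : ℝ) ^ (1 / 10 : ℝ)) := by
        have : p * (n * (n : ℝ) ^ (1 / 10 : ℝ)) = lam * (n : ℝ) ^ (1 / 10 : ℝ) := by
          rw [hp]; field_simp
        rw [this]
        exact le_mul_of_one_le_left (by positivity) hlam.le
      have f6 := mul_le_mul_of_nonneg_left (f4 ▸ f3) hp0.le
      push_cast
      linarith
    have e2 : Real.exp (-(n : ℝ) ^ (1 / 10 : ℝ)) ≤ (n : ℝ)⁻¹ * (n : ℝ)⁻¹ := by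
      have : Real.exp (-(n : ℝ) ^ (1 / 10 : ℝ)) ≤ Real.exp (-(2 * Real.log n)) :=
        Real.exp_le_exp.2 (neg_le_neg hlog2)
      refine this.trans (le_of_eq ?_)
      rw [two_mul, neg_add, Real.exp_add, Real.exp_neg, Real.exp_log hn0]
    refine e1.trans (e2.trans ?_)
    have e3 : (n : ℝ)⁻¹ ≤ γ / 2 := by
      rw [inv_le_comm₀ hn0 (by positivity), inv_div]; exact hnγ
    calc (n : ℝ)⁻¹ * (n : ℝ)⁻¹ ≤ γ / 2 * (n : ℝ)⁻¹ :=
          mul_le_mul_of_nonneg_right e3 (by positivity)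
      _ = _ := by field_simp
  -- This is why `growthErr` is a negative power of `n`: errors accumulated over logarithmically
  -- many steps stay bounded.
  have hεt : ε * t ≤ 1 := by
    calc ε * t ≤ ε * (n : ℝ) ^ (1 / 4 : ℝ) :=
          mul_le_mul_of_nonneg_left (htu.trans hKlog) hε0
      _ = 1 := by
          rw [hεdef, growthErr, ← Real.rpow_add hn0]; norm_num
  have hv : (2 * s)⁻¹ ≤ 1 - z := by
    have e1 := le_hitProb hp0.le (by linarith : p ≤ 1) b
    have e2 : lam / s ≤ p * b := by
      have : lam / s = p * s := by rw [hp, ← hss]; field_simp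
      rw [this]
      exact mul_le_mul_of_nonneg_left hb1 hp0.le
    have e3 : lam / s ≤ 1 := by
      rw [div_le_one (by linarith)]
      exact Real.le_sqrt_of_sq_le hlamn2
    have e4 : (2 * s)⁻¹ ≤ p * b / (1 + p * b) := by
      have hpb : 1 / s ≤ p * b := le_trans (by gcongr) e2
      have hs' : (0 : ℝ) < s := by linarith
      rw [inv_eq_one_div, div_le_div_iff₀ (by positivity) (by positivity)]
      rw [div_le_iff₀ hs'] at hpb
      have : p * b ≤ p * b * s := le_mul_of_one_le_right (by positivity) hs1
      linarith
    have e5 : hitProb p b = 1 - z := rfl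
    linarith
  have hv0 : 0 < 1 - z := lt_of_lt_of_le (by positivity) hv
  have hdiff := hvit ε hε0 hε t (1 - z) hv0 (by linarith) hεt
  -- Half the main term is `log n / log (1 / lamStar)` plus `(α / 2) * log n / log (1 / lamStar)`.
  -- The first part yields `1 / n`; the second yields `n ^ (-(α / 2))`, which cancels the growth
  -- phase from `1 - z ≈ 1 / √n` in `hvα`.
  have hpowt : lamStar ^ t ≤ lamStar ^ C * (n : ℝ) ^ (-(α / 2)) * (n : ℝ)⁻¹ := by
    have e1 : lamStar ^ t ≤ lamStar ^ (diamMainTerm lam lamStar n / 2 + C) := by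
      rw [← Real.rpow_natCast]
      exact Real.rpow_le_rpow_of_exponent_ge h0 h1.le htl
    refine e1.trans (le_of_eq ?_)
    have hls : Real.log (1 / lamStar) = -Real.log lamStar := by
      rw [one_div, Real.log_inv]
    have hls0 : Real.log lamStar ≠ 0 := by
      intro h; rw [hls, h] at hlogs; simp at hlogs
    rw [add_comm, Real.rpow_add h0, mul_assoc]
    congr 1
    rw [Real.rpow_def_of_pos h0, Real.rpow_def_of_pos hn0, ← Real.exp_log hn0, ← Real.exp_neg,
      ← Real.exp_add, Real.exp_log hn0]
    congr 1
    rw [diamMainTerm, hα, hls]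
    field_simp
  have hvα : (1 - z) ^ (-α) ≤ 2 ^ α * (n : ℝ) ^ (α / 2) := by
    have e1 : (1 - z) ^ (-α) ≤ ((2 * s)⁻¹) ^ (-α) :=
      Real.rpow_le_rpow_of_nonpos (by positivity) hv (by linarith)
    refine e1.trans (le_of_eq ?_)
    rw [Real.inv_rpow (by positivity), Real.rpow_neg (by positivity), inv_inv,
      Real.mul_rpow (by norm_num) (by linarith), hsr, ← Real.rpow_mul hn0.le]
    congr 2; ring
  have hT : tailErr (lam * (1 - ε)) (1 + 2 * ε) z η t ≤ γ / n := by
    have e1 : (1 + 2 * ε) ^ t ≤ Real.exp 2 := by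
      have f1 : (1 + 2 * ε) ^ t ≤ Real.exp (2 * ε) ^ t := by
        refine pow_le_pow_left₀ (by linarith) ?_ t
        linarith [Real.add_one_le_exp (2 * ε)]
      refine f1.trans ?_
      rw [← Real.exp_nat_mul]
      exact Real.exp_le_exp.2 (by linarith)
    have e2 : vit (lam * (1 - ε)) t 1 - vit (lam * (1 - ε)) t (1 - z) ≤
        C₁ * 2 ^ α * lamStar ^ C * (n : ℝ)⁻¹ := by
      refine hdiff.trans ?_
      calc C₁ * lamStar ^ t * (1 - z) ^ (-α)
          ≤ C₁ * (lamStar ^ C * (n : ℝ) ^ (-(α / 2)) * (n : ℝ)⁻¹) *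
            (2 ^ α * (n : ℝ) ^ (α / 2)) := by
            refine mul_le_mul (mul_le_mul_of_nonneg_left hpowt hC₁.le) hvα (by positivity)
              (by positivity)
        _ = C₁ * 2 ^ α * lamStar ^ C * (n : ℝ)⁻¹ *
            ((n : ℝ) ^ (-(α / 2)) * (n : ℝ) ^ (α / 2)) := by ring
        _ = _ := by rw [← Real.rpow_add hn0]; simp
    rw [tailErr]
    have e3 : (1 + 2 * ε) ^ t * (1 - vit (lam * (1 - ε)) t (1 - z) -
        (1 - vit (lam * (1 - ε)) t 1)) ≤ γ / 2 * (n : ℝ)⁻¹ := by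
      calc _ = (1 + 2 * ε) ^ t * (vit (lam * (1 - ε)) t 1 - vit (lam * (1 - ε)) t (1 - z)) := by
            ring
        _ ≤ Real.exp 2 * (C₁ * 2 ^ α * lamStar ^ C * (n : ℝ)⁻¹) := by
            refine mul_le_mul e1 e2 ?_ (Real.exp_pos _).le
            refine sub_nonneg.2 (vit_mono ?_ t (by linarith))
            refine mul_nonneg hlam0.le ?_
            have : (lam - 1) / (2 * lam) ≤ 1 := by
              rw [div_le_one (by positivity)]; linarith
            linarith
        _ = Real.exp 2 * (C₁ * 2 ^ α * lamStar ^ C) * (n : ℝ)⁻¹ := by ring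
        _ ≤ _ := mul_le_mul_of_nonneg_right hC (by positivity)
    calc _ ≤ γ / 2 * (n : ℝ)⁻¹ + γ / (2 * n) := add_le_add e3 hη1
      _ = γ / n := by field_simp; ring
  have hl0 : 0 ≤ lam * (1 - ε) := by
    refine mul_nonneg hlam0.le ?_
    have : (lam - 1) / (2 * lam) ≤ 1 := by
      rw [div_le_one (by positivity)]; linarith
    linarith
  have hr : (2 * t + 4) * levelCap n = (2 * t + 3) * levelCap n + levelCap n := by ring
  have hmain := gnpP_exists_far_le (V := V) (p := p) (l := lam * (1 - ε)) (κ := 1 + 2 * ε) (z := z)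
    (η := η) (cap := levelCap n) (N0 := n - (2 * t + 4) * levelCap n) (b := b)
    hp0.le (by linarith) hl0 (by linarith) rfl le_rfl hb0 hbc (by omega)
    (fun a N _ ha hN hNn => by
      rw [hV] at hNn
      exact hstep a N ha hN hNn) t (by rw [hV]; omega)
  rw [hV] at hmain
  refine hmain.trans ?_
  have hW : ((1 - p) ^ b ^ 2)⁻¹ ≤ Real.exp (8 * lam) := by
    refine (inv_one_sub_pow_le hp0.le hp2 _).trans (Real.exp_le_exp.2 ?_)
    have e1 : ((b ^ 2 : ℕ) : ℝ) ≤ 4 * n := by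
      push_cast
      calc (b : ℝ) ^ 2 ≤ (2 * s) ^ 2 := pow_le_pow_left₀ (by positivity) hb2 2
        _ = 4 * n := by rw [← hss]; ring
    have e2 : p * ((b ^ 2 : ℕ) : ℝ) ≤ p * (4 * n) := mul_le_mul_of_nonneg_left e1 hp0.le
    have e3 : p * (4 * n) = 4 * lam := by rw [hp]; field_simp
    linarith
  have hzb : z ^ b = (1 - p) ^ b ^ 2 := by rw [hz, ← pow_mul, sq]
  rw [hzb]
  have hT0 := tailErr_nonneg (κ := 1 + 2 * ε) (η := η) hl0 (by linarith) hz0.le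
    (pow_nonneg hz0.le _) t
  set W := ((1 - p) ^ b ^ 2)⁻¹ with hWdef
  have hW0 : 0 ≤ W := inv_nonneg.2 (pow_nonneg (by linarith) _)
  set Θ := tailErr (lam * (1 - ε)) (1 + 2 * ε) z η t with hΘ
  have hnΘ : n * Θ ≤ γ := by
    rw [le_div_iff₀ hn0] at hT; linarith
  have hnΘ0 : 0 ≤ n * Θ := by positivity
  have hγ1 : γ ≤ 1 := min_le_left _ _
  have hγ2 : γ ≤ δ / (4 * Real.exp (8 * lam)) := min_le_right _ _
  calc (n : ℝ) * (W * Θ) + (n : ℝ) ^ 2 * (W * Θ ^ 2) = W * (n * Θ + (n * Θ) * (n * Θ)) := by ring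
    _ ≤ Real.exp (8 * lam) * (γ + γ * 1) := by
        refine mul_le_mul hW (add_le_add hnΘ ?_) (by positivity) (Real.exp_pos _).le
        exact mul_le_mul hnΘ (hnΘ.trans hγ1) hnΘ0 hγ0.le
    _ ≤ δ := by
        rw [le_div_iff₀ (by positivity)] at hγ2
        have : Real.exp (8 * lam) * (γ + γ * 1) = γ * (4 * Real.exp (8 * lam)) / 2 := by ring
        linarith

end UpperAsymptotics

/-! ### Pendant subgraphs -/

section Pendant

/-- The exploration from `A` inside `A ∪ U` has its last nonempty level at depth `k`, and `T` is the
set of explored vertices. -/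
def Dies : ℕ → SimpleGraph V → Finset V → Finset V → Finset V → Prop
  | 0, G, A, U, T => A ≠ ∅ ∧ nbr G A U = ∅ ∧ T = A
  | k + 1, G, A, U, T => A ⊆ T ∧ Dies k G (nbr G A U) (U \ nbr G A U) (T \ A)

theorem Dies.subset {k : ℕ} {G : SimpleGraph V} {A U T : Finset V} (h : Dies k G A U T) :
    A ⊆ T := by
  cases k with
  | zero => exact h.2.2.ge
  | succ k => exact h.1

theorem Dies.subset_union {k : ℕ} {G : SimpleGraph V} {A U T : Finset V} (h : Dies k G A U T) :
    T ⊆ A ∪ U := by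
  induction k generalizing A U T with
  | zero => exact h.2.2.le.trans subset_union_left
  | succ k ih =>
    have := ih h.2
    rw [union_sdiff_of_subset (nbr_subset G A U)] at this
    intro x hx
    by_cases hA : x ∈ A
    · exact mem_union_left _ hA
    · exact mem_union_right _ (this (Finset.mem_sdiff.2 ⟨hx, hA⟩))

theorem Dies.unique {k : ℕ} {G : SimpleGraph V} {A U T T' : Finset V} (h : Dies k G A U T)
    (h' : Dies k G A U T') : T = T' := by
  induction k generalizing A U T T' with
  | zero => rw [h.2.2, h'.2.2]
  | succ k ih => rw [← union_sdiff_of_subset h.1, ← union_sdiff_of_subset h'.1, ih h.2 h'.2]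

/-- No edges leave the explored set when the exploration dies. -/
theorem Dies.not_adj {k : ℕ} {G : SimpleGraph V} {A U T : Finset V} (hAU : Disjoint A U)
    (h : Dies k G A U T) : ∀ a ∈ T, ∀ u ∈ U, u ∉ T → ¬ G.Adj a u := by
  induction k generalizing A U T with
  | zero =>
    intro a ha u hu _ hadj
    rw [h.2.2] at ha
    have : u ∈ nbr G A U := mem_nbr.2 ⟨hu, a, ha, hadj⟩
    rw [h.2.1] at this
    simp at this
  | succ k ih =>
    intro a ha u hu huT hadj
    have huA : u ∉ A := disjoint_right.1 hAU hu
    have hun : u ∉ nbr G A U := fun hn => huT (Finset.mem_sdiff.1 (h.2.subset hn)).1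
    by_cases haA : a ∈ A
    · exact hun (mem_nbr.2 ⟨hu, a, haA, hadj⟩)
    · exact ih disjoint_sdiff h.2 a (Finset.mem_sdiff.2 ⟨ha, haA⟩) u
        (Finset.mem_sdiff.2 ⟨hu, hun⟩) (fun h' => huT (Finset.mem_sdiff.1 h').1) hadj

/-- The exploration does not see vertices that are not joined to the explored set. -/
theorem dies_inter_iff {k : ℕ} {G : SimpleGraph V} {A U T : Finset V} (hAU : Disjoint A U)
    (hA : A ⊆ T) (hT : ∀ a ∈ T, ∀ u ∈ U, u ∉ T → ¬ G.Adj a u) :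
    Dies k G A U T ↔ Dies k G A (U ∩ T) T := by
  have hn : ∀ {A U T : Finset V}, A ⊆ T → (∀ a ∈ T, ∀ u ∈ U, u ∉ T → ¬ G.Adj a u) →
      nbr G A U = nbr G A (U ∩ T) := by
    intro A U T hA hT
    ext u
    simp only [mem_nbr, mem_inter]
    constructor
    · rintro ⟨hu, a, ha, hadj⟩
      refine ⟨⟨hu, ?_⟩, a, ha, hadj⟩
      by_contra huT
      exact hT a (hA ha) u hu huT hadj
    · rintro ⟨⟨hu, -⟩, h⟩
      exact ⟨hu, h⟩
  induction k generalizing A U T with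
  | zero => rw [Dies, Dies, hn hA hT]
  | succ k ih =>
    rw [Dies, Dies, ← hn hA hT]
    refine and_congr_right fun _ => ?_
    have hset : (U ∩ T) \ nbr G A U = (U \ nbr G A U) ∩ (T \ A) := by
      ext u
      have h0 : u ∈ U → u ∉ A := fun h => disjoint_right.1 hAU h
      simp only [mem_inter, Finset.mem_sdiff]
      tauto
    rw [hset]
    refine ih disjoint_sdiff ?_ ?_
    · intro u hu
      have h1 := (mem_nbr.1 (hn hA hT ▸ hu)).1
      exact Finset.mem_sdiff.2 ⟨(mem_inter.1 h1).2, disjoint_right.1 hAU (mem_inter.1 h1).1⟩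
    · intro a ha u hu huT
      rw [Finset.mem_sdiff] at ha hu
      exact hT a ha.1 u hu.1 fun h => huT (Finset.mem_sdiff.2 ⟨h, disjoint_right.1 hAU hu.1⟩)

/-- Every vertex of `T` is reached from `A` by a path inside `T`; stated as an induction principle
over closed sets. -/
theorem Dies.subset_of_closed {k : ℕ} {G : SimpleGraph V} {A U T : Finset V} {C : Set V}
    (h : Dies k G A U T) (hA : ∀ a ∈ A, a ∈ C)
    (hC : ∀ a ∈ T, a ∈ C → ∀ b ∈ T, G.Adj a b → b ∈ C) : ∀ a ∈ T, a ∈ C := by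
  induction k generalizing A U T with
  | zero => rw [h.2.2]; exact hA
  | succ k ih =>
    have hAT := h.1
    have hB := h.2.subset
    have := ih h.2 (fun b hb => by
      obtain ⟨-, a, ha, hab⟩ := mem_nbr.1 hb
      exact hC a (hAT ha) (hA a ha) b (Finset.mem_sdiff.1 (hB hb)).1 hab)
      (fun a ha haC b hb hab => hC a (Finset.mem_sdiff.1 ha).1 haC b (Finset.mem_sdiff.1 hb).1 hab)
    intro a ha
    by_cases haA : a ∈ A
    · exact hA a haA
    · exact this a (Finset.mem_sdiff.2 ⟨ha, haA⟩)

/-- The depth function of an exploration that dies. -/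
theorem Dies.exists_depth {k : ℕ} {G : SimpleGraph V} {A U T : Finset V} (hAU : Disjoint A U)
    (h : Dies k G A U T) :
    ∃ ψ : V → ℕ, (∀ u, u ∉ T → ψ u = 0) ∧ (∀ a ∈ A, ψ a = 1) ∧ (∀ u ∈ T, 1 ≤ ψ u) ∧
      (∃ x ∈ T, ψ x = k + 1) ∧ (∀ a ∈ T, ∀ b ∈ T, G.Adj a b → ψ a ≤ ψ b + 1) ∧
      ∀ u ∈ T, ∃ a ∈ A, G.edist a u ≤ k := by
  induction k generalizing A U T with
  | zero =>
    obtain ⟨hne, -, rfl⟩ := h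
    refine ⟨fun u => if u ∈ T then 1 else 0, fun u hu => if_neg hu, fun a ha => if_pos ha,
      fun u hu => (if_pos hu).ge, ?_, ?_, fun u hu => ⟨u, hu, by simp⟩⟩
    · obtain ⟨x, hx⟩ := nonempty_iff_ne_empty.2 hne
      exact ⟨x, hx, if_pos hx⟩
    · intro a ha b hb _
      dsimp only
      rw [if_pos ha]; omega
  | succ k ih =>
    obtain ⟨ψ, h1, h2, h3, ⟨x, hx, hxk⟩, h5, h6⟩ := ih disjoint_sdiff h.2
    have hTU := h.subset_union
    refine ⟨fun u => if u ∈ A then 1 else if u ∈ T then ψ u + 1 else 0, ?_, ?_, ?_, ?_, ?_, ?_⟩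
    · intro u hu
      dsimp only
      rw [if_neg fun h' => hu (h.1 h'), if_neg hu]
    · exact fun a ha => if_pos ha
    · intro u hu
      dsimp only
      split_ifs <;> omega
    · rw [Finset.mem_sdiff] at hx
      refine ⟨x, hx.1, ?_⟩
      dsimp only
      rw [if_neg hx.2, if_pos hx.1, hxk]
    · intro a ha b hb hab
      dsimp only
      by_cases haA : a ∈ A
      · rw [if_pos haA]; omega
      · rw [if_neg haA, if_pos ha]
        by_cases hbA : b ∈ A
        · rw [if_pos hbA]
          have haU : a ∈ U := (mem_union.1 (hTU ha)).resolve_left haA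
          rw [h2 a (mem_nbr.2 ⟨haU, b, hbA, hab.symm⟩)]
        · rw [if_neg hbA, if_pos hb]
          have := h5 a (Finset.mem_sdiff.2 ⟨ha, haA⟩) b (Finset.mem_sdiff.2 ⟨hb, hbA⟩) hab
          omega
    · intro u hu
      by_cases huA : u ∈ A
      · exact ⟨u, huA, by simp⟩
      · obtain ⟨b, hb, hbu⟩ := h6 u (Finset.mem_sdiff.2 ⟨hu, huA⟩)
        obtain ⟨-, a, ha, hab⟩ := mem_nbr.1 hb
        refine ⟨a, ha, (G.edist_triangle (v := b)).trans ?_⟩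
        rw [SimpleGraph.edist_eq_one_iff_adj.2 hab]
        push_cast
        rw [add_comm]
        gcongr

theorem dep_dies (k : ℕ) (A U T : Finset V) :
    Dep (Within (A ∪ U)) (fun G => Dies k G A U T) := by
  induction k generalizing A U T with
  | zero =>
    intro G H h
    have h1 : nbr G A U = nbr H A U := dep_nbr A U G H fun a b hab =>
      h a b ⟨mem_union_left _ hab.1, mem_union_right _ hab.2⟩
    simp only [Dies, h1]
  | succ k ih =>
    intro G H h
    have h1 : nbr G A U = nbr H A U := dep_nbr A U G H fun a b hab =>
      h a b ⟨mem_union_left _ hab.1, mem_union_right _ hab.2⟩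
    simp only [Dies, h1]
    refine propext (and_congr_right fun _ => ?_)
    refine Eq.to_iff (ih _ _ _ G H fun a b hab => h a b ?_)
    rw [Within, union_sdiff_of_subset (nbr_subset H A U)] at hab
    exact ⟨mem_union_right _ hab.1, mem_union_right _ hab.2⟩

/-- `T` is a set of vertices attached to the rest of the graph by the single edge `vw`, whose
vertices have distance at most `k` from `v` inside `T`, with equality for some vertex. -/
def Pend (k : ℕ) (G : SimpleGraph V) (v w : V) (T : Finset V) : Prop :=
  Dies k G {v} (T.erase v) T ∧ ∀ a ∈ T, ∀ b, b ∉ T → (G.Adj a b ↔ a = v ∧ b = w)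

/-! ### Geometry of pendant subgraphs -/

section Pend

variable {k : ℕ} {G : SimpleGraph V} {v w v' w' : V} {T T' : Finset V}

theorem Pend.mem (h : Pend k G v w T) : v ∈ T := h.1.subset (mem_singleton_self v)

theorem Pend.adj (h : Pend k G v w T) (hw : w ∉ T) : G.Adj v w := (h.2 v h.mem w hw).2 ⟨rfl, rfl⟩

theorem Pend.eq_of_adj (h : Pend k G v w T) {a b : V} (ha : a ∈ T) (hb : b ∉ T)
    (hab : G.Adj a b) : a = v ∧ b = w := (h.2 a ha b hb).1 hab

theorem Pend.subset_of_closed (h : Pend k G v w T) {C : Set V} (hv : v ∈ C)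
    (hC : ∀ a ∈ T, a ∈ C → ∀ b ∈ T, G.Adj a b → b ∈ C) : ∀ a ∈ T, a ∈ C :=
  h.1.subset_of_closed (by simpa using hv) hC

theorem Pend.exists_depth (h : Pend k G v w T) :
    ∃ ψ : V → ℕ, (∀ u, u ∉ T → ψ u = 0) ∧ ψ v = 1 ∧ (∀ u ∈ T, 1 ≤ ψ u) ∧
      (∃ x ∈ T, ψ x = k + 1) ∧ (∀ a b, G.Adj a b → ψ a ≤ ψ b + 1) ∧
      ∀ u ∈ T, G.edist v u ≤ k := by
  obtain ⟨ψ, h1, h2, h3, h4, h5, h6⟩ := h.1.exists_depth (by simp)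
  refine ⟨ψ, h1, h2 v (mem_singleton_self v), h3, h4, ?_, ?_⟩
  · intro a b hab
    by_cases ha : a ∈ T
    · by_cases hb : b ∈ T
      · exact h5 a ha b hb hab
      · rw [(h.eq_of_adj ha hb hab).1, h2 v (mem_singleton_self v)]; omega
    · rw [h1 a ha]; omega
  · intro u hu
    obtain ⟨a, ha, hau⟩ := h6 u hu
    rwa [mem_singleton.1 ha] at hau

/-- `T'` is connected from `v'`, and the only edge leaving `T` ends at `w`. If `w` is not in `T'`,
there is no way out of `T`. -/
theorem Pend.subset_of_mem (h' : Pend k G v' w' T') (h : Pend k G v w T)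
    (hv : v' ∈ T) (hw : w ∉ T') : T' ⊆ T := by
  refine fun a ha => h'.subset_of_closed (C := {x | x ∈ T}) hv (fun a _ haT b hb hab => ?_) a ha
  by_contra hbT
  have := (h.eq_of_adj haT hbT hab).2
  exact hw (this ▸ hb)

theorem Pend.unique (h : Pend k G v w T) (h' : Pend k G v w T') (hw : w ∉ T) (hw' : w ∉ T') :
    T = T' :=
  (h.subset_of_mem h' h'.mem hw).antisymm (h'.subset_of_mem h h.mem hw')

/-- Lower bounds for distances are obtained from potentials that change by at most one along edges,
in place of an analysis of paths. -/
theorem le_add_of_edist_le {φ : V → ℤ} (hφ : ∀ a b, G.Adj a b → φ a ≤ φ b + 1) {x y : V} {m : ℕ}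
    (h : G.edist x y ≤ m) : φ x ≤ φ y + m := by
  have hne : G.edist x y ≠ ⊤ := ne_top_of_le_ne_top (ENat.natCast_ne_top m) h
  obtain ⟨p, hp⟩ := SimpleGraph.exists_walk_of_edist_ne_top hne
  rw [← hp] at h
  have hm : p.length ≤ m := by exact_mod_cast h
  have key : ∀ {x y : V} (p : G.Walk x y), φ x ≤ φ y + p.length := by
    intro x y p
    induction p with
    | nil => simp
    | cons hadj q ih =>
      have := hφ _ _ hadj
      rw [SimpleGraph.Walk.length_cons]
      push_cast
      linarith
  have := key p
  have : (p.length : ℤ) ≤ m := by exact_mod_cast hm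
  linarith

/-- The hypotheses force `T'` to be nested in `T` with `v` outside `T'`. The deepest vertex of `T'`
is then at distance at least `k + 1` from `v`, although all of `T` is within `k` of `v`. Equality of
the two depths is essential. -/
theorem Pend.false_of_mem (h : Pend k G v w T) (h' : Pend k G v' w' T') (hw : w ∉ T)
    (hw' : w' ∉ T') (hne : (v, w) ≠ (v', w')) (h1 : w' ∈ T) (h2 : w ∉ T') : False := by
  have hv' : v' ∈ T := by
    by_contra hv
    have := (h.eq_of_adj h1 hv (h'.adj hw').symm).2
    exact h2 (this ▸ h'.mem)
  have hsub := h'.subset_of_mem h hv' h2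
  have hv : v ∉ T' := by
    intro hv
    have := h'.eq_of_adj hv h2 (h.adj hw)
    exact hne (by rw [this.1, this.2])
  obtain ⟨ψ, e1, e2, e3, ⟨x, hx, e4⟩, e5, e6⟩ := h'.exists_depth
  obtain ⟨-, -, -, -, -, -, f6⟩ := h.exists_depth
  have := le_add_of_edist_le (G := G) (φ := fun u => (ψ u : ℤ)) (x := x) (y := v) (m := k)
    (fun a b hab => by exact_mod_cast e5 a b hab) (by
      rw [G.edist_comm]; exact f6 x (hsub hx))
  rw [e4, e1 v hv] at this
  push_cast at this
  linarith

/-- Distinct pendant subgraphs of the same depth are disjoint, unless they cover a component. -/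
theorem Pend.disjoint (h : Pend k G v w T) (h' : Pend k G v' w' T') (hw : w ∉ T) (hw' : w' ∉ T')
    (hne : (v, w) ≠ (v', w'))
    (hbig : ∀ C : Finset V, w ∈ C → (∀ a ∈ C, ∀ b, G.Adj a b → b ∈ C) → #T + #T' < #C) :
    Disjoint T T' ∧ w ∉ T' ∧ w' ∉ T := by
  by_cases h1 : w' ∈ T
  · exfalso
    by_cases h2 : w ∈ T'
    -- If each root lies in the other set, no edge leaves the union, which is then a closed set too
    -- small for `hbig`.
    · refine absurd (hbig (T ∪ T') (mem_union_right _ h2) ?_) (not_lt.2 (card_union_le _ _))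
      intro a ha b hab
      by_contra hb
      rw [mem_union, not_or] at hb
      rcases mem_union.1 ha with ha | ha
      · exact hb.2 ((h.eq_of_adj ha hb.1 hab).2 ▸ h2)
      · exact hb.1 ((h'.eq_of_adj ha hb.2 hab).2 ▸ h1)
    · exact h.false_of_mem h' hw hw' hne h1 h2
  by_cases h2 : w ∈ T'
  · exact (h'.false_of_mem h hw' hw hne.symm h2 h1).elim
  refine ⟨?_, h2, h1⟩
  by_contra hd
  -- If `v'` is outside `T`, then `T'`, grown from `v'`, could enter `T` only through `w`, which is
  -- not in `T'`.
  have key : ∀ {v w v' w' : V} {T T' : Finset V}, Pend k G v w T → Pend k G v' w' T' → w ∉ T' →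
      ¬ Disjoint T T' → v' ∈ T := by
    intro v w v' w' T T' h h' h2 hd
    by_contra hv
    refine hd (disjoint_right.2 ?_)
    refine h'.subset_of_closed (C := {x | x ∉ T}) hv fun a _ haT b hb hab hbT => ?_
    exact h2 ((h.eq_of_adj hbT haT hab.symm).2 ▸ ‹a ∈ T'›)
  have hv' := key h h' h2 hd
  have hv := key h' h h1 fun h => hd h.symm
  have hTT : T = T' := (h.subset_of_mem h' hv h1).antisymm (h'.subset_of_mem h hv' h2)
  have := h.eq_of_adj hv' h1 (h'.adj hw')
  exact hne (by rw [this.1, this.2])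

/-- Two disjoint pendant subgraphs attached at distant vertices contain very distant vertices. -/
theorem Pend.exists_dist (h : Pend k G v w T) (h' : Pend k G v' w' T') (hw : w ∉ T)
    (hw' : w' ∉ T') (hd : Disjoint T T') (h2 : w ∉ T') (hr : G.Reachable w w')
    {m : ℕ} (hm : ¬ G.edist w w' < m) :
    m + 2 * k + 2 ≤ G.finiteDiam := by
  obtain ⟨ψ, e1, e2, e3, ⟨x, hx, e4⟩, e5, e6⟩ := h.exists_depth
  obtain ⟨ψ', e1', e2', e3', ⟨x', hx', e4'⟩, e5', e6'⟩ := h'.exists_depth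
  -- Distance from `w`, truncated at `m`, so that it equals `m` at `w'` and never exceeds the values
  -- assigned on `T'`.
  set D : V → ℕ := fun u => (min (G.edist w u) m).toNat with hD
  have hDc : ∀ u, (D u : ℕ∞) = min (G.edist w u) m := fun u =>
    ENat.natCast_toNat (ne_top_of_le_ne_top (ENat.natCast_ne_top m) (min_le_right _ _))
  have hDadj : ∀ a b, G.Adj a b → D a ≤ D b + 1 := by
    intro a b hab
    have : ((D a : ℕ) : ℕ∞) ≤ ((D b + 1 : ℕ) : ℕ∞) := by
      push_cast
      rw [hDc, hDc]
      rcases le_total (G.edist w b) m with hb | hb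
      · rw [min_eq_left hb]
        refine (min_le_left _ _).trans ((G.edist_triangle (v := b)).trans (le_of_eq ?_))
        rw [SimpleGraph.edist_eq_one_iff_adj.2 hab.symm]
      · rw [min_eq_right hb]
        exact (min_le_right _ _).trans le_self_add
    exact_mod_cast this
  have hDw : D w = 0 := by simp [hD]
  have hDw' : D w' = m := by
    have := hDc w'
    rw [min_eq_right (not_lt.1 hm)] at this
    exact_mod_cast this
  have hDm : ∀ u, D u ≤ m := fun u => by
    have := (hDc u).le.trans (min_le_right _ _)
    exact_mod_cast this
  -- Potential running from `-(k + 1)` at the bottom of `T`, through `0` at `w` and `m` at `w'`, to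
  -- `m + k + 1` at the bottom of `T'`. Each set meets the outside in one edge only, so the pieces
  -- fit together with steps of at most one.
  set φ : V → ℤ := fun u => if u ∈ T then -(ψ u : ℤ) else if u ∈ T' then m + ψ' u else D u with hφ
  have hφadj : ∀ a b, G.Adj a b → φ a ≤ φ b + 1 := by
    intro a b hab
    have f1 := e5 a b hab
    have f2 := e5 b a hab.symm
    have f3 := e5' a b hab
    have f4 := hDadj a b hab
    simp only [hφ]
    by_cases ha : a ∈ T
    · rw [if_pos ha]
      by_cases hb : b ∈ T
      · rw [if_pos hb]; omega
      · rw [if_neg hb]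
        split_ifs <;> omega
    · rw [if_neg ha]
      by_cases hb : b ∈ T
      · have := h.eq_of_adj hb ha hab.symm
        rw [if_pos hb, this.1, this.2, if_neg h2, hDw, e2]
        norm_num
      · rw [if_neg hb]
        by_cases ha' : a ∈ T'
        · rw [if_pos ha']
          by_cases hb' : b ∈ T'
          · rw [if_pos hb']; omega
          · have := h'.eq_of_adj ha' hb' hab
            rw [if_neg hb', this.1, this.2, e2', hDw']
            push_cast; omega
        · rw [if_neg ha']
          by_cases hb' : b ∈ T'
          · rw [if_pos hb']
            have := hDm a
            omega
          · rw [if_neg hb']; omega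
  have hr' : G.Reachable x' x := by
    have r1 : G.Reachable v x := SimpleGraph.reachable_of_edist_ne_top
      (ne_top_of_le_ne_top (ENat.natCast_ne_top k) (e6 x hx))
    have r2 : G.Reachable v' x' := SimpleGraph.reachable_of_edist_ne_top
      (ne_top_of_le_ne_top (ENat.natCast_ne_top k) (e6' x' hx'))
    exact r2.symm.trans ((h'.adj hw').reachable.trans
      (hr.symm.trans ((h.adj hw).symm.reachable.trans r1)))
  have hdist : (m + 2 * k + 2 : ℤ) ≤ G.dist x' x := by
    have := le_add_of_edist_le (G := G) hφadj (x := x') (y := x) (m := G.dist x' x)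
      (hr'.coe_dist_eq_edist.ge)
    have hx'T : x' ∉ T := disjoint_right.1 hd hx'
    simp only [hφ, if_pos hx, if_neg hx'T, if_pos hx', e4, e4'] at this
    push_cast at this
    linarith
  have : Nonempty V := ⟨v⟩
  have := G.isGreatest_finiteDiam.2 ⟨x', x, hr', rfl⟩
  omega

end Pend

/-! ### Explorations in closed or separated sets -/

theorem grow_empty_left (cap t : ℕ) (hcap : 1 ≤ cap) (G : SimpleGraph V) (U : Finset V) :
    (grow cap t G ∅ U).1 = ∅ := by
  induction t generalizing U with
  | zero => rfl
  | succ t ih =>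
    have h1 : nbr G ∅ U = ∅ := by ext; simp [mem_nbr]
    rw [grow, if_neg (by rw [card_empty]; omega), h1]
    exact ih _

/-- An exploration inside a small closed set dies out. -/
theorem grow_empty_of_closed (cap t : ℕ) {G : SimpleGraph V} {A U C : Finset V}
    (hAU : Disjoint A U) (hC : ∀ a ∈ C, ∀ b, G.Adj a b → b ∈ C) (hA : A ⊆ C) (hcap : #C < cap)
    (ht : #(C ∩ (A ∪ U)) ≤ t) : (grow cap t G A U).1 = ∅ := by
  induction t generalizing A U with
  | zero =>
    rw [Nat.le_zero, card_eq_zero] at ht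
    rw [grow, ← subset_empty, ← ht]
    exact subset_inter hA subset_union_left
  | succ t ih =>
    have hA' : ¬ cap ≤ #A := by have := card_le_card hA; omega
    by_cases hA0 : A = ∅
    · rw [hA0]
      exact grow_empty_left _ _ (by omega) _ _
    rw [grow, if_neg hA']
    have hB : nbr G A U ⊆ C := fun b hb => by
      obtain ⟨-, a, ha, hab⟩ := mem_nbr.1 hb
      exact hC a (hA ha) b hab
    refine ih disjoint_sdiff hB ?_
    rw [union_sdiff_of_subset (nbr_subset G A U)]
    have h1 : C ∩ (A ∪ U) = A ∪ C ∩ U := by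
      rw [inter_union_distrib_left, inter_eq_right.2 hA]
    -- Each nonempty level uses up at least one vertex of `C`, so at most `#C` levels are possible;
    -- the cap is never reached as `#C < cap`.
    rw [h1, card_union_of_disjoint (hAU.mono_right inter_subset_right)] at ht
    have := card_pos.2 (nonempty_iff_ne_empty.2 hA0)
    omega

/-- With no edges between `W` and its complement in `A ∪ U`, the levels of the search inside `W` are
the traces on `W` of the full levels, hence empty when these are. The full search cannot have
stopped at the cap, since its last level is empty. -/
theorem grow_empty_of_inter (cap t : ℕ) (hcap : 1 ≤ cap) {G : SimpleGraph V} {A U W : Finset V}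
    (hAU : Disjoint A U)
    (hW : ∀ a ∈ A ∪ U, ∀ b ∈ A ∪ U, a ∈ W → b ∉ W → ¬ G.Adj a b)
    (h : (grow cap t G A U).1 = ∅) : (grow cap t G (A ∩ W) (U ∩ W)).1 = ∅ := by
  induction t generalizing A U with
  | zero =>
    have h' : A = ∅ := h
    simp [grow, h']
  | succ t ih =>
    rw [grow] at h ⊢
    have hA : ¬ cap ≤ #A := by
      intro hA
      rw [if_pos hA] at h
      have h' : A = ∅ := h
      rw [h', card_empty] at hA
      omega
    have hA' : ¬ cap ≤ #(A ∩ W) := fun h' => hA (h'.trans (card_le_card inter_subset_left))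
    rw [if_neg hA] at h
    rw [if_neg hA']
    have hn : nbr G (A ∩ W) (U ∩ W) = nbr G A U ∩ W := by
      ext u
      simp only [mem_nbr, mem_inter]
      constructor
      · rintro ⟨⟨hu, huW⟩, a, ⟨ha, -⟩, hab⟩
        exact ⟨⟨hu, a, ha, hab⟩, huW⟩
      · rintro ⟨⟨hu, a, ha, hab⟩, huW⟩
        refine ⟨⟨hu, huW⟩, a, ⟨ha, ?_⟩, hab⟩
        by_contra haW
        exact hW u (mem_union_right _ hu) a (mem_union_left _ ha) huW haW hab.symm
    have hs : (U ∩ W) \ (nbr G A U ∩ W) = (U \ nbr G A U) ∩ W := by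
      ext u; simp only [mem_inter, Finset.mem_sdiff]; tauto
    rw [hn, hs]
    refine ih disjoint_sdiff (fun a ha b hb => hW a ?_ b ?_) h
    · rw [union_sdiff_of_subset (nbr_subset G A U)] at ha
      exact mem_union_right _ ha
    · rw [union_sdiff_of_subset (nbr_subset G A U)] at hb
      exact mem_union_right _ hb

/-- If the exploration from the other neighbours of `w` survives, so does the one from `w`. -/
theorem Pend.grow_ne_empty {k : ℕ} {G : SimpleGraph V} {v w : V} {T : Finset V}
    (h : Pend k G v w T) {cap t : ℕ} (hcap : 2 ≤ cap)
    (hs : (grow cap t G (nbr G {w} (insert w T)ᶜ)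
      ((insert w T)ᶜ \ nbr G {w} (insert w T)ᶜ)).1 ≠ ∅) :
    (grow cap (t + 1) G {w} {w}ᶜ).1 ≠ ∅ := by
  intro h0
  apply hs
  rw [grow, if_neg (by rw [card_singleton]; omega)] at h0
  have hn : nbr G {w} {w}ᶜ ∩ (insert w T)ᶜ = nbr G {w} (insert w T)ᶜ := by
    ext u
    simp only [mem_inter, mem_nbr, mem_compl, mem_singleton, mem_insert, not_or]
    tauto
  have hU : ({w}ᶜ \ nbr G {w} {w}ᶜ) ∩ (insert w T)ᶜ =
      (insert w T)ᶜ \ nbr G {w} (insert w T)ᶜ := by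
    rw [← hn]
    ext u
    simp only [mem_inter, Finset.mem_sdiff, mem_compl, mem_singleton, mem_insert, not_or]
    tauto
  rw [← hn] at *
  rw [← hU]
  refine grow_empty_of_inter cap t (by omega) disjoint_sdiff ?_ h0
  intro a _ b hb ha hb' hab
  rw [union_sdiff_of_subset (nbr_subset _ _ _)] at hb
  rw [mem_compl, not_not, mem_insert] at hb'
  simp only [mem_compl, mem_singleton, mem_insert, not_or] at ha hb
  exact ha.1 (h.eq_of_adj (hb'.resolve_left hb) ha.2 hab.symm).2

end Pendant

/-! ### Probability that the exploration dies at a given depth -/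

section Counting

/-- The exploration from `A` dies after exactly `k` levels and sees at most `S` vertices. -/
def DiesSmall (k S : ℕ) (G : SimpleGraph V) (A U : Finset V) : Prop :=
  ∃ T, Dies k G A U T ∧ #T ≤ S

theorem diesSmall_zero_iff {S : ℕ} {G : SimpleGraph V} {A U : Finset V} :
    DiesSmall 0 S G A U ↔ nbr G A U = ∅ ∧ A ≠ ∅ ∧ #A ≤ S := by
  constructor
  · rintro ⟨T, ⟨h1, h2, rfl⟩, h3⟩
    exact ⟨h2, h1, h3⟩
  · rintro ⟨h2, h1, h3⟩
    exact ⟨A, ⟨h1, h2, rfl⟩, h3⟩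

theorem DiesSmall.card_le {k S : ℕ} {G : SimpleGraph V} {A U : Finset V}
    (h : DiesSmall k S G A U) : #A ≤ S := by
  obtain ⟨T, hT, hS⟩ := h
  exact (card_le_card hT.subset).trans hS

/-- The remaining budget decreases by the size of the current level; `#A ≤ S` prevents truncation in
the natural subtraction. -/
theorem diesSmall_succ_iff {k S : ℕ} {G : SimpleGraph V} {A U : Finset V} (hAU : Disjoint A U)
    (hS : #A ≤ S) :
    DiesSmall (k + 1) S G A U ↔ DiesSmall k (S - #A) G (nbr G A U) (U \ nbr G A U) := by
  constructor
  · rintro ⟨T, ⟨h1, h2⟩, h3⟩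
    refine ⟨T \ A, h2, ?_⟩
    rw [card_sdiff_of_subset h1]
    omega
  · rintro ⟨T, hT, hc⟩
    have hd : Disjoint A T := by
      have h := hT.subset_union
      rw [union_sdiff_of_subset (nbr_subset G A U)] at h
      exact hAU.mono_right h
    refine ⟨A ∪ T, ⟨subset_union_left, ?_⟩, ?_⟩
    · rwa [union_sdiff_cancel_left hd]
    · rw [card_union_of_disjoint hd]
      omega

theorem dep_diesSmall (k S : ℕ) (A U : Finset V) :
    Dep (Within (A ∪ U)) (fun G => DiesSmall k S G A U) := by
  intro G H h
  simp only [DiesSmall]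
  congr 1
  ext T
  have := dep_dies k A U T G H h
  simp only at this
  rw [this]

theorem gnpP_diesSmall_of_lt {k S : ℕ} (p : ℝ) {A U : Finset V} (h : S < #A) :
    gnpP p (fun G => DiesSmall k S G A U) = 0 := by
  have : ∀ G : SimpleGraph V, ¬ DiesSmall k S G A U := fun G hG => by
    have := hG.card_le
    omega
  simp [gnpP, ind_of_not (this _), gnpE_const]

theorem gnpP_diesSmall_zero {S : ℕ} (p : ℝ) {A U : Finset V} (hAU : Disjoint A U) (hA : A ≠ ∅)
    (hS : #A ≤ S) :
    gnpP p (fun G => DiesSmall 0 S G A U) = (1 - p) ^ (#A * #U) := by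
  simp only [diesSmall_zero_iff, hA, hS, ne_eq, not_false_eq_true, and_true]
  rw [gnpP_nbr_eq p A U hAU (empty_subset U), card_empty, pow_zero, one_mul, Nat.sub_zero, hitProb,
    sub_sub_cancel, ← pow_mul]

theorem gnpP_diesSmall_succ {k S : ℕ} (p : ℝ) {A U : Finset V} (hAU : Disjoint A U)
    (hS : #A ≤ S) :
    gnpP p (fun G => DiesSmall (k + 1) S G A U) =
      ∑ B ∈ U.powerset, hitProb p #A ^ #B * (1 - hitProb p #A) ^ (#U - #B) *
        gnpP p (fun G => DiesSmall k (S - #A) G B (U \ B)) := by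
  simp only [diesSmall_succ_iff hAU hS]
  refine gnpE_explore p A U hAU (fun B G => ind (DiesSmall k (S - #A) G B (U \ B))) (Within U)
    (fun a b ha _ => ?_) fun B hB => ?_
  · have := disjoint_left.1 hAU ha
    exact ⟨fun h => this h.1, fun h => this h.2⟩
  · have := (dep_diesSmall k (S - #A) B (U \ B)).comp ind
    rwa [union_sdiff_of_subset hB] at this

/-- The probability that a Poisson branching process with mean `m`, started from `a` individuals,
has its last nonempty generation at time `k` and has total progeny at most `S`. -/
noncomputable def treeW (m : ℝ) : ℕ → ℕ → ℕ → ℝ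
  | 0, a, S => if 1 ≤ a ∧ a ≤ S then Real.exp (-(m * a)) else 0
  | k + 1, a, S => if a ≤ S then ∑ b ∈ range (S - a + 1),
      Real.exp (-(m * a)) * (m * a) ^ b / (b.factorial : ℝ) * treeW m k b (S - a) else 0

theorem treeW_of_lt {m : ℝ} {k a S : ℕ} (h : S < a) : treeW m k a S = 0 := by
  cases k with
  | zero => rw [treeW, if_neg (by omega)]
  | succ k => rw [treeW, if_neg (by omega)]

theorem treeW_nonneg {m : ℝ} (hm : 0 ≤ m) (k a S : ℕ) : 0 ≤ treeW m k a S := by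
  induction k generalizing a S with
  | zero =>
    rw [treeW]
    split_ifs <;> positivity
  | succ k ih =>
    rw [treeW]
    split_ifs
    · refine sum_nonneg fun b _ => mul_nonneg (by positivity) (ih _ _)
    · exact le_rfl

/-- First moment bound: generation `k` must be nonempty, and its mean size is `a * m ^ k`. -/
theorem treeW_le {m : ℝ} (hm : 0 ≤ m) (k a S : ℕ) : treeW m k a S ≤ a * m ^ k := by
  induction k generalizing a S with
  | zero =>
    rw [treeW]
    split_ifs with h
    · have h1 : (1 : ℝ) ≤ a := by exact_mod_cast h.1
      have : Real.exp (-(m * a)) ≤ 1 := by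
        rw [Real.exp_le_one_iff]
        have : 0 ≤ m * a := by positivity
        linarith
      simpa using this.trans h1
    · positivity
  | succ k ih =>
    rw [treeW]
    split_ifs with h
    · have hx : 0 ≤ m * a := by positivity
      have h1 : ∑ b ∈ range (S - a + 1),
          Real.exp (-(m * a)) * (m * a) ^ b / (b.factorial : ℝ) * treeW m k b (S - a) ≤
          ∑ b ∈ range (S - a + 1),
          Real.exp (-(m * a)) * (m * a) ^ b / (b.factorial : ℝ) * (b * m ^ k) :=
        sum_le_sum fun b _ => mul_le_mul_of_nonneg_left (ih _ _) (by positivity)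
      refine h1.trans ?_
      rw [sum_range_succ']
      have h2 : ∀ b ∈ range (S - a), Real.exp (-(m * a)) * (m * a) ^ (b + 1) /
          ((b + 1).factorial : ℝ) * (((b + 1 : ℕ) : ℝ) * m ^ k) =
          Real.exp (-(m * a)) * (m * a) * m ^ k * ((m * a) ^ b / (b.factorial : ℝ)) := by
        intro b _
        have : (b.factorial : ℝ) ≠ 0 := by positivity
        have h3 : ((b : ℝ) + 1) ≠ 0 := by positivity
        rw [Nat.factorial_succ]
        push_cast
        field_simp
        ring
      rw [sum_congr rfl h2, ← mul_sum]
      have h4 := mul_le_mul_of_nonneg_left (Real.sum_le_exp_of_nonneg hx (S - a))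
        (show 0 ≤ Real.exp (-(m * a)) * (m * a) * m ^ k by positivity)
      refine (add_le_add_left h4 _).trans (le_of_eq ?_)
      have h5 : Real.exp (-(m * a)) * Real.exp (m * a) = 1 := by rw [← Real.exp_add]; simp
      simp only [CharP.cast_eq_zero, zero_mul, mul_zero, add_zero]
      calc _ = (Real.exp (-(m * a)) * Real.exp (m * a)) * ((m * a) * m ^ k) := by ring
        _ = _ := by rw [h5]; ring
    · positivity

/-- Reduction of a sum over subsets to a sum over their sizes, for summands supported on small
sizes. -/
theorem sum_powerset_eq_range {U : Finset V} {s : ℕ} (hs : s ≤ #U) (f : ℕ → ℝ)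
    (hf : ∀ b, s < b → f b = 0) :
    ∑ B ∈ U.powerset, f #B = ∑ b ∈ range (s + 1), ((#U).choose b : ℝ) * f b := by
  rw [sum_powerset_apply_card]
  simp only [nsmul_eq_mul]
  symm
  refine sum_subset (range_mono (by omega)) fun b _ hb => ?_
  rw [hf b (by simpa using hb), mul_zero]

/-- Duality: since `m * exp (-m) = lam * exp (-lam)`, a finite forest with `a` roots has under mean
`lam` exactly `(m / lam) ^ a` times its weight under mean `m`. The invariant `hS` guarantees that at
most `S₀` vertices are missing whenever an edge is required to be absent; each of the at most `S`
explored vertices then costs a factor `exp (p * S₀)`. -/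
theorem gnpP_diesSmall_le {p lam m : ℝ} {n S₀ : ℕ} (hp : 0 ≤ p) (hp1 : p ≤ 1) (hlam : 0 < lam)
    (hpn : p * n = lam) (hm : 0 < m) (hdual : m * Real.exp (-m) = lam * Real.exp (-lam))
    (hS₀ : S₀ ≤ n) (k S : ℕ) (A U : Finset V) (hAU : Disjoint A U) (hn : #A + #U ≤ n)
    (hS : n + S ≤ S₀ + #A + #U) :
    gnpP p (fun G => DiesSmall k S G A U) ≤
      Real.exp (p * S₀) ^ S * (m / lam) ^ #A * treeW m k #A S := by
  have hE : 1 ≤ Real.exp (p * S₀) := Real.one_le_exp (by positivity)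
  have hexp : Real.exp (-lam) = m / lam * Real.exp (-m) := by
    rw [div_mul_eq_mul_div, hdual]; field_simp
  -- the probability of seeing no further vertices
  have hQ : ∀ a N : ℕ, n ≤ N + S₀ → (1 - p) ^ (a * N) ≤
      Real.exp (p * S₀) ^ a * (m / lam) ^ a * Real.exp (-(m * a)) := by
    intro a N hN
    have hN' : (n : ℝ) ≤ N + S₀ := by exact_mod_cast hN
    have h1 : (1 - p) ^ N ≤ Real.exp (p * S₀) * (m / lam) * Real.exp (-m) := by
      calc (1 - p) ^ N ≤ Real.exp (-p) ^ N :=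
            pow_le_pow_left₀ (by linarith) (Real.one_sub_le_exp_neg p) N
        _ = Real.exp (-(p * N)) := by rw [← Real.exp_nat_mul]; congr 1; ring
        _ ≤ Real.exp (p * S₀ + -lam) := by
            refine Real.exp_le_exp.2 ?_
            have := mul_le_mul_of_nonneg_left hN' hp
            linarith
        _ = _ := by rw [Real.exp_add, hexp]; ring
    calc (1 - p) ^ (a * N) = ((1 - p) ^ N) ^ a := by rw [mul_comm, pow_mul]
      _ ≤ (Real.exp (p * S₀) * (m / lam) * Real.exp (-m)) ^ a :=
          pow_le_pow_left₀ (pow_nonneg (by linarith) _) h1 a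
      _ = _ := by
          rw [mul_pow, mul_pow, ← Real.exp_nat_mul (-m)]
          congr 2; ring
  induction k generalizing S A U with
  | zero =>
    by_cases hA : A ≠ ∅ ∧ #A ≤ S
    · rw [gnpP_diesSmall_zero p hAU hA.1 hA.2, treeW,
        if_pos ⟨card_pos.2 (nonempty_iff_ne_empty.2 hA.1), hA.2⟩]
      refine (hQ _ _ (by omega)).trans ?_
      have := pow_le_pow_right₀ hE hA.2
      gcongr
    · have : ∀ G : SimpleGraph V, ¬ DiesSmall 0 S G A U := fun G hG =>
        hA (diesSmall_zero_iff.1 hG).2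
      simp only [gnpP, ind_of_not (this _), gnpE_const]
      have := treeW_nonneg hm.le 0 #A S
      positivity
  | succ k ih =>
    rcases lt_or_ge S #A with h | h
    · rw [gnpP_diesSmall_of_lt p h, treeW_of_lt h, mul_zero]
    rw [gnpP_diesSmall_succ p hAU h]
    set a := #A with ha
    set N := #U with hNdef
    have hπ0 := hitProb_nonneg hp hp1 a
    have hπ1 := hitProb_le_one hp1 a
    have hW := treeW_nonneg hm.le k
    set f : ℕ → ℝ := fun b => hitProb p a ^ b * (1 - hitProb p a) ^ (N - b) *
      (Real.exp (p * S₀) ^ (S - a) * (m / lam) ^ b * treeW m k b (S - a)) with hf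
    have h1 : ∑ B ∈ U.powerset, hitProb p a ^ #B * (1 - hitProb p a) ^ (N - #B) *
        gnpP p (fun G => DiesSmall k (S - a) G B (U \ B)) ≤ ∑ B ∈ U.powerset, f #B := by
      refine sum_le_sum fun B hB => mul_le_mul_of_nonneg_left ?_
        (mul_nonneg (pow_nonneg hπ0 _) (pow_nonneg (by linarith) _))
      have hB' := mem_powerset.1 hB
      have hc : #B + #(U \ B) = N := by
        rw [card_sdiff_of_subset hB']
        have := card_le_card hB'
        omega
      exact ih _ _ _ disjoint_sdiff (by omega) (by omega)
    refine h1.trans ?_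
    rw [sum_powerset_eq_range (s := S - a) (by omega) f
      (fun b hb => by rw [hf]; simp only [treeW_of_lt hb, mul_zero]), treeW, if_pos h, mul_sum]
    refine sum_le_sum fun b hb => ?_
    have hb' : b ≤ S - a := by simpa [Nat.lt_succ_iff] using hb
    have hlamN : (N : ℝ) * hitProb p a ≤ lam * a := by
      have h2 : (N : ℝ) ≤ n := by exact_mod_cast (by omega : N ≤ n)
      calc (N : ℝ) * hitProb p a ≤ n * (p * a) :=
            mul_le_mul h2 (hitProb_le hp1 a) hπ0 (by positivity)
        _ = _ := by rw [← hpn]; ring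
    have hC : ((N.choose b : ℕ) : ℝ) * hitProb p a ^ b ≤ (lam * a) ^ b / (b.factorial : ℝ) := by
      calc ((N.choose b : ℕ) : ℝ) * hitProb p a ^ b
          ≤ (N : ℝ) ^ b / (b.factorial : ℝ) * hitProb p a ^ b :=
            mul_le_mul_of_nonneg_right (Nat.choose_le_pow_div b N) (pow_nonneg hπ0 _)
        _ = ((N : ℝ) * hitProb p a) ^ b / (b.factorial : ℝ) := by rw [mul_pow]; ring
        _ ≤ _ := by
            have : 0 ≤ (N : ℝ) * hitProb p a := by positivity
            gcongr
    have hq : (1 - hitProb p a) ^ (N - b) ≤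
        Real.exp (p * S₀) ^ a * (m / lam) ^ a * Real.exp (-(m * a)) := by
      rw [hitProb, sub_sub_cancel, ← pow_mul]
      exact hQ a (N - b) (by omega)
    have hq0 : 0 ≤ (1 - hitProb p a) ^ (N - b) := pow_nonneg (by linarith) _
    have hWb := hW b (S - a)
    calc ((N.choose b : ℕ) : ℝ) * f b = (((N.choose b : ℕ) : ℝ) * hitProb p a ^ b) *
          (1 - hitProb p a) ^ (N - b) *
          (Real.exp (p * S₀) ^ (S - a) * (m / lam) ^ b * treeW m k b (S - a)) := by
          rw [hf]; ring
      _ ≤ (lam * a) ^ b / (b.factorial : ℝ) *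
          (Real.exp (p * S₀) ^ a * (m / lam) ^ a * Real.exp (-(m * a))) *
          (Real.exp (p * S₀) ^ (S - a) * (m / lam) ^ b * treeW m k b (S - a)) := by
          gcongr
      _ = Real.exp (p * S₀) ^ (a + (S - a)) * (m / lam) ^ a * (Real.exp (-(m * a)) *
          (lam * a * (m / lam)) ^ b / (b.factorial : ℝ) * treeW m k b (S - a)) := by
          rw [pow_add, mul_pow (lam * a)]; ring
      _ = _ := by
          -- Each new vertex carries its own factor `m / lam`, which changes the Poisson parameter
          -- from `lam * a` to `m * a`.
          rw [Nat.add_sub_cancel' h, show lam * a * (m / lam) = m * a by field_simp]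

/-- The converse of the duality bound. Every explored vertex costs one factor `1 - ε` for its absent
edges and one for having been found; the starting vertices were not found by a step, hence the
exponent `2 * S - #A`. -/
theorem le_gnpP_diesSmall {p lam m ε : ℝ} {n S₀ : ℕ} (hp : 0 ≤ p) (hp1 : p ≤ 1) (hlam : 0 < lam)
    (hε : 0 ≤ ε) (hε1 : ε ≤ 1) (hm : 0 < m)
    (hdual : m * Real.exp (-m) = lam * Real.exp (-lam))
    (h1 : ∀ a M : ℕ, a ≤ S₀ → n ≤ M + S₀ → lam * (1 - ε) * a ≤ M * hitProb p a)
    (h2 : Real.exp (-lam) * (1 - ε) ≤ (1 - p) ^ n)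
    (hS₀ : S₀ ≤ n) (k S : ℕ) (A U : Finset V) (hAU : Disjoint A U) (hn : #A + #U ≤ n)
    (hS : n + S ≤ S₀ + #A + #U) :
    (1 - ε) ^ (2 * S - #A) * (m / lam) ^ #A * treeW m k #A S ≤
      gnpP p (fun G => DiesSmall k S G A U) := by
  have hε' : 0 ≤ 1 - ε := by linarith
  have hε1' : 1 - ε ≤ 1 := by linarith
  have hp' : 0 ≤ 1 - p := by linarith
  have hexp : Real.exp (-lam) = m / lam * Real.exp (-m) := by
    rw [div_mul_eq_mul_div, hdual]; field_simp
  have hQ : ∀ a N : ℕ, N ≤ n → (m / lam) ^ a * Real.exp (-(m * a)) * (1 - ε) ^ a ≤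
      (1 - p) ^ (a * N) := by
    intro a N hN
    calc (m / lam) ^ a * Real.exp (-(m * a)) * (1 - ε) ^ a
        = (Real.exp (-lam) * (1 - ε)) ^ a := by
          rw [hexp, mul_pow, mul_pow, ← Real.exp_nat_mul (-m)]
          congr 3; ring
      _ ≤ ((1 - p) ^ n) ^ a := pow_le_pow_left₀ (by positivity) h2 a
      _ ≤ ((1 - p) ^ N) ^ a :=
          pow_le_pow_left₀ (pow_nonneg hp' _) (pow_le_pow_of_le_one hp' (by linarith) hN) a
      _ = _ := by rw [← pow_mul, mul_comm]
  induction k generalizing S A U with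
  | zero =>
    by_cases hA : A ≠ ∅ ∧ #A ≤ S
    · rw [gnpP_diesSmall_zero p hAU hA.1 hA.2, treeW,
        if_pos ⟨card_pos.2 (nonempty_iff_ne_empty.2 hA.1), hA.2⟩]
      refine le_trans ?_ (hQ #A #U (by omega))
      have := mul_le_mul_of_nonneg_left
        (pow_le_pow_of_le_one hε' hε1' (by omega : #A ≤ 2 * S - #A))
        (show 0 ≤ (m / lam) ^ #A * Real.exp (-(m * #A)) by positivity)
      refine le_trans (le_of_eq ?_) this
      ring
    · have : treeW m 0 #A S = 0 := by
        rw [treeW, if_neg]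
        rintro ⟨h3, h4⟩
        exact hA ⟨nonempty_iff_ne_empty.1 (card_pos.1 h3), h4⟩
      rw [this, mul_zero]
      exact gnpP_nonneg hp hp1 _
  | succ k ih =>
    rcases lt_or_ge S #A with h | h
    · rw [gnpP_diesSmall_of_lt p h, treeW_of_lt h, mul_zero]
    rw [gnpP_diesSmall_succ p hAU h]
    set a := #A with ha
    set N := #U with hNdef
    have hπ0 := hitProb_nonneg hp hp1 a
    have hπ1 := hitProb_le_one hp1 a
    have hW := treeW_nonneg hm.le k
    set f : ℕ → ℝ := fun b => hitProb p a ^ b * (1 - hitProb p a) ^ (N - b) *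
      ((1 - ε) ^ (2 * (S - a) - b) * (m / lam) ^ b * treeW m k b (S - a)) with hf
    have h3 : ∑ B ∈ U.powerset, f #B ≤
        ∑ B ∈ U.powerset, hitProb p a ^ #B * (1 - hitProb p a) ^ (N - #B) *
        gnpP p (fun G => DiesSmall k (S - a) G B (U \ B)) := by
      refine sum_le_sum fun B hB => mul_le_mul_of_nonneg_left ?_
        (mul_nonneg (pow_nonneg hπ0 _) (pow_nonneg (by linarith) _))
      have hB' := mem_powerset.1 hB
      have hc : #B + #(U \ B) = N := by
        rw [card_sdiff_of_subset hB']
        have := card_le_card hB'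
        omega
      exact ih _ _ _ disjoint_sdiff (by omega) (by omega)
    refine le_trans ?_ h3
    rw [sum_powerset_eq_range (s := S - a) (by omega) f
      (fun b hb => by rw [hf]; simp only [treeW_of_lt hb, mul_zero]), treeW, if_pos h, mul_sum]
    refine sum_le_sum fun b hb => ?_
    have hb' : b ≤ S - a := by simpa [Nat.lt_succ_iff] using hb
    have hC : (lam * (1 - ε) * a) ^ b / (b.factorial : ℝ) ≤
        ((N.choose b : ℕ) : ℝ) * hitProb p a ^ b := by
      calc (lam * (1 - ε) * a) ^ b / (b.factorial : ℝ)
          ≤ (((N + 1 - b : ℕ) : ℝ) * hitProb p a) ^ b / (b.factorial : ℝ) := by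
            have := h1 a (N + 1 - b) (by omega) (by omega)
            gcongr
        _ = ((N + 1 - b : ℕ) : ℝ) ^ b / (b.factorial : ℝ) * hitProb p a ^ b := by
            rw [mul_pow]; ring
        _ ≤ _ := mul_le_mul_of_nonneg_right (Nat.pow_le_choose b N) (pow_nonneg hπ0 _)
    have hq : (m / lam) ^ a * Real.exp (-(m * a)) * (1 - ε) ^ a ≤
        (1 - hitProb p a) ^ (N - b) := by
      rw [hitProb, sub_sub_cancel, ← pow_mul]
      exact hQ a (N - b) (by omega)
    have hWb := hW b (S - a)
    calc (1 - ε) ^ (2 * S - a) * (m / lam) ^ a * (Real.exp (-(m * a)) *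
          (m * a) ^ b / (b.factorial : ℝ) * treeW m k b (S - a))
        = (1 - ε) ^ (b + a + (2 * (S - a) - b)) * (m / lam) ^ a * (Real.exp (-(m * a)) *
          (lam * a * (m / lam)) ^ b / (b.factorial : ℝ) * treeW m k b (S - a)) := by
          rw [show lam * a * (m / lam) = m * a by field_simp]
          congr 3; omega
      _ = (lam * (1 - ε) * a) ^ b / (b.factorial : ℝ) *
          ((m / lam) ^ a * Real.exp (-(m * a)) * (1 - ε) ^ a) *
          ((1 - ε) ^ (2 * (S - a) - b) * (m / lam) ^ b * treeW m k b (S - a)) := by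
          rw [pow_add, pow_add, mul_pow (lam * a), show lam * (1 - ε) * a = lam * a * (1 - ε) by ring,
            mul_pow (lam * a) (1 - ε)]
          ring
      _ ≤ ((N.choose b : ℕ) * hitProb p a ^ b) * (1 - hitProb p a) ^ (N - b) *
          ((1 - ε) ^ (2 * (S - a) - b) * (m / lam) ^ b * treeW m k b (S - a)) := by
          have : 0 ≤ (lam * (1 - ε) * a) ^ b / (b.factorial : ℝ) := by positivity
          gcongr
      _ = ((N.choose b : ℕ) : ℝ) * f b := by
          rw [hf]; ring

/-! ### Depth and total progeny of a subcritical Poisson process -/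

/-- Here `vit m k 1` is the probability that one individual has descendants in generation `k`. Its
reciprocal satisfies an affine recursion, now expanding at rate `1 / m`. -/
theorem pow_le_vit {m : ℝ} (hm : 0 < m) (hm1 : m < 1) (k : ℕ) : (1 - m) * m ^ k ≤ vit m k 1 := by
  have key : ∀ k, (vit m k 1)⁻¹ + m / (1 - m) ≤ (1 / (1 - m)) * (m ^ k)⁻¹ := by
    intro k
    have h1m : 0 < 1 - m := by linarith
    induction k with
    | zero =>
      simp only [vit, inv_one, pow_zero, mul_one]
      apply le_of_eq; field_simp; ring
    | succ k ih =>
      have hv := vit_pos hm one_pos k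
      have h := inv_one_sub_exp_neg_le (mul_pos hm hv)
      have h2 := mul_le_mul_of_nonneg_left ih (inv_nonneg.2 hm.le)
      rw [vit, pow_succ]
      calc (1 - Real.exp (-(m * vit m k 1)))⁻¹ + m / (1 - m)
          ≤ (m * vit m k 1)⁻¹ + 1 + m / (1 - m) := by linarith
        _ = m⁻¹ * ((vit m k 1)⁻¹ + m / (1 - m)) := by
            rw [mul_inv]; field_simp; ring
        _ ≤ m⁻¹ * (1 / (1 - m) * (m ^ k)⁻¹) := h2
        _ = _ := by rw [mul_inv]; ring
  have hv := vit_pos hm one_pos k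
  have h1m : 0 < 1 - m := by linarith
  have h := key k
  have h3 : (vit m k 1)⁻¹ ≤ ((1 - m) * m ^ k)⁻¹ := by
    rw [mul_inv, ← one_div (1 - m)]
    have : 0 < m / (1 - m) := by positivity
    linarith
  exact (inv_le_inv₀ hv (by positivity)).1 h3

/-- Without restriction on the progeny the probability is the difference of two extinction
probabilities. The subtracted term is a Chernoff bound for progeny exceeding `S`: for one root the
generating function of the total progeny at `1 / τ` equals `1 / m`, the value where `x * exp (m * (1
- x))` is maximal. -/
theorem le_treeW {m : ℝ} (hm : 0 < m) (hm1 : m < 1) (k a S : ℕ) :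
    (1 - vit m (k + 1) 1) ^ a - (1 - vit m k 1) ^ a -
      (m * Real.exp (1 - m)) ^ S * (m⁻¹) ^ a ≤ treeW m k a S := by
  set τ := m * Real.exp (1 - m) with hτ
  have hτ0 : 0 < τ := by positivity
  have hg1 : 1 ≤ m⁻¹ := (one_le_inv₀ hm).2 hm1.le
  have hτg : τ * m⁻¹ = Real.exp (1 - m) := by rw [hτ]; field_simp
  have hτg1 : 1 ≤ τ * m⁻¹ := by rw [hτg]; exact Real.one_le_exp (by linarith)
  -- In this range the subtracted term is at least `(τ / m) ^ S ≥ 1`. So the bound is trivial there,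
  -- and the missing tail of the Poisson sum has the right sign.
  have hbig : ∀ k a S : ℕ, S ≤ a → (1 - vit m (k + 1) 1) ^ a - (1 - vit m k 1) ^ a -
      τ ^ S * (m⁻¹) ^ a ≤ 0 := by
    intro k a S h
    have h1 := vit_mem hm.le (k + 1) zero_le_one (le_refl (1 : ℝ))
    have h2 := vit_mem hm.le k zero_le_one (le_refl (1 : ℝ))
    have h3 : (1 - vit m (k + 1) 1) ^ a ≤ 1 := pow_le_one₀ (by linarith) (by linarith)
    have h4 : 0 ≤ (1 - vit m k 1) ^ a := pow_nonneg (by linarith) _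
    have h5 : 1 ≤ τ ^ S * (m⁻¹) ^ a := by
      calc (1 : ℝ) ≤ (τ * m⁻¹) ^ S := one_le_pow₀ hτg1
        _ = τ ^ S * (m⁻¹) ^ S := mul_pow _ _ _
        _ ≤ τ ^ S * (m⁻¹) ^ a :=
            mul_le_mul_of_nonneg_left (pow_le_pow_right₀ hg1 h) (by positivity)
    linarith
  induction k generalizing a S with
  | zero =>
    rcases lt_or_ge S a with h | h
    · rw [treeW_of_lt h]; exact hbig 0 a S h.le
    rcases Nat.eq_zero_or_pos a with rfl | ha
    · have : treeW m 0 0 S = 0 := by rw [treeW, if_neg (by omega)]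
      rw [this]
      have : 0 < τ ^ S := by positivity
      simpa using this.le
    · rw [treeW, if_pos ⟨ha, h⟩]
      simp only [vit, mul_one, sub_sub_cancel, sub_self, zero_pow (by omega : a ≠ 0), sub_zero]
      have h1 : Real.exp (-m) ^ a = Real.exp (-(m * a)) := by
        rw [← Real.exp_nat_mul]; congr 1; ring
      have : 0 < τ ^ S * (m⁻¹) ^ a := by positivity
      linarith
  | succ k ih =>
    rcases lt_or_ge S a with h | h
    · rw [treeW_of_lt h]; exact hbig (k + 1) a S h.le
    rw [treeW, if_pos h]
    have hsum : ∀ s : ℝ, HasSum (fun b : ℕ => Real.exp (-(m * a)) * (m * a) ^ b /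
        (b.factorial : ℝ) * s ^ b) (Real.exp (-(m * a) + m * a * s)) := by
      intro s
      have := (NormedSpace.expSeries_div_hasSum_exp (m * a * s)).mul_left (Real.exp (-(m * a)))
      rw [← Real.exp_eq_exp_ℝ, ← Real.exp_add] at this
      have e : (fun b : ℕ => Real.exp (-(m * a)) * (m * a) ^ b / (b.factorial : ℝ) * s ^ b) =
          fun b : ℕ => Real.exp (-(m * a)) * ((m * a * s) ^ b / (b.factorial : ℝ)) := by
        ext b
        rw [mul_pow (m * a) s]; ring
      rw [e]
      exact this
    -- The left-hand side solves the untruncated branching recursion exactly: averaging `s ^ b` over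
    -- a Poisson variable of mean `m * a` gives `exp (m * a * (s - 1))`, and `s = 1 / m` gives `(τ /
    -- m) ^ a`.
    have hH : HasSum (fun b : ℕ => Real.exp (-(m * a)) * (m * a) ^ b / (b.factorial : ℝ) *
        ((1 - vit m (k + 1) 1) ^ b - (1 - vit m k 1) ^ b - τ ^ (S - a) * (m⁻¹) ^ b))
        ((1 - vit m (k + 1 + 1) 1) ^ a - (1 - vit m (k + 1) 1) ^ a - τ ^ S * (m⁻¹) ^ a) := by
      have h3 := ((hsum (1 - vit m (k + 1) 1)).sub (hsum (1 - vit m k 1))).sub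
        ((hsum m⁻¹).mul_left (τ ^ (S - a)))
      have e0 : (fun b : ℕ => Real.exp (-(m * a)) * (m * a) ^ b / (b.factorial : ℝ) *
          ((1 - vit m (k + 1) 1) ^ b - (1 - vit m k 1) ^ b - τ ^ (S - a) * (m⁻¹) ^ b)) =
          fun b : ℕ => Real.exp (-(m * a)) * (m * a) ^ b / (b.factorial : ℝ) *
            (1 - vit m (k + 1) 1) ^ b - Real.exp (-(m * a)) * (m * a) ^ b / (b.factorial : ℝ) *
            (1 - vit m k 1) ^ b - τ ^ (S - a) * (Real.exp (-(m * a)) * (m * a) ^ b /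
            (b.factorial : ℝ) * (m⁻¹) ^ b) := by
        ext b; ring
      rw [e0]
      have e3 : (1 - vit m (k + 1 + 1) 1) ^ a - (1 - vit m (k + 1) 1) ^ a - τ ^ S * (m⁻¹) ^ a =
          Real.exp (-(m * a) + m * a * (1 - vit m (k + 1) 1)) -
          Real.exp (-(m * a) + m * a * (1 - vit m k 1)) -
          τ ^ (S - a) * Real.exp (-(m * a) + m * a * m⁻¹) := by
        have e1 : ∀ j, (1 - vit m (j + 1) 1) ^ a =
            Real.exp (-(m * a) + m * a * (1 - vit m j 1)) := by
          intro j
          rw [vit, sub_sub_cancel, ← Real.exp_nat_mul]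
          congr 1; ring
        rw [e1, e1]
        congr 1
        have e2 : Real.exp (-(m * a) + m * a * m⁻¹) = Real.exp (1 - m) ^ a := by
          rw [← Real.exp_nat_mul]
          congr 1
          field_simp; ring
        rw [e2, ← hτg, mul_pow τ, ← mul_assoc, ← pow_add, Nat.sub_add_cancel h]
      rw [e3]
      exact h3
    calc _ ≤ ∑ b ∈ range (S - a + 1), Real.exp (-(m * a)) * (m * a) ^ b / (b.factorial : ℝ) *
          ((1 - vit m (k + 1) 1) ^ b - (1 - vit m k 1) ^ b - τ ^ (S - a) * (m⁻¹) ^ b) := by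
          have h4 := sum_le_hasSum (range (S - a + 1)) (fun b hb => ?_) hH.neg
          · rw [sum_neg_distrib] at h4
            linarith
          · rw [mem_range, not_lt] at hb
            have := hbig k b (S - a) (by omega)
            exact neg_nonneg.2 (mul_nonpos_of_nonneg_of_nonpos (by positivity) this)
      _ ≤ _ := sum_le_sum fun b _ => mul_le_mul_of_nonneg_left (ih b (S - a)) (by positivity)

/-- The chance of surviving to generation `k` but not `k + 1` is at least a fraction `1 - m` of the
chance of surviving to generation `k`. -/
theorem le_one_sub_vit_sub {m : ℝ} (hm : 0 < m) (hm1 : m < 1) (k : ℕ) :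
    (1 - m) ^ 2 * m ^ k ≤ (1 - vit m (k + 1) 1) ^ 1 - (1 - vit m k 1) ^ 1 := by
  have h1 := pow_le_vit hm hm1 k
  have h2 : vit m (k + 1) 1 ≤ m * vit m k 1 := by
    rw [vit]
    have := Real.one_sub_le_exp_neg (m * vit m k 1)
    linarith
  have h3 := mul_le_mul_of_nonneg_left h1 (by linarith : 0 ≤ 1 - m)
  nlinarith

end Counting

/-! ### Probabilities of pendant subgraphs -/

section PendantProbability

theorem gnpP_of_forall_not (p : ℝ) {A : SimpleGraph V → Prop} (h : ∀ G, ¬ A G) : gnpP p A = 0 := by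
  simp only [gnpP, ind_of_not (h _), gnpE_const]

/-- The graph `G` restricted to the pairs satisfying `P` in both orders. -/
def filterAdj (P : V → V → Prop) (G : SimpleGraph V) : SimpleGraph V where
  Adj a b := G.Adj a b ∧ P a b ∧ P b a
  symm := ⟨fun _ _ h => ⟨h.1.symm, h.2.2, h.2.1⟩⟩
  loopless := ⟨fun _ h => h.1.ne rfl⟩

theorem Dep.filterAdj {β : Type*} {R : V → V → Prop} {f : SimpleGraph V → β} (hf : Dep R f)
    (P : V → V → Prop) :
    Dep (fun a b => R a b ∧ P a b ∧ P b a) (fun G => f (filterAdj P G)) := by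
  intro G H h
  refine hf _ _ fun a b hab => ?_
  by_cases hP : P a b ∧ P b a
  · exact and_congr_left fun _ => h a b ⟨hab, hP⟩
  · exact iff_of_false (fun h' => hP h'.2) (fun h' => hP h'.2)

theorem Dep.filterAdj_eq {β : Type*} {R : V → V → Prop} {f : SimpleGraph V → β} (hf : Dep R f)
    {P : V → V → Prop} {G : SimpleGraph V} (h : ∀ a b, R a b → G.Adj a b → P a b ∧ P b a) :
    f (SparseDiam.filterAdj P G) = f G :=
  hf _ _ fun a b hab => ⟨fun h' => h'.1, fun h' => ⟨h', h a b hab h'⟩⟩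

/-- Events depending on the edges that touch disjoint sets are almost independent, if no edges
join these sets. -/
theorem gnpP_and_mul_le {p : ℝ} (hp : 0 ≤ p) (hp1 : p ≤ 1) {X Y : Finset V} (hXY : Disjoint X Y)
    {A B : SimpleGraph V → Prop} (hA : Dep (fun a _ => a ∈ X) A) (hB : Dep (fun a _ => a ∈ Y) B) :
    gnpP p (fun G => A G ∧ B G ∧ ∀ a ∈ X, ∀ b ∈ Y, ¬ G.Adj a b) * (1 - p) ^ (#X * #Y) ≤
      gnpP p A * gnpP p B := by
  set P : V → V → Prop := fun a b => ¬ (a ∈ X ∧ b ∈ Y) with hP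
  set N : SimpleGraph V → Prop := fun G => ∀ a ∈ X, ∀ b ∈ Y, ¬ G.Adj a b with hN
  have hNdep : Dep (fun a b => a ∈ X ∧ b ∈ Y) N := by
    intro G H h
    refine propext (forall₂_congr fun a ha => forall₂_congr fun b hb => ?_)
    rw [h a b ⟨ha, hb⟩]
  have hPN : gnpP p N = (1 - p) ^ (#X * #Y) := gnpP_no_edges p X Y hXY
  have hNP : ∀ G, N G → ∀ a b, G.Adj a b → P a b ∧ P b a := fun G hG a b hab =>
    ⟨fun h => hG a h.1 b h.2 hab, fun h => hG b h.1 a h.2 hab.symm⟩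
  have hA' := hA.filterAdj P
  have hB' := hB.filterAdj P
  have eA : ∀ G, N G → A (filterAdj P G) = A G := fun G hG =>
    hA.filterAdj_eq fun a b _ hab => hNP G hG a b hab
  have eB : ∀ G, N G → B (filterAdj P G) = B G := fun G hG =>
    hB.filterAdj_eq fun a b _ hab => hNP G hG a b hab
  -- The two events overlap only in the pairs between `X` and `Y`. Their filtered versions ignore
  -- these pairs, so they are independent of each other and of `N`, and they agree with the original
  -- events on `N`. Multiplying by the probability of `N` once more recovers `A` and `B` on the
  -- right.
  have i1 : gnpP p (fun G => A (filterAdj P G) ∧ B (filterAdj P G)) =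
      gnpP p (fun G => A (filterAdj P G)) * gnpP p (fun G => B (filterAdj P G)) := by
    refine gnpP_and_of_dep p hA' hB' fun a b h => ?_
    have h1 := disjoint_left.1 hXY h.1
    exact ⟨fun h' => h1 h'.1, fun h' => h.2.1 ⟨h.1, h'.1⟩⟩
  have i2 : gnpP p (fun G => A (filterAdj P G) ∧ N G) =
      gnpP p (fun G => A (filterAdj P G)) * gnpP p N :=
    gnpP_and_of_dep p hA' hNdep fun a b h => ⟨fun h' => h.2.1 h', fun h' => h.2.2 h'⟩
  have i3 : gnpP p (fun G => B (filterAdj P G) ∧ N G) =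
      gnpP p (fun G => B (filterAdj P G)) * gnpP p N :=
    gnpP_and_of_dep p hB' hNdep fun a b h => ⟨fun h' => h.2.1 h', fun h' => h.2.2 h'⟩
  have i4 : gnpP p (fun G => (A (filterAdj P G) ∧ B (filterAdj P G)) ∧ N G) =
      gnpP p (fun G => A (filterAdj P G) ∧ B (filterAdj P G)) * gnpP p N := by
    refine gnpP_and_of_dep p (R := fun a b => P a b ∧ P b a) ?_ hNdep
      fun a b h => ⟨fun h' => h.1 h', fun h' => h.2 h'⟩
    exact (hA'.mono (R' := fun a b => P a b ∧ P b a) fun a b h => Or.inl h.2).comp₂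
      (hB'.mono fun a b h => Or.inl h.2) And
  have h1 : gnpP p (fun G => A G ∧ B G ∧ N G) ≤
      gnpP p (fun G => (A (filterAdj P G) ∧ B (filterAdj P G)) ∧ N G) := by
    refine gnpP_mono hp hp1 fun G h => ?_
    exact ⟨⟨(eA G h.2.2).mpr h.1, (eB G h.2.2).mpr h.2.1⟩, h.2.2⟩
  have h2 : gnpP p (fun G => A (filterAdj P G) ∧ N G) ≤ gnpP p A :=
    gnpP_mono hp hp1 fun G h => (eA G h.2).mp h.1
  have h3 : gnpP p (fun G => B (filterAdj P G) ∧ N G) ≤ gnpP p B :=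
    gnpP_mono hp hp1 fun G h => (eB G h.2).mp h.1
  rw [i4, i1] at h1
  rw [i2] at h2
  rw [i3] at h3
  have hN0 := gnpP_nonneg hp hp1 N
  rw [← hPN]
  calc gnpP p (fun G => A G ∧ B G ∧ N G) * gnpP p N
      ≤ gnpP p (fun G => A (filterAdj P G)) * gnpP p (fun G => B (filterAdj P G)) * gnpP p N *
        gnpP p N := mul_le_mul_of_nonneg_right h1 hN0
    _ = (gnpP p (fun G => A (filterAdj P G)) * gnpP p N) *
        (gnpP p (fun G => B (filterAdj P G)) * gnpP p N) := by ring
    _ ≤ _ := mul_le_mul h2 h3 (mul_nonneg (gnpP_nonneg hp hp1 _) hN0) (gnpP_nonneg hp hp1 _)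

/-- There is a path of length `m` from `x` to `y` whose vertices other than `x` lie in `W`. -/
def PathIn (G : SimpleGraph V) (y : V) : ℕ → V → Finset V → Prop
  | 0, x, _ => x = y
  | m + 1, x, W => ∃ z ∈ W, G.Adj x z ∧ PathIn G y m z (W.erase z)

theorem dep_pathIn (y : V) (m : ℕ) (x : V) (W : Finset V) :
    Dep (Within (insert x W)) (fun G => PathIn G y m x W) := by
  induction m generalizing x W with
  | zero => exact Dep.const _ _
  | succ m ih =>
    intro G H h
    refine propext (exists_congr fun z => and_congr_right fun hz => and_congr ?_ ?_)
    · exact h x z ⟨mem_insert_self _ _, mem_insert_of_mem hz⟩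
    · refine Eq.to_iff (ih z (W.erase z) G H fun a b hab => h a b ?_)
      rw [Within, insert_erase hz] at hab
      exact ⟨mem_insert_of_mem hab.1, mem_insert_of_mem hab.2⟩

/-- Expected number of paths: `m` free interior vertices and `m + 1` edges. Erasing visited vertices
keeps the edges distinct and hence independent. -/
theorem gnpP_pathIn_le {p : ℝ} (hp : 0 ≤ p) (hp1 : p ≤ 1) (y : V) (m : ℕ) (x : V) (W : Finset V)
    (hx : x ∉ W) :
    gnpP p (fun G => PathIn G y (m + 1) x W) ≤ p * (p * Fintype.card V) ^ m := by
  have step : ∀ (m : ℕ) (x : V) (W : Finset V), x ∉ W →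
      gnpP p (fun G => PathIn G y (m + 1) x W) ≤
        ∑ z ∈ W, p * gnpP p (fun G => PathIn G y m z (W.erase z)) := by
    intro m x W hx
    refine (gnpP_exists_le hp hp1 W fun z G => G.Adj x z ∧ PathIn G y m z (W.erase z)).trans
      (sum_le_sum fun z hz => le_of_eq ?_)
    have hxz : x ≠ z := fun h => hx (h ▸ hz)
    rw [gnpP_and_of_dep p (R := fun a b => a = x ∧ b = z) ?_ (dep_pathIn y m z (W.erase z)),
      gnpP_adj p hxz]
    · rintro a b ⟨rfl, rfl⟩
      rw [Within, Within, insert_erase hz]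
      exact ⟨fun h => hx h.1, fun h => hx h.2⟩
    · intro G H h
      exact propext (h x z ⟨rfl, rfl⟩)
  induction m generalizing x W with
  | zero =>
    refine (step 0 x W hx).trans ?_
    have h1 : ∀ z ∈ W, p * gnpP p (fun G => PathIn G y 0 z (W.erase z)) =
        if z = y then p else 0 := by
      intro z _
      by_cases h : z = y <;> simp [gnpP, PathIn, ind, h, gnpE_const]
    rw [sum_congr rfl h1, sum_ite_eq']
    split_ifs <;> simp [hp]
  | succ m ih =>
    refine (step (m + 1) x W hx).trans ?_
    calc ∑ z ∈ W, p * gnpP p (fun G => PathIn G y (m + 1) z (W.erase z))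
        ≤ ∑ z ∈ W, p * (p * (p * Fintype.card V) ^ m) :=
          sum_le_sum fun z _ => mul_le_mul_of_nonneg_left (ih z _ (notMem_erase z W)) hp
      _ = #W * (p * (p * (p * Fintype.card V) ^ m)) := by rw [sum_const, nsmul_eq_mul]
      _ ≤ Fintype.card V * (p * (p * (p * Fintype.card V) ^ m)) := by
          have : (#W : ℝ) ≤ Fintype.card V := by exact_mod_cast card_le_univ W
          exact mul_le_mul_of_nonneg_right this (by positivity)
      _ = _ := by ring

theorem pathIn_of_isPath {G : SimpleGraph V} {x y : V} (q : G.Walk x y) (hq : q.IsPath)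
    (W : Finset V) (hW : ∀ z ∈ q.support, z ≠ x → z ∈ W) : PathIn G y q.length x W := by
  induction q generalizing W with
  | nil => rfl
  | @cons x z y hadj q ih =>
    rw [SimpleGraph.Walk.cons_isPath_iff] at hq
    have hmem : ∀ u ∈ q.support, u ∈ W := fun u hu =>
      hW u (by rw [SimpleGraph.Walk.support_cons]; exact List.mem_cons_of_mem _ hu)
        (fun h => hq.2 (h ▸ hu))
    refine ⟨z, hmem z q.start_mem_support, hadj, ih hq.1 _ fun u hu huz => ?_⟩
    exact mem_erase.2 ⟨huz, hmem u hu⟩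

theorem exists_pathIn_of_edist_le {G : SimpleGraph V} {x y : V} (hxy : x ≠ y) {l : ℕ}
    (h : G.edist x y ≤ l) : ∃ m ∈ range l, PathIn G y (m + 1) x (univ.erase x) := by
  obtain ⟨q, hq⟩ := SimpleGraph.exists_walk_of_edist_ne_top
    (ne_top_of_le_ne_top (ENat.natCast_ne_top l) h)
  rw [← hq] at h
  have hl : q.length ≤ l := by exact_mod_cast h
  have hb := q.length_bypass_le_length
  have hpath := pathIn_of_isPath q.bypass q.bypass_isPath (univ.erase x)
    fun z _ hz => mem_erase.2 ⟨hz, mem_univ z⟩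
  cases hm : q.bypass.length with
  | zero =>
    rw [hm] at hpath
    exact (hxy hpath).elim
  | succ m =>
    rw [hm] at hpath
    exact ⟨m, mem_range.2 (by omega), hpath⟩

theorem gnpP_edist_le {p : ℝ} (hp : 0 ≤ p) (hp1 : p ≤ 1) (hlam : 1 < p * Fintype.card V)
    {x y : V} (hxy : x ≠ y) (l : ℕ) :
    gnpP p (fun G => G.edist x y ≤ l) ≤
      p * (p * Fintype.card V) ^ l / (p * Fintype.card V - 1) := by
  have h0 : 0 < p * Fintype.card V - 1 := by linarith
  calc gnpP p (fun G => G.edist x y ≤ l)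
      ≤ gnpP p (fun G => ∃ m ∈ range l, PathIn G y (m + 1) x (univ.erase x)) :=
        gnpP_mono hp hp1 fun G h => exists_pathIn_of_edist_le hxy h
    _ ≤ ∑ m ∈ range l, gnpP p (fun G => PathIn G y (m + 1) x (univ.erase x)) :=
        gnpP_exists_le hp hp1 _ _
    _ ≤ ∑ m ∈ range l, p * (p * Fintype.card V) ^ m :=
        sum_le_sum fun m _ => gnpP_pathIn_le hp hp1 y m x _ (notMem_erase x univ)
    _ = p * (((p * Fintype.card V) ^ l - 1) / (p * Fintype.card V - 1)) := by
        rw [← mul_sum, geom_sum_eq hlam.ne']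
    _ ≤ _ := by
        rw [mul_div_assoc]
        gcongr
        linarith

/-- Weak graph homomorphisms do not increase distances. -/
theorem edist_map_le {G H : SimpleGraph V} (f : V → V)
    (hf : ∀ a b, G.Adj a b → f a = f b ∨ H.Adj (f a) (f b)) (x y : V) {l : ℕ}
    (h : G.edist x y ≤ l) : H.edist (f x) (f y) ≤ l := by
  obtain ⟨q, hq⟩ := SimpleGraph.exists_walk_of_edist_ne_top
    (ne_top_of_le_ne_top (ENat.natCast_ne_top l) h)
  refine le_trans ?_ (hq.trans_le h)
  clear hq h
  induction q with
  | nil => simp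
  | @cons a b c hadj q ih =>
    rw [SimpleGraph.Walk.length_cons]
    push_cast
    rcases hf a b hadj with h | h
    · rw [h]; exact ih.trans le_self_add
    · refine (H.edist_triangle (v := f b)).trans ?_
      rw [SimpleGraph.edist_eq_one_iff_adj.2 h, add_comm]
      gcongr

/-- `Pend` for the triple `q = ((v, w), T)` with `w ∉ T`. -/
def PendAt (k : ℕ) (G : SimpleGraph V) (q : (V × V) × Finset V) : Prop :=
  q.1.2 ∉ q.2 ∧ Pend k G q.1.1 q.1.2 q.2

/-- The root of the pendant subgraph `q` has at least `D` further neighbours. -/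
def Hub (D : ℕ) (G : SimpleGraph V) (q : (V × V) × Finset V) : Prop :=
  D ≤ #(nbr G {q.1.2} (insert q.1.2 q.2)ᶜ)

/-- The exploration from the further neighbours of the root of the pendant subgraph survives. -/
def Survives (cap t : ℕ) (G : SimpleGraph V) (q : (V × V) × Finset V) : Prop :=
  (grow cap t G (nbr G {q.1.2} (insert q.1.2 q.2)ᶜ)
    ((insert q.1.2 q.2)ᶜ \ nbr G {q.1.2} (insert q.1.2 q.2)ᶜ)).1 ≠ ∅

theorem dep_pendAt (k : ℕ) (q : (V × V) × Finset V) :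
    Dep (fun a _ => a ∈ q.2) (fun G => PendAt k G q) := by
  obtain ⟨⟨v, w⟩, T⟩ := q
  intro G H h
  simp only [PendAt, Pend] at h ⊢
  refine propext (and_congr_right fun _ => ?_)
  by_cases hv : v ∈ T
  · have h1 := dep_dies k {v} (T.erase v) T G H fun a b hab => by
      have hT : ({v} : Finset V) ∪ T.erase v = T := by
        rw [← insert_eq, insert_erase hv]
      rw [Within, hT] at hab
      exact h a b hab.1
    simp only at h1
    rw [h1]
    refine and_congr_right fun _ => forall₂_congr fun a ha => forall_congr' fun b => ?_
    rw [h a b ha]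
  · refine iff_of_false (fun h' => hv ?_) (fun h' => hv ?_)
    · exact h'.1.subset (mem_singleton_self v)
    · exact h'.1.subset (mem_singleton_self v)

/-- The definition of `Pend` looks only at pairs touching `T`, which suits independence for disjoint
sets. The right-hand side fits the exploration recursion: a search from `v` that avoids `w`, and
separately the pairs from `w` to `T`, which it has not examined. -/
theorem pendAt_iff (k : ℕ) (G : SimpleGraph V) {v w : V} (hvw : v ≠ w) (T : Finset V) :
    PendAt k G ((v, w), T) ↔ Dies k G {v} {v, w}ᶜ T ∧ nbr G {w} T = {v} := by
  have hdisj : Disjoint ({v} : Finset V) {v, w}ᶜ := by simp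
  have hU : ∀ T : Finset V, w ∉ T → ({v, w} : Finset V)ᶜ ∩ T = T.erase v := by
    intro T hw
    ext u
    simp only [mem_inter, mem_compl, mem_insert, mem_singleton, mem_erase]
    have : u ∈ T → u ≠ w := fun h h' => hw (h' ▸ h)
    tauto
  constructor
  · rintro ⟨hw, h⟩
    have hv := h.mem
    refine ⟨?_, ?_⟩
    · rw [dies_inter_iff hdisj (by simpa using hv), hU T hw]
      · exact h.1
      · intro a ha u hu huT hadj
        rw [(h.eq_of_adj ha huT hadj).2] at hu
        simp at hu
    · ext u
      rw [mem_nbr, mem_singleton]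
      constructor
      · rintro ⟨hu, a, ha, hadj⟩
        rw [mem_singleton.1 ha] at hadj
        exact (h.eq_of_adj hu hw hadj.symm).1
      · rintro rfl
        exact ⟨hv, w, mem_singleton_self w, (h.adj hw).symm⟩
  · rintro ⟨h, hn⟩
    have hT := h.subset_union
    have hw : w ∉ T := fun h' => by
      have := hT h'
      simp [hvw.symm] at this
    have hv : v ∈ T := h.subset (mem_singleton_self v)
    have hno := h.not_adj hdisj
    refine ⟨hw, ?_, fun a ha b hb => ⟨fun hab => ?_, ?_⟩⟩
    · rw [← hU T hw]
      exact (dies_inter_iff hdisj (by simpa using hv) hno).1 h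
    · have hbw : b = w := by
        by_contra hbw
        refine hno a ha b ?_ hb hab
        rw [mem_compl, mem_insert, mem_singleton, not_or]
        exact ⟨fun h' => hb (h' ▸ hv), hbw⟩
      subst hbw
      have : a ∈ nbr G {b} T := mem_nbr.2 ⟨ha, b, mem_singleton_self b, hab.symm⟩
      rw [hn, mem_singleton] at this
      exact ⟨this, rfl⟩
    · rintro ⟨rfl, rfl⟩
      have : a ∈ nbr G {b} T := by rw [hn]; exact mem_singleton_self a
      obtain ⟨-, c, hc, hadj⟩ := mem_nbr.1 this
      rw [mem_singleton.1 hc] at hadj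
      exact hadj.symm

theorem hitProb_one (p : ℝ) : hitProb p 1 = p := by simp [hitProb]

theorem gnpP_pendAt (p : ℝ) (k : ℕ) {v w : V} (hvw : v ≠ w) (T : Finset V) :
    gnpP p (fun G => PendAt k G ((v, w), T)) =
      gnpP p (fun G => Dies k G {v} {v, w}ᶜ T) * (p * (1 - p) ^ (#T - 1)) := by
  simp only [pendAt_iff k _ hvw]
  by_cases hw : w ∈ T
  · have h0 : ∀ G : SimpleGraph V, ¬ Dies k G {v} {v, w}ᶜ T := fun G h => by
      have := h.subset_union hw
      simp [hvw.symm] at this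
    rw [gnpP_of_forall_not p h0, zero_mul, gnpP_of_forall_not p fun G h => h0 G h.1]
  by_cases hv : v ∈ T
  · rw [gnpP_and_of_dep p (dep_dies k {v} {v, w}ᶜ T) ((dep_nbr {w} T).comp (· = {v}))]
    · rw [gnpP_nbr_eq p {w} T (by simpa using hw) (by simpa using hv), card_singleton,
        card_singleton, hitProb_one, pow_one]
    · rintro a b ⟨ha, hb⟩
      have hne : ∀ a, a ∈ ({v} : Finset V) ∪ {v, w}ᶜ → a ∉ ({w} : Finset V) := by
        intro a ha
        simp only [mem_union, mem_singleton, mem_compl, mem_insert, not_or] at ha ⊢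
        rcases ha with rfl | ha
        · exact hvw
        · exact ha.2
      exact ⟨fun h => hne a ha h.1, fun h => hne b hb h.1⟩
  · have h0 : ∀ G : SimpleGraph V, ¬ Dies k G {v} {v, w}ᶜ T := fun G h =>
      hv (h.subset (mem_singleton_self v))
    rw [gnpP_of_forall_not p h0, zero_mul, gnpP_of_forall_not p fun G h => h0 G h.1]

theorem gnpP_diesSmall_eq_sum (p : ℝ) (k S : ℕ) (A U : Finset V) :
    gnpP p (fun G => DiesSmall k S G A U) =
      ∑ T ∈ univ.filter (fun T : Finset V => #T ≤ S), gnpP p (fun G => Dies k G A U T) := by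
  simp only [gnpP]
  rw [← gnpE_sum]
  congr 1
  ext G
  by_cases h : DiesSmall k S G A U
  · obtain ⟨T, hT, hS⟩ := h
    rw [ind_of ⟨T, hT, hS⟩, sum_eq_single_of_mem T (by simpa using hS), ind_of hT]
    intro T' _ hne
    exact ind_of_not fun h' => hne (h'.unique hT)
  · rw [ind_of_not h, sum_eq_zero]
    intro T hT
    exact ind_of_not fun h' => h ⟨T, h', (mem_filter.1 hT).2⟩

theorem sum_gnpP_pendAt_le {p : ℝ} (hp : 0 ≤ p) (hp1 : p ≤ 1) (k S : ℕ) {v w : V} (hvw : v ≠ w) :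
    ∑ T ∈ univ.filter (fun T : Finset V => #T ≤ S), gnpP p (fun G => PendAt k G ((v, w), T)) ≤
      p * gnpP p (fun G => DiesSmall k S G {v} {v, w}ᶜ) := by
  rw [gnpP_diesSmall_eq_sum, mul_sum]
  refine sum_le_sum fun T _ => ?_
  rw [gnpP_pendAt p k hvw, mul_comm]
  refine mul_le_mul_of_nonneg_right ?_ (gnpP_nonneg hp hp1 _)
  exact mul_le_of_le_one_right hp (pow_le_one₀ (by linarith) (by linarith))

theorem le_sum_gnpP_pendAt {p : ℝ} (hp : 0 ≤ p) (hp1 : p ≤ 1) (k S : ℕ) {v w : V} (hvw : v ≠ w) :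
    p * (1 - p) ^ S * gnpP p (fun G => DiesSmall k S G {v} {v, w}ᶜ) ≤
    ∑ T ∈ univ.filter (fun T : Finset V => #T ≤ S), gnpP p (fun G => PendAt k G ((v, w), T)) := by
  rw [gnpP_diesSmall_eq_sum, mul_sum]
  refine sum_le_sum fun T hT => ?_
  have hS := (mem_filter.1 hT).2
  rw [gnpP_pendAt p k hvw, mul_comm]
  refine mul_le_mul_of_nonneg_left ?_ (gnpP_nonneg hp hp1 _)
  exact mul_le_mul_of_nonneg_left
    (pow_le_pow_of_le_one (by linarith) (by linarith) (by omega)) hp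

theorem gnpP_pendAt_and (p : ℝ) (k : ℕ) (q : (V × V) × Finset V) {Y : SimpleGraph V → Prop}
    (hY : Dep (Within q.2ᶜ) Y) :
    gnpP p (fun G => PendAt k G q ∧ Y G) = gnpP p (fun G => PendAt k G q) * gnpP p Y := by
  refine gnpP_and_of_dep p (dep_pendAt k q) hY fun a b ha => ?_
  exact ⟨fun h => mem_compl.1 h.1 ha, fun h => mem_compl.1 h.2 ha⟩

theorem dep_hub (D : ℕ) (q : (V × V) × Finset V) :
    Dep (fun a b => a = q.1.2 ∧ b ∈ (insert q.1.2 q.2)ᶜ) (fun G => Hub D G q) :=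
  ((dep_nbr {q.1.2} (insert q.1.2 q.2)ᶜ).comp fun B => D ≤ #B).mono
    fun _ _ h => Or.inl ⟨mem_singleton.1 h.1, h.2⟩

theorem dep_hub_within (D : ℕ) {q : (V × V) × Finset V} (hq : q.1.2 ∉ q.2) :
    Dep (Within q.2ᶜ) (fun G => Hub D G q) := by
  refine (dep_hub D q).mono fun a b h => Or.inl ⟨?_, ?_⟩
  · rw [h.1]; exact mem_compl.2 hq
  · exact mem_compl.2 fun h' => mem_compl.1 h.2 (mem_insert_of_mem h')

theorem dep_survives (cap t : ℕ) {q : (V × V) × Finset V} (hq : q.1.2 ∉ q.2) :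
    Dep (Within q.2ᶜ) (fun G => Survives cap t G q) := by
  intro G H h
  have h1 := dep_nbr {q.1.2} (insert q.1.2 q.2)ᶜ G H fun a b hab => h a b ⟨?_, ?_⟩
  · have h2 := dep_grow cap t (nbr H {q.1.2} (insert q.1.2 q.2)ᶜ)
      ((insert q.1.2 q.2)ᶜ \ nbr H {q.1.2} (insert q.1.2 q.2)ᶜ) G H fun a b hab => h a b ?_
    · simp only at h1 h2
      simp only [Survives]
      rw [h1, h2]
    · rw [Within, union_sdiff_of_subset (nbr_subset _ _ _), mem_compl, mem_compl] at hab
      exact ⟨mem_compl.2 fun h' => hab.1 (mem_insert_of_mem h'),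
        mem_compl.2 fun h' => hab.2 (mem_insert_of_mem h')⟩
  · rw [mem_singleton.1 hab.1]; exact mem_compl.2 hq
  · exact mem_compl.2 fun h' => mem_compl.1 hab.2 (mem_insert_of_mem h')

theorem gnpP_pendAt_hub (p : ℝ) (k D : ℕ) (q : (V × V) × Finset V) :
    gnpP p (fun G => PendAt k G q ∧ Hub D G q) =
      gnpP p (fun G => PendAt k G q) * gnpP p (fun G => Hub D G q) := by
  by_cases hq : q.1.2 ∈ q.2
  · rw [gnpP_of_forall_not p (A := fun G => PendAt k G q) fun G h => h.1 hq, zero_mul,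
      gnpP_of_forall_not p fun G h => h.1.1 hq]
  · exact gnpP_pendAt_and p k q (dep_hub_within D hq)

/-- Condition on the further neighbours of the root. Given at least `D` of them, the search from
them dies with probability at most `ρ ^ D`. So a hub, which is a local condition, implies survival
up to a small relative error. -/
theorem le_gnpP_hub_survives {p ρ : ℝ} (hp : 0 ≤ p) (hp1 : p ≤ 1) (hρ : 0 ≤ ρ) (hρ1 : ρ ≤ 1)
    (D cap t : ℕ) (q : (V × V) × Finset V)
    (hdie : ∀ B ⊆ (insert q.1.2 q.2)ᶜ,
      gnpP p (fun G => (grow cap t G B ((insert q.1.2 q.2)ᶜ \ B)).1 = ∅) ≤ ρ ^ #B) :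
    (1 - ρ ^ D) * gnpP p (fun G => Hub D G q) ≤
      gnpP p (fun G => Hub D G q ∧ Survives cap t G q) := by
  set U := (insert q.1.2 q.2)ᶜ with hU
  have hdisj : Disjoint {q.1.2} U := by simp [hU]
  have hR : ∀ a b, a ∈ ({q.1.2} : Finset V) → b ∈ U → ¬ Within U a b ∧ ¬ Within U b a := by
    intro a b ha _
    have := disjoint_left.1 hdisj ha
    exact ⟨fun h => this h.1, fun h => this h.2⟩
  have e1 := gnpE_explore p {q.1.2} U hdisj (fun B _ => ind (D ≤ #B)) (Within U) hR
    fun B _ => Dep.const _ _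
  have e2 := gnpE_explore p {q.1.2} U hdisj
    (fun B G => ind (D ≤ #B ∧ (grow cap t G B (U \ B)).1 ≠ ∅)) (Within U) hR fun B hB => by
      have := (dep_grow cap t B (U \ B)).comp fun x => ind (D ≤ #B ∧ x.1 ≠ ∅)
      rwa [union_sdiff_of_subset hB] at this
  have e1' : gnpP p (fun G => Hub D G q) = _ := e1
  have e2' : gnpP p (fun G => Hub D G q ∧ Survives cap t G q) = _ := e2
  rw [e1', e2', mul_sum]
  refine sum_le_sum fun B hB => ?_
  rw [mul_left_comm]
  refine mul_le_mul_of_nonneg_left ?_ (mul_nonneg (pow_nonneg (hitProb_nonneg hp hp1 _) _)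
    (pow_nonneg (by linarith [hitProb_le_one hp1 #({q.1.2} : Finset V)]) _))
  rw [gnpE_const]
  by_cases hD : D ≤ #B
  · rw [ind_of hD, mul_one]
    have h1 := hdie B (mem_powerset.1 hB)
    have h2 := gnpP_not p fun G => (grow cap t G B (U \ B)).1 = ∅
    have h3 := pow_le_pow_of_le_one hρ hρ1 hD
    simp only [hD, true_and]
    change _ ≤ gnpP p fun G => ¬ (grow cap t G B (U \ B)).1 = ∅
    linarith
  · rw [ind_of_not hD, mul_zero]
    exact gnpE_nonneg hp hp1 fun _ => ind_nonneg _

theorem le_gnpP_pendAt_hub_survives {p ρ : ℝ} (hp : 0 ≤ p) (hp1 : p ≤ 1) (hρ : 0 ≤ ρ)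
    (hρ1 : ρ ≤ 1) (k D cap t : ℕ) (q : (V × V) × Finset V)
    (hdie : ∀ B ⊆ (insert q.1.2 q.2)ᶜ,
      gnpP p (fun G => (grow cap t G B ((insert q.1.2 q.2)ᶜ \ B)).1 = ∅) ≤ ρ ^ #B) :
    (1 - ρ ^ D) * gnpP p (fun G => PendAt k G q ∧ Hub D G q) ≤
      gnpP p (fun G => PendAt k G q ∧ Hub D G q ∧ Survives cap t G q) := by
  by_cases hq : q.1.2 ∈ q.2
  · rw [gnpP_of_forall_not p (A := fun G => PendAt k G q ∧ Hub D G q) fun G h => h.1.1 hq, mul_zero]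
    exact gnpP_nonneg hp hp1 _
  · rw [gnpP_pendAt_hub, gnpP_pendAt_and p k q (Y := fun G => Hub D G q ∧ Survives cap t G q)
      ((dep_hub_within D hq).comp₂ (dep_survives cap t hq) And), mul_left_comm]
    exact mul_le_mul_of_nonneg_left (le_gnpP_hub_survives hp hp1 hρ hρ1 D cap t q hdie)
      (gnpP_nonneg hp hp1 _)

/-- The pendant subgraphs `q` and `q'` are disjoint and not attached to each other. -/
def Apart (q q' : (V × V) × Finset V) : Prop :=
  Disjoint q.2 q'.2 ∧ q.1.2 ∉ q'.2 ∧ q'.1.2 ∉ q.2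

/-- Otherwise the root of `q` would lie in a closed set of at most `2 * S` vertices, where its
exploration would die before time `t`. -/
theorem apart_of_survives {k S cap t : ℕ} {G : SimpleGraph V} {q q' : (V × V) × Finset V}
    (hcap : 2 * S < cap) (ht : 2 * S ≤ t) (hS : #q.2 ≤ S) (hS' : #q'.2 ≤ S)
    (h : PendAt k G q) (h' : PendAt k G q') (hs : Survives cap t G q) (hne : q ≠ q') :
    Apart q q' := by
  obtain ⟨⟨v, w⟩, T⟩ := q
  obtain ⟨⟨v', w'⟩, T'⟩ := q'
  replace hS : #T ≤ S := hS
  replace hS' : #T' ≤ S := hS'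
  have hvw : (v, w) ≠ (v', w') := by
    intro heq
    obtain ⟨rfl, rfl⟩ := Prod.mk.inj heq
    have hT : T = T' := h.2.unique h'.2 h.1 h'.1
    exact hne (by rw [hT])
  refine h.2.disjoint h'.2 h.1 h'.1 hvw fun C hC hcl => ?_
  by_contra hle
  replace hle : #C ≤ #T + #T' := not_lt.1 hle
  refine hs (grow_empty_of_closed cap t disjoint_sdiff hcl (fun b hb => ?_) ?_ ?_)
  · obtain ⟨-, a, ha, hab⟩ := mem_nbr.1 hb
    rw [mem_singleton.1 ha] at hab
    exact hcl w hC b hab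
  · omega
  · exact (card_le_card inter_subset_left).trans (by omega)

/-- When the roots are not close, no edge joins `T ∪ {w}` to `T' ∪ {w'}`: edges leaving a pendant
set end at its root, and the roots are neither equal nor adjacent since `l ≥ 1`. Then
`gnpP_and_mul_le` applies. -/
theorem gnpP_far_mul_le {p : ℝ} (hp : 0 ≤ p) (hp1 : p ≤ 1) (k D l S : ℕ) (hl : 1 ≤ l)
    {q q' : (V × V) × Finset V} (hq : Apart q q') (hS : #q.2 ≤ S) (hS' : #q'.2 ≤ S) :
    gnpP p (fun G => (PendAt k G q ∧ Hub D G q) ∧ (PendAt k G q' ∧ Hub D G q') ∧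
      ¬ G.edist q.1.2 q'.1.2 ≤ l) * (1 - p) ^ ((S + 1) ^ 2) ≤
      gnpP p (fun G => PendAt k G q ∧ Hub D G q) * gnpP p (fun G => PendAt k G q' ∧ Hub D G q') := by
  have hp' : 0 ≤ 1 - p := by linarith
  by_cases hww : q.1.2 = q'.1.2
  · rw [gnpP_of_forall_not, zero_mul]
    · exact mul_nonneg (gnpP_nonneg hp hp1 _) (gnpP_nonneg hp hp1 _)
    · intro G h
      apply h.2.2
      rw [hww, SimpleGraph.edist_self]
      exact zero_le
  have hdep : ∀ q : (V × V) × Finset V, Dep (fun a _ => a ∈ insert q.1.2 q.2)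
      (fun G => PendAt k G q ∧ Hub D G q) := fun q =>
    ((dep_pendAt k q).mono fun a b h => Or.inl (mem_insert_of_mem h)).comp₂
      ((dep_hub D q).mono fun a b h => Or.inl (h.1 ▸ mem_insert_self _ _)) And
  have hdisj : Disjoint (insert q.1.2 q.2) (insert q'.1.2 q'.2) := by
    rw [disjoint_insert_left, disjoint_insert_right, mem_insert, not_or]
    exact ⟨⟨hww, hq.2.1⟩, hq.2.2, hq.1⟩
  refine le_trans ?_ (gnpP_and_mul_le hp hp1 hdisj (hdep q) (hdep q'))
  have hc : #(insert q.1.2 q.2) * #(insert q'.1.2 q'.2) ≤ (S + 1) ^ 2 := by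
    rw [sq]
    exact Nat.mul_le_mul ((card_insert_le _ _).trans (by omega))
      ((card_insert_le _ _).trans (by omega))
  refine mul_le_mul (gnpP_mono hp hp1 fun G h => ⟨h.1, h.2.1, ?_⟩)
    (pow_le_pow_of_le_one hp' (by linarith) hc) (pow_nonneg hp' _) (gnpP_nonneg hp hp1 _)
  obtain ⟨⟨h1, -⟩, ⟨h2, -⟩, h3⟩ := h
  intro a ha b hb hab
  rw [mem_insert] at ha hb
  rcases ha with rfl | ha
  · rcases hb with rfl | hb
    · apply h3
      rw [SimpleGraph.edist_eq_one_iff_adj.2 hab]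
      exact_mod_cast hl
    · exact hww (h2.2.eq_of_adj hb hq.2.1 hab.symm).2
  · rcases hb with rfl | hb
    · exact hww (h1.2.eq_of_adj ha hq.2.2 hab).2.symm
    · have := (h1.2.eq_of_adj ha (disjoint_right.1 hq.1 hb) hab).2
      exact hq.2.1 (this ▸ hb)

/-- A shortest path between the roots gains nothing from entering a pendant set. The distance event
is therefore implied by the same event in the graph without the pairs touching the two sets, which
is independent of both pendant events. -/
theorem gnpP_close_mul_le {p : ℝ} (hp : 0 ≤ p) (hp1 : p ≤ 1) (k l S : ℕ)
    {q q' : (V × V) × Finset V} (hq : Apart q q') (hS : #q.2 ≤ S) (hS' : #q'.2 ≤ S) :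
    gnpP p (fun G => PendAt k G q ∧ PendAt k G q' ∧ G.edist q.1.2 q'.1.2 ≤ l) *
      (1 - p) ^ (S ^ 2) ≤
      gnpP p (fun G => PendAt k G q) * gnpP p (fun G => PendAt k G q') *
        gnpP p (fun G => G.edist q.1.2 q'.1.2 ≤ l) := by
  have hp' : 0 ≤ 1 - p := by linarith
  set P : V → V → Prop := fun a _ => a ∉ q.2 ∧ a ∉ q'.2 with hP
  have hdep : Dep (fun a b => P a b ∧ P b a)
      (fun G => (filterAdj P G).edist q.1.2 q'.1.2 ≤ l) := by
    have h : Dep (fun _ _ => True) (fun G : SimpleGraph V => G.edist q.1.2 q'.1.2 ≤ l) := by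
      intro G H h
      have : G = H := by ext a b; exact h a b trivial
      rw [this]
    exact (h.filterAdj P).mono fun a b h => Or.inl h.2
  have hboth : Dep (fun a b => ¬ P a b) (fun G => PendAt k G q ∧ PendAt k G q') :=
    ((dep_pendAt k q).mono fun a b h => Or.inl fun h' => h'.1 h).comp₂
      ((dep_pendAt k q').mono fun a b h => Or.inl fun h' => h'.2 h) And
  have h1 : gnpP p (fun G => PendAt k G q ∧ PendAt k G q' ∧ G.edist q.1.2 q'.1.2 ≤ l) ≤
      gnpP p (fun G => PendAt k G q ∧ PendAt k G q') *
        gnpP p (fun G => G.edist q.1.2 q'.1.2 ≤ l) := by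
    calc _ ≤ gnpP p (fun G => (PendAt k G q ∧ PendAt k G q') ∧
          (filterAdj P G).edist q.1.2 q'.1.2 ≤ l) := by
          refine gnpP_mono hp hp1 fun G h => ⟨⟨h.1, h.2.1⟩, ?_⟩
          -- Collapse each pendant set onto its root; edges are then either contracted or kept
          -- outside both sets.
          set f : V → V := fun u => if u ∈ q.2 then q.1.2 else if u ∈ q'.2 then q'.1.2 else u
            with hf
          have key : ∀ a b, G.Adj a b → a ∈ q.2 ∨ a ∈ q'.2 → f a = f b := by
            intro a b hab ha
            rcases ha with ha | ha
            · by_cases hb : b ∈ q.2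
              · simp only [hf, if_pos ha, if_pos hb]
              · have := (h.1.2.eq_of_adj ha hb hab).2
                simp only [hf, if_pos ha, this, if_neg h.1.1, if_neg hq.2.1]
            · have ha' := disjoint_right.1 hq.1 ha
              by_cases hb : b ∈ q'.2
              · have hb' := disjoint_right.1 hq.1 hb
                simp only [hf, if_pos ha, if_pos hb, if_neg ha', if_neg hb']
              · have := (h.2.1.2.eq_of_adj ha hb hab).2
                simp only [hf, if_pos ha, this, if_neg h.2.1.1, if_neg hq.2.2, if_neg ha']
          have h2 := edist_map_le (H := filterAdj P G) f (fun a b hab => ?_) _ _ h.2.2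
          · simpa only [hf, if_neg h.1.1, if_neg h.2.1.1, if_neg hq.2.1, if_neg hq.2.2] using h2
          · by_cases ha : a ∈ q.2 ∨ a ∈ q'.2
            · exact Or.inl (key a b hab ha)
            · by_cases hb : b ∈ q.2 ∨ b ∈ q'.2
              · exact Or.inl (key b a hab.symm hb).symm
              · rw [not_or] at ha hb
                right
                simp only [hf, if_neg ha.1, if_neg ha.2, if_neg hb.1, if_neg hb.2]
                exact ⟨hab, ha, hb⟩
      _ = gnpP p (fun G => PendAt k G q ∧ PendAt k G q') *
          gnpP p (fun G => (filterAdj P G).edist q.1.2 q'.1.2 ≤ l) :=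
          gnpP_and_of_dep p hboth hdep fun a b h => ⟨fun h' => h h'.1, fun h' => h h'.2⟩
      _ ≤ _ := by
          refine mul_le_mul_of_nonneg_left (gnpP_mono hp hp1 fun G h => ?_) (gnpP_nonneg hp hp1 _)
          exact (SimpleGraph.edist_anti (show filterAdj P G ≤ G from fun _ _ h' => h'.1)).trans h
  have h2 : gnpP p (fun G => PendAt k G q ∧ PendAt k G q') * (1 - p) ^ (S ^ 2) ≤
      gnpP p (fun G => PendAt k G q) * gnpP p (fun G => PendAt k G q') := by
    refine le_trans ?_ (gnpP_and_mul_le hp hp1 hq.1 (dep_pendAt k q) (dep_pendAt k q'))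
    refine mul_le_mul (gnpP_mono hp hp1 fun G h => ⟨h.1, h.2, fun a ha b hb hab => ?_⟩)
      (pow_le_pow_of_le_one hp' (by linarith) (by rw [sq]; exact Nat.mul_le_mul hS hS'))
      (pow_nonneg hp' _) (gnpP_nonneg hp hp1 _)
    have := (h.1.2.eq_of_adj ha (disjoint_right.1 hq.1 hb) hab).2
    exact hq.2.1 (this ▸ hb)
  calc _ ≤ gnpP p (fun G => PendAt k G q ∧ PendAt k G q') *
        gnpP p (fun G => G.edist q.1.2 q'.1.2 ≤ l) * (1 - p) ^ (S ^ 2) :=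
        mul_le_mul_of_nonneg_right h1 (pow_nonneg hp' _)
    _ = gnpP p (fun G => PendAt k G q ∧ PendAt k G q') * (1 - p) ^ (S ^ 2) *
        gnpP p (fun G => G.edist q.1.2 q'.1.2 ≤ l) := by ring
    _ ≤ _ := mul_le_mul_of_nonneg_right h2 (gnpP_nonneg hp hp1 _)

end PendantProbability

/-! ### The second moment argument -/

section SecondMoment

/-- The possible positions of pendant subgraphs with at most `S` vertices. -/
noncomputable def places (V : Type*) [Fintype V] [DecidableEq V] (S : ℕ) :
    Finset ((V × V) × Finset V) :=
  (univ : Finset V).offDiag ×ˢ univ.filter fun T : Finset V => #T ≤ S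

theorem card_le_of_mem_places {S : ℕ} {q : (V × V) × Finset V} (hq : q ∈ places V S) :
    #q.2 ≤ S := by
  simpa using (mem_product.1 hq).2

/-- If a random variable is concentrated around a mean larger than one, it rarely counts at most
one event. -/
theorem gnpP_subsingleton_le {ι : Type*} [DecidableEq ι] {p : ℝ} (hp : 0 ≤ p) (hp1 : p ≤ 1)
    (J : Finset ι) (E : ι → SimpleGraph V → Prop) {μ : ℝ} (hμ : 1 < μ) :
    gnpP p (fun G => ¬ ∃ q ∈ J, ∃ q' ∈ J, q ≠ q' ∧ E q G ∧ E q' G) ≤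
      (gnpE p (fun G => (∑ q ∈ J, ind (E q G)) ^ 2) - 2 * μ * ∑ q ∈ J, gnpP p (E q) + μ ^ 2) /
        (μ - 1) ^ 2 := by
  have h0 : 0 < (μ - 1) ^ 2 := by have : 0 < μ - 1 := by linarith
                                  positivity
  rw [le_div_iff₀ h0]
  have h1 : gnpE p (fun G => (∑ q ∈ J, ind (E q G) - μ) ^ 2) =
      gnpE p (fun G => (∑ q ∈ J, ind (E q G)) ^ 2) - 2 * μ * ∑ q ∈ J, gnpP p (E q) + μ ^ 2 := by
    have : (fun G : SimpleGraph V => (∑ q ∈ J, ind (E q G) - μ) ^ 2) = fun G =>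
        ((∑ q ∈ J, ind (E q G)) ^ 2 - 2 * μ * ∑ q ∈ J, ind (E q G)) + μ ^ 2 := by
      ext G; ring
    rw [this, gnpE_add, gnpE_sub, gnpE_const_mul, gnpE_sum, gnpE_const]
    rfl
  rw [← h1, mul_comm, gnpP, ← gnpE_const_mul]
  refine gnpE_mono hp hp1 fun G => ?_
  by_cases h : ∃ q ∈ J, ∃ q' ∈ J, q ≠ q' ∧ E q G ∧ E q' G
  · rw [ind_of_not (not_not.2 h), mul_zero]
    positivity
  · rw [ind_of h, mul_one]
    -- A count of at most one is at distance at least `μ - 1` from `μ`. The centre `μ` need not be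
    -- the exact mean.
    have h2 : ∑ q ∈ J, ind (E q G) ≤ 1 := by
      by_cases h3 : ∃ q ∈ J, E q G
      · obtain ⟨q, hq, hE⟩ := h3
        rw [sum_eq_single_of_mem q hq fun q' hq' hne => ind_of_not fun hE' =>
          h ⟨q', hq', q, hq, hne, hE', hE⟩]
        exact ind_le_one _
      · rw [sum_eq_zero fun q hq => ind_of_not fun hE => h3 ⟨q, hq, hE⟩]
        exact zero_le_one
    nlinarith

theorem sq_sum_ind_le {ι : Type*} [DecidableEq ι] (J : Finset ι) (E : ι → Prop)
    (B : ι → ι → ℝ) (hB : ∀ q q', 0 ≤ B q q')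
    (h : ∀ q ∈ J, ∀ q' ∈ J, q ≠ q' → E q → E q' → 1 ≤ B q q') :
    (∑ q ∈ J, ind (E q)) ^ 2 ≤ ∑ q ∈ J, ind (E q) + ∑ q ∈ J, ∑ q' ∈ J, B q q' := by
  rw [sq, sum_mul_sum, ← sum_add_distrib]
  refine sum_le_sum fun q hq => ?_
  have h1 : ind (E q) = ∑ q' ∈ J, if q = q' then ind (E q) else 0 := by
    rw [sum_ite_eq, if_pos hq]
  rw [h1, ← sum_add_distrib]
  refine sum_le_sum fun q' hq' => ?_
  rw [← h1]
  by_cases hqq : q = q'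
  · rw [if_pos hqq, ← hqq]
    have h2 := ind_le_one (E q)
    have h3 := ind_nonneg (E q)
    have h4 := hB q q
    nlinarith
  · rw [if_neg hqq, zero_add, ← ind_and]
    by_cases hE : E q ∧ E q'
    · rw [ind_of hE]
      exact h q hq q' hq' hqq hE.1 hE.2
    · rw [ind_of_not hE]
      exact hB q q'

/-- There are `n ^ 3` pairs of attaching edges with a common root, where closeness is automatic, and
at most `n ^ 4` others, each with a factor `β`. -/
theorem sum_places_close_le {p : ℝ} (hp : 0 ≤ p) (hp1 : p ≤ 1) (k S l : ℕ) {b β : ℝ}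
    (hβ0 : 0 ≤ β)
    (hb : ∀ v w : V, v ≠ w → ∑ T ∈ univ.filter (fun T : Finset V => #T ≤ S),
      gnpP p (fun G => PendAt k G ((v, w), T)) ≤ b)
    (hβ : ∀ x y : V, x ≠ y → gnpP p (fun G => G.edist x y ≤ l) ≤ β) :
    ∑ q ∈ places V S, ∑ q' ∈ places V S, gnpP p (fun G => PendAt k G q) *
      gnpP p (fun G => PendAt k G q') * gnpP p (fun G => G.edist q.1.2 q'.1.2 ≤ l) ≤
      b ^ 2 * (Fintype.card V ^ 3 * (1 + Fintype.card V * β)) := by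
  set a : V × V → ℝ := fun o => ∑ T ∈ univ.filter (fun T : Finset V => #T ≤ S),
    gnpP p (fun G => PendAt k G (o, T)) with ha
  have ha0 : ∀ o, 0 ≤ a o := fun o => sum_nonneg fun T _ => gnpP_nonneg hp hp1 _
  have hab : ∀ o ∈ (univ : Finset V).offDiag, a o ≤ b := fun o ho =>
    hb o.1 o.2 (mem_offDiag.1 ho).2.2
  have hγ : ∀ x y : V, gnpP p (fun G => G.edist x y ≤ l) ≤ (if x = y then 1 else 0) + β := by
    intro x y
    split_ifs with h
    · have := gnpP_le_one hp hp1 fun G : SimpleGraph V => G.edist x y ≤ l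
      linarith
    · rw [zero_add]; exact hβ x y h
  have h1 : ∑ q ∈ places V S, ∑ q' ∈ places V S, gnpP p (fun G => PendAt k G q) *
      gnpP p (fun G => PendAt k G q') * gnpP p (fun G => G.edist q.1.2 q'.1.2 ≤ l) =
      ∑ o ∈ (univ : Finset V).offDiag, ∑ o' ∈ (univ : Finset V).offDiag,
        a o * a o' * gnpP p (fun G => G.edist o.2 o'.2 ≤ l) := by
    rw [places, sum_product]
    refine sum_congr rfl fun o _ => ?_
    simp only [sum_product]
    rw [sum_comm]
    refine sum_congr rfl fun o' _ => ?_
    rw [ha]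
    simp only [sum_mul]
    refine sum_congr rfl fun x _ => ?_
    rw [mul_sum, sum_mul]
  rw [h1]
  calc ∑ o ∈ (univ : Finset V).offDiag, ∑ o' ∈ (univ : Finset V).offDiag,
        a o * a o' * gnpP p (fun G => G.edist o.2 o'.2 ≤ l)
      ≤ ∑ o ∈ (univ : Finset V).offDiag, ∑ o' ∈ (univ : Finset V).offDiag,
        b ^ 2 * ((if o.2 = o'.2 then 1 else 0) + β) := by
        refine sum_le_sum fun o ho => sum_le_sum fun o' ho' => ?_
        rw [sq]
        exact mul_le_mul (mul_le_mul (hab o ho) (hab o' ho') (ha0 o') ((ha0 o).trans (hab o ho)))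
          (hγ _ _) (gnpP_nonneg hp hp1 _)
          (mul_self_nonneg b)
    _ ≤ ∑ o : V × V, ∑ o' : V × V, b ^ 2 * ((if o.2 = o'.2 then 1 else 0) + β) := by
        have h0 : ∀ o o' : V × V, 0 ≤ b ^ 2 * ((if o.2 = o'.2 then (1 : ℝ) else 0) + β) := by
          intro o o'
          refine mul_nonneg (sq_nonneg b) (add_nonneg ?_ hβ0)
          split_ifs <;> norm_num
        refine (sum_le_sum fun o _ => sum_le_sum_of_subset_of_nonneg (subset_univ _)
          fun o' _ _ => h0 o o').trans ?_
        exact sum_le_sum_of_subset_of_nonneg (subset_univ _)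
          fun o _ _ => sum_nonneg fun o' _ => h0 o o'
    _ = _ := by
        simp only [← mul_sum, Fintype.sum_prod_type, Fintype.card_prod, Nat.cast_mul,
          sum_add_distrib, sum_ite_eq, mem_univ, if_true,
          sum_const, card_univ, nsmul_eq_mul]
        ring

/-- With high probability there are two distant pendant subgraphs whose roots lie in large
components. -/
theorem gnpP_not_exists_far_le {p : ℝ} (hp : 0 ≤ p) (hp1 : p ≤ 1) {k S D cap t l : ℕ}
    (hcap : 2 * S < cap) (ht : 2 * S ≤ t) (hl : 1 ≤ l) {η κ b β μ : ℝ} (hκ0 : 0 ≤ κ)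
    (hβ0 : 0 ≤ β)
    (hη : ∀ q ∈ places V S, (1 - η) * gnpP p (fun G => PendAt k G q ∧ Hub D G q) ≤
      gnpP p (fun G => PendAt k G q ∧ Hub D G q ∧ Survives cap t G q))
    (hκ : 1 ≤ (1 + κ) * (1 - p) ^ ((S + 1) ^ 2))
    (hb : ∀ v w : V, v ≠ w → ∑ T ∈ univ.filter (fun T : Finset V => #T ≤ S),
      gnpP p (fun G => PendAt k G ((v, w), T)) ≤ b)
    (hβ : ∀ x y : V, x ≠ y → gnpP p (fun G => G.edist x y ≤ l) ≤ β)
    (hμ : μ = ∑ q ∈ places V S, gnpP p (fun G => PendAt k G q ∧ Hub D G q)) (hμ1 : 1 < μ)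
    {Q : ℝ} (hQ : Q = (1 + κ) * (b ^ 2 * (Fintype.card V ^ 3 * (1 + Fintype.card V * β)))) :
    gnpP p (fun G => ¬ ∃ q q' : (V × V) × Finset V, (PendAt k G q ∧ Survives cap t G q) ∧
      (PendAt k G q' ∧ Survives cap t G q') ∧ Apart q q' ∧ ¬ G.edist q.1.2 q'.1.2 ≤ l) ≤
      (μ + (κ + 2 * η) * μ ^ 2 + Q) / (μ - 1) ^ 2 + Q := by
  have hp' : 0 ≤ 1 - p := by linarith
  set J := places V S with hJ
  set M : (V × V) × Finset V → SimpleGraph V → Prop := fun q G => PendAt k G q ∧ Hub D G q with hM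
  set E : (V × V) × Finset V → SimpleGraph V → Prop :=
    fun q G => PendAt k G q ∧ Hub D G q ∧ Survives cap t G q with hE
  -- Survival is not local and cannot be decorrelated for two places. For far pairs it is dropped
  -- and only the local hub condition is kept. The second moment is thus compared with the hub mean
  -- `μ`, while the first moment of the surviving places is at least `(1 - η) * μ`.
  set F : (V × V) × Finset V → (V × V) × Finset V → SimpleGraph V → Prop :=
    fun q q' G => Apart q q' ∧ M q G ∧ M q' G ∧ ¬ G.edist q.1.2 q'.1.2 ≤ l with hF
  set C : (V × V) × Finset V → (V × V) × Finset V → SimpleGraph V → Prop :=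
    fun q q' G => Apart q q' ∧ PendAt k G q ∧ PendAt k G q' ∧ G.edist q.1.2 q'.1.2 ≤ l with hC
  have hcard := fun q (hq : q ∈ J) => card_le_of_mem_places hq
  have hFle : ∀ q ∈ J, ∀ q' ∈ J, gnpP p (F q q') ≤ (1 + κ) * (gnpP p (M q) * gnpP p (M q')) := by
    intro q hq q' hq'
    by_cases hA : Apart q q'
    · have h1 := gnpP_far_mul_le hp hp1 k D l S hl hA (hcard q hq) (hcard q' hq')
      have h2 : F q q' = fun G => M q G ∧ M q' G ∧ ¬ G.edist q.1.2 q'.1.2 ≤ l := by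
        ext G; simp only [hF, hA, true_and]
      rw [h2]
      calc _ ≤ gnpP p (fun G => M q G ∧ M q' G ∧ ¬ G.edist q.1.2 q'.1.2 ≤ l) *
            ((1 + κ) * (1 - p) ^ ((S + 1) ^ 2)) := le_mul_of_one_le_right (gnpP_nonneg hp hp1 _) hκ
        _ = (1 + κ) * (gnpP p (fun G => M q G ∧ M q' G ∧ ¬ G.edist q.1.2 q'.1.2 ≤ l) *
            (1 - p) ^ ((S + 1) ^ 2)) := by ring
        _ ≤ _ := mul_le_mul_of_nonneg_left h1 (by linarith)
    · rw [gnpP_of_forall_not p fun G h => hA h.1]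
      exact mul_nonneg (by linarith) (mul_nonneg (gnpP_nonneg hp hp1 _) (gnpP_nonneg hp hp1 _))
  have hκ' : 1 ≤ (1 + κ) * (1 - p) ^ (S ^ 2) := by
    refine hκ.trans (mul_le_mul_of_nonneg_left ?_ (by linarith))
    exact pow_le_pow_of_le_one hp' (by linarith) (Nat.pow_le_pow_left (by omega) 2)
  have hCle : ∀ q ∈ J, ∀ q' ∈ J, gnpP p (C q q') ≤ (1 + κ) * (gnpP p (fun G => PendAt k G q) *
      gnpP p (fun G => PendAt k G q') * gnpP p (fun G => G.edist q.1.2 q'.1.2 ≤ l)) := by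
    intro q hq q' hq'
    by_cases hA : Apart q q'
    · have h1 := gnpP_close_mul_le hp hp1 k l S hA (hcard q hq) (hcard q' hq')
      have h2 : C q q' = fun G => PendAt k G q ∧ PendAt k G q' ∧ G.edist q.1.2 q'.1.2 ≤ l := by
        ext G; simp only [hC, hA, true_and]
      rw [h2]
      calc _ ≤ gnpP p (fun G => PendAt k G q ∧ PendAt k G q' ∧ G.edist q.1.2 q'.1.2 ≤ l) *
            ((1 + κ) * (1 - p) ^ (S ^ 2)) := le_mul_of_one_le_right (gnpP_nonneg hp hp1 _) hκ'
        _ = (1 + κ) * (gnpP p (fun G => PendAt k G q ∧ PendAt k G q' ∧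
            G.edist q.1.2 q'.1.2 ≤ l) * (1 - p) ^ (S ^ 2)) := by ring
        _ ≤ _ := mul_le_mul_of_nonneg_left h1 (by linarith)
    · rw [gnpP_of_forall_not p fun G h => hA h.1]
      exact mul_nonneg (by linarith) (mul_nonneg (mul_nonneg (gnpP_nonneg hp hp1 _)
        (gnpP_nonneg hp hp1 _)) (gnpP_nonneg hp hp1 _))
  have hFsum : ∑ q ∈ J, ∑ q' ∈ J, gnpP p (F q q') ≤ (1 + κ) * μ ^ 2 := by
    calc _ ≤ ∑ q ∈ J, ∑ q' ∈ J, (1 + κ) * (gnpP p (M q) * gnpP p (M q')) :=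
          sum_le_sum fun q hq => sum_le_sum fun q' hq' => hFle q hq q' hq'
      _ = _ := by simp only [← mul_sum, ← sum_mul]; rw [← hμ]; ring
  have hCsum : ∑ q ∈ J, ∑ q' ∈ J, gnpP p (C q q') ≤ Q := by
    calc _ ≤ ∑ q ∈ J, ∑ q' ∈ J, (1 + κ) * (gnpP p (fun G => PendAt k G q) *
          gnpP p (fun G => PendAt k G q') * gnpP p (fun G => G.edist q.1.2 q'.1.2 ≤ l)) :=
          sum_le_sum fun q hq => sum_le_sum fun q' hq' => hCle q hq q' hq'
      _ ≤ Q := by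
          simp only [← mul_sum]
          rw [hQ]
          refine mul_le_mul_of_nonneg_left ?_ (by linarith)
          exact sum_places_close_le hp hp1 k S l hβ0 hb hβ
  have hpair : ∀ G, ∀ q ∈ J, ∀ q' ∈ J, q ≠ q' → E q G → E q' G → F q q' G ∨ C q q' G := by
    intro G q hq q' hq' hne h h'
    have hA := apart_of_survives hcap ht (hcard q hq) (hcard q' hq') h.1 h'.1 h.2.2 hne
    by_cases hd : G.edist q.1.2 q'.1.2 ≤ l
    · exact Or.inr ⟨hA, h.1, h'.1, hd⟩
    · exact Or.inl ⟨hA, ⟨h.1, h.2.1⟩, ⟨h'.1, h'.2.1⟩, hd⟩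
  have hsq : gnpE p (fun G => (∑ q ∈ J, ind (E q G)) ^ 2) ≤
      μ + (1 + κ) * μ ^ 2 + Q := by
    calc _ ≤ gnpE p (fun G => ∑ q ∈ J, ind (E q G) +
          ∑ q ∈ J, ∑ q' ∈ J, (ind (F q q' G) + ind (C q q' G))) := by
          refine gnpE_mono hp hp1 fun G => ?_
          refine sq_sum_ind_le J (fun q => E q G) (fun q q' => ind (F q q' G) + ind (C q q' G))
            (fun q q' => add_nonneg (ind_nonneg _) (ind_nonneg _)) ?_
          intro q hq q' hq' hne h h'
          rcases hpair G q hq q' hq' hne h h' with h | h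
          · rw [ind_of h]; linarith [ind_nonneg (C q q' G)]
          · rw [ind_of h]; linarith [ind_nonneg (F q q' G)]
      _ = ∑ q ∈ J, gnpP p (E q) + (∑ q ∈ J, ∑ q' ∈ J, gnpP p (F q q') +
          ∑ q ∈ J, ∑ q' ∈ J, gnpP p (C q q')) := by
          rw [gnpE_add, gnpE_sum, gnpE_sum,
            ← sum_add_distrib (f := fun q => ∑ q' ∈ J, gnpP p (F q q'))]
          refine congrArg₂ _ rfl ?_
          refine sum_congr rfl fun q _ => ?_
          rw [gnpE_sum, ← sum_add_distrib]
          exact sum_congr rfl fun q' _ => gnpE_add p _ _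
      _ ≤ _ := by
          have : ∑ q ∈ J, gnpP p (E q) ≤ μ := by
            rw [hμ]
            exact sum_le_sum fun q _ => gnpP_mono hp hp1 fun G h => ⟨h.1, h.2.1⟩
          linarith
  have hmean : (1 - η) * μ ≤ ∑ q ∈ J, gnpP p (E q) := by
    rw [hμ, mul_sum]
    exact sum_le_sum hη
  have hmain := gnpP_subsingleton_le hp hp1 J E hμ1
  have hbound : gnpP p (fun G => ¬ ∃ q ∈ J, ∃ q' ∈ J, q ≠ q' ∧ E q G ∧ E q' G) ≤
      (μ + (κ + 2 * η) * μ ^ 2 + Q) / (μ - 1) ^ 2 := by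
    refine hmain.trans ?_
    refine div_le_div_of_nonneg_right ?_ (sq_nonneg _)
    have := mul_le_mul_of_nonneg_left hmean (by linarith : 0 ≤ 2 * μ)
    linarith
  have hclose : gnpP p (fun G => ∃ q ∈ J, ∃ q' ∈ J, C q q' G) ≤ Q := by
    refine le_trans ((gnpP_exists_le hp hp1 J fun q G => ∃ q' ∈ J, C q q' G).trans ?_) hCsum
    exact sum_le_sum fun q _ => gnpP_exists_le hp hp1 J fun q' G => C q q' G
  -- Two distinct good places exist up to the Chebyshev error; they are apart, and they are far from
  -- each other except on the event of total probability at most `Q` that some close pair occurs.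
  refine le_trans (le_trans (gnpP_mono hp hp1 fun G h => ?_) (gnpP_or_le hp hp1
    (fun G => ¬ ∃ q ∈ J, ∃ q' ∈ J, q ≠ q' ∧ E q G ∧ E q' G)
    (fun G => ∃ q ∈ J, ∃ q' ∈ J, C q q' G))) (add_le_add hbound hclose)
  by_contra hcon
  rw [not_or, not_not] at hcon
  obtain ⟨⟨q, hq, q', hq', hne, hEq, hEq'⟩, hcl⟩ := hcon
  rcases hpair G q hq q' hq' hne hEq hEq' with hf | hc
  · exact h ⟨q, q', ⟨hEq.1, hEq.2.2⟩, ⟨hEq'.1, hEq'.2.2⟩, hf.1, hf.2.2.2⟩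
  · exact hcl ⟨q, hq, q', hq', hc⟩

end SecondMoment

/-! ### Asymptotics of the first moment -/

section FirstMoment

theorem exp_le_two {x : ℝ} (hx : x ≤ 1 / 2) : Real.exp x ≤ 2 := by
  have h1 := Real.add_one_le_exp (-x)
  have h2 : Real.exp x * Real.exp (-x) = 1 := by rw [← Real.exp_add]; simp
  have h3 := Real.exp_pos x
  nlinarith

theorem exp_neg_mul_le_one_sub_pow {lam : ℝ} {n : ℕ} (hlam : 0 ≤ lam) (hn : 0 < n)
    (hn2 : 2 * lam ≤ n) :
    Real.exp (-lam) * (1 - 2 * lam ^ 2 / n) ≤ (1 - lam / n) ^ n := by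
  have hn0 : (0 : ℝ) < n := by exact_mod_cast hn
  set p := lam / n with hp
  have hp0 : 0 ≤ p := by positivity
  have hp2 : p ≤ 1 / 2 := by rw [hp, div_le_iff₀ hn0]; linarith
  have hpn : n * p = lam := by rw [hp]; field_simp
  have h1 : Real.exp (-(p + 2 * p ^ 2)) ≤ 1 - p := by
    rw [Real.exp_neg]
    have h2 := Real.add_one_le_exp (p + 2 * p ^ 2)
    rw [inv_le_comm₀ (Real.exp_pos _) (by linarith)]
    refine le_trans ?_ h2
    rw [inv_le_iff_one_le_mul₀ (by linarith)]
    nlinarith [mul_nonneg (sq_nonneg p) (by linarith : 0 ≤ 1 - 2 * p)]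
  calc Real.exp (-lam) * (1 - 2 * lam ^ 2 / n)
      ≤ Real.exp (-lam) * Real.exp (-(2 * lam ^ 2 / n)) :=
        mul_le_mul_of_nonneg_left (Real.one_sub_le_exp_neg _) (Real.exp_pos _).le
    _ = Real.exp (-(p + 2 * p ^ 2)) ^ n := by
        rw [← Real.exp_add, ← Real.exp_nat_mul]
        congr 1
        have : 2 * lam ^ 2 / n = n * (2 * p ^ 2) := by rw [hp]; field_simp
        rw [this]
        linarith
    _ ≤ _ := pow_le_pow_left₀ (Real.exp_pos _).le h1 n

variable {lam m : ℝ}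

/-- Since `S ^ 2` is small compared with `n`, all accumulated errors are within a factor two. The
extra hypothesis in the lower bound says that the truncation at progeny `S` removes at most half of
the main term. -/
theorem gnpP_diesSmall_bounds (hlam : 1 < lam) (hm : 0 < m) (hm1 : m < 1)
    (hdual : m * Real.exp (-m) = lam * Real.exp (-lam)) {n S k : ℕ}
    (hn : 64 * (lam + 1) ^ 2 * (S + 1) ^ 2 ≤ n) (hV : Fintype.card V = n) {v w : V} (hvw : v ≠ w) :
    gnpP (lam / n) (fun G => DiesSmall k S G {v} {v, w}ᶜ) ≤ 2 * (m / lam) * m ^ k ∧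
    ((m * Real.exp (1 - m)) ^ S * m⁻¹ ≤ (1 - m) ^ 2 / 2 * m ^ k →
      m / lam * ((1 - m) ^ 2 / 4 * m ^ k) ≤
        gnpP (lam / n) (fun G => DiesSmall k S G {v} {v, w}ᶜ)) := by
  have hlam0 : 0 < lam := by linarith
  have hS0 : (0 : ℝ) ≤ S := Nat.cast_nonneg S
  have hlow : 64 * (lam + 1) ^ 2 * (S + 1) ≤ (n : ℝ) := by
    refine le_trans ?_ hn
    have h1 : ((S : ℝ) + 1) ≤ (S + 1) ^ 2 := by nlinarith
    exact mul_le_mul_of_nonneg_left h1 (by positivity)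
  have hnS : ((S : ℝ) + 1) * 64 ≤ n ∧ 64 * lam ≤ n := by
    constructor <;> nlinarith [mul_nonneg hlam0.le hS0, sq_nonneg lam,
      mul_nonneg (sq_nonneg lam) hS0]
  have hn0 : (0 : ℝ) < n := by linarith
  have hn0' : 0 < n := by exact_mod_cast hn0
  have hp : 0 ≤ lam / n := by positivity
  have hp1 : lam / n ≤ 1 := (div_le_one hn0).2 (by linarith)
  have hSn : S + 1 ≤ n := by
    have : ((S + 1 : ℕ) : ℝ) ≤ n := by push_cast; linarith
    exact_mod_cast this
  have hdisj : Disjoint ({v} : Finset V) {v, w}ᶜ := by simp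
  have hc2 : #({v, w} : Finset V) = 2 := card_pair hvw
  have hcU : #({v, w}ᶜ : Finset V) = n - 2 := by rw [card_compl, hc2, hV]
  have hn2 : 2 ≤ n := by rw [← hV, ← hc2]; exact card_le_univ _
  have hcard : #({v} : Finset V) + #({v, w}ᶜ : Finset V) ≤ n := by
    rw [hcU, card_singleton]; omega
  have hinv : n + S ≤ (S + 1) + #({v} : Finset V) + #({v, w}ᶜ : Finset V) := by
    rw [hcU, card_singleton]; omega
  constructor
  · refine (gnpP_diesSmall_le hp hp1 hlam0 (by field_simp) hm hdual hSn k S {v} {v, w}ᶜ hdisj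
      hcard hinv).trans ?_
    have h1 := treeW_le hm.le k 1 S
    rw [Nat.cast_one, one_mul] at h1
    have h2 : Real.exp (lam / n * (S + 1 : ℕ)) ^ S ≤ 2 := by
      rw [← Real.exp_nat_mul]
      refine exp_le_two ?_
      push_cast
      rw [show (S : ℝ) * (lam / n * (S + 1)) = S * lam * (S + 1) / n by ring, div_le_iff₀ hn0]
      nlinarith [mul_nonneg hlam0.le hS0, mul_nonneg (sq_nonneg lam) (sq_nonneg ((S : ℝ) + 1)),
        mul_nonneg hlam0.le (sq_nonneg ((S : ℝ) + 1)), sq_nonneg ((S : ℝ) + 1)]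
    rw [card_singleton, pow_one]
    have h3 := treeW_nonneg hm.le k 1 S
    gcongr
  · intro hτ
    set ε := 2 * (lam + 1) ^ 2 * (S + 1) / n with hε
    have hε0 : 0 ≤ ε := by positivity
    have hεn : ε * n = 2 * (lam + 1) ^ 2 * (S + 1) := by rw [hε]; field_simp
    have hε1 : ε ≤ 1 / 2 := by
      rw [hε, div_le_iff₀ hn0]; linarith
    have hh1 : ∀ a M : ℕ, a ≤ S + 1 → n ≤ M + (S + 1) →
        lam * (1 - ε) * a ≤ M * hitProb (lam / n) a := by
      intro a M ha hM
      have ha' : (a : ℝ) ≤ S + 1 := by exact_mod_cast ha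
      have hmin : (n : ℝ) ≤ (min M n : ℕ) + (S + 1) := by
        have : n ≤ min M n + (S + 1) := by omega
        exact_mod_cast this
      have h := (hitProb_growth (a := a) (N := min M n) hlam0.le hn0' (by linarith) hε0 hε1
        (min_le_right _ _) (by
          rw [hεn]
          have := mul_le_mul_of_nonneg_left ha' hlam0.le
          nlinarith [mul_nonneg hlam0.le hS0, mul_nonneg (sq_nonneg lam) hS0, sq_nonneg lam])).1
      refine h.trans (mul_le_mul_of_nonneg_right ?_ (hitProb_nonneg hp hp1 a))
      have : ((min M n : ℕ) : ℝ) ≤ M := by exact_mod_cast min_le_left M n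
      linarith
    have hh2 : Real.exp (-lam) * (1 - ε) ≤ (1 - lam / n) ^ n := by
      refine le_trans ?_ (exp_neg_mul_le_one_sub_pow hlam0.le hn0' (by linarith))
      refine mul_le_mul_of_nonneg_left ?_ (Real.exp_pos _).le
      have : 2 * lam ^ 2 / n ≤ ε := by
        refine div_le_div_of_nonneg_right ?_ hn0.le
        nlinarith [mul_nonneg hlam0.le hS0, mul_nonneg (sq_nonneg lam) hS0]
      linarith
    refine le_trans ?_ (le_gnpP_diesSmall hp hp1 hlam0 hε0 (by linarith) hm hdual hh1 hh2 hSn k S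
      {v} {v, w}ᶜ hdisj hcard hinv)
    rw [card_singleton, pow_one]
    have h1 : 1 / 2 ≤ (1 - ε) ^ (2 * S - 1) := by
      calc (1 : ℝ) / 2 ≤ 1 + (2 * S : ℕ) * (-ε) := by
            push_cast
            have : ε * (4 * S) ≤ 1 := by
              rw [hε, div_mul_eq_mul_div, div_le_iff₀ hn0]
              have : (S + 1 : ℝ) * S ≤ (S + 1) ^ 2 := by nlinarith
              have := mul_le_mul_of_nonneg_left this (by positivity : 0 ≤ 8 * (lam + 1) ^ 2)
              have : 0 ≤ (lam + 1) ^ 2 * (S + 1) ^ 2 := by positivity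
              linarith
            linarith
        _ ≤ (1 + -ε) ^ (2 * S) := one_add_mul_le_pow (by linarith) _
        _ ≤ _ := by
            rw [← sub_eq_add_neg]
            exact pow_le_pow_of_le_one (by linarith) (by linarith) (by omega)
    have h2 : (1 - m) ^ 2 / 2 * m ^ k ≤ treeW m k 1 S := by
      have h3 := le_treeW hm hm1 k 1 S
      have h4 := le_one_sub_vit_sub hm hm1 k
      rw [pow_one (m⁻¹)] at h3
      linarith
    have h5 : 0 ≤ (1 - m) ^ 2 / 2 * m ^ k := by positivity
    calc m / lam * ((1 - m) ^ 2 / 4 * m ^ k) =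
          1 / 2 * (m / lam) * ((1 - m) ^ 2 / 2 * m ^ k) := by ring
      _ ≤ _ := by gcongr

theorem le_gnpP_card_nbr {p : ℝ} (hp : 0 ≤ p) (hp1 : p ≤ 1) (D : ℕ) {A U : Finset V}
    (hAU : Disjoint A U) :
    ((#U).choose D : ℝ) * (hitProb p #A ^ D * (1 - hitProb p #A) ^ (#U - D)) ≤
      gnpP p (fun G => D ≤ #(nbr G A U)) := by
  have h1 : ∑ B ∈ powersetCard D U, gnpP p (fun G => nbr G A U = B) ≤
      gnpP p (fun G => D ≤ #(nbr G A U)) := by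
    simp only [gnpP]
    rw [← gnpE_sum]
    refine gnpE_mono hp hp1 fun G => ?_
    by_cases h : #(nbr G A U) = D
    · rw [ind_of h.ge, sum_eq_single_of_mem (nbr G A U)
        (mem_powersetCard.2 ⟨nbr_subset G A U, h⟩) fun B _ hB => ind_of_not fun h' => hB h'.symm]
      exact ind_le_one _
    · rw [sum_eq_zero fun B hB => ind_of_not fun h' => h (by rw [h']; exact (mem_powersetCard.1 hB).2)]
      exact ind_nonneg _
  refine le_trans (le_of_eq ?_) h1
  rw [sum_congr rfl fun B hB => ?_, sum_const, card_powersetCard, nsmul_eq_mul]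
  rw [gnpP_nbr_eq p A U hAU (mem_powersetCard.1 hB).1, (mem_powersetCard.1 hB).2]

/-- Only the event of exactly `D` neighbours is kept; its probability converges to a positive
Poisson weight. The constant allows half of the vertices to be unavailable. -/
theorem exists_le_gnpP_card_nbr (hlam : 0 < lam) (D : ℕ) :
    ∃ c : ℝ, 0 < c ∧ ∀ᶠ n : ℕ in atTop, ∀ (V : Type) [Fintype V] [DecidableEq V],
      Fintype.card V = n → ∀ (w : V) (U : Finset V), w ∉ U → n ≤ 2 * #U →
      c ≤ gnpP (lam / n) (fun G => D ≤ #(nbr G {w} U)) := by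
  refine ⟨(lam / 4) ^ D / (D.factorial : ℝ) * Real.exp (-(2 * lam)), by positivity, ?_⟩
  filter_upwards [eventually_ge_atTop (4 * D), eventually_ge_atTop 1,
    tendsto_natCast_atTop_atTop.eventually (eventually_ge_atTop (2 * lam))]
    with n hnD hn1 hnlam V _ _ hV w U hw hU
  have hn0 : (0 : ℝ) < n := by exact_mod_cast hn1
  have hp : 0 ≤ lam / n := by positivity
  have hp2 : lam / n ≤ 1 / 2 := by rw [div_le_iff₀ hn0]; linarith
  refine le_trans ?_ (le_gnpP_card_nbr hp (by linarith) D (by simpa using hw))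
  rw [card_singleton, hitProb_one]
  have hUn : #U ≤ n := hV ▸ card_le_univ U
  have h1 : (lam / 4) ^ D / (D.factorial : ℝ) ≤ ((#U).choose D : ℝ) * (lam / n) ^ D := by
    calc (lam / 4) ^ D / (D.factorial : ℝ)
        ≤ (((#U + 1 - D : ℕ) : ℝ) * (lam / n)) ^ D / (D.factorial : ℝ) := by
          have h3 : (n : ℝ) ≤ 4 * (#U + 1 - D : ℕ) := by
            have : n ≤ 4 * (#U + 1 - D) := by omega
            exact_mod_cast this
          have h4 : lam / 4 ≤ ((#U + 1 - D : ℕ) : ℝ) * (lam / n) := by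
            calc lam / 4 = n / 4 * (lam / n) := by field_simp
              _ ≤ _ := mul_le_mul_of_nonneg_right (by linarith) hp
          gcongr
      _ = ((#U + 1 - D : ℕ) : ℝ) ^ D / (D.factorial : ℝ) * (lam / n) ^ D := by rw [mul_pow]; ring
      _ ≤ _ := mul_le_mul_of_nonneg_right (Nat.pow_le_choose D #U) (by positivity)
  have h2 : Real.exp (-(2 * lam)) ≤ (1 - lam / n) ^ (#U - D) := by
    have h3 := inv_one_sub_pow_le hp hp2 n
    rw [show lam / n * (n : ℝ) = lam by field_simp] at h3
    have h4 : 0 < (1 - lam / n) ^ n := pow_pos (by linarith) n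
    rw [Real.exp_neg]
    refine le_trans ?_ (pow_le_pow_of_le_one (by linarith) (by linarith)
      (by omega : #U - D ≤ n))
    exact (inv_le_comm₀ (Real.exp_pos _) h4).2 h3
  rw [← mul_assoc]
  exact mul_le_mul h1 h2 (Real.exp_pos _).le (by positivity)

theorem sum_places_pendAt_hub_bounds {p : ℝ} (hp : 0 ≤ p) (hp1 : p ≤ 1) {k S D : ℕ} {a b c : ℝ}
    (hc0 : 0 ≤ c)
    (ha : ∀ v w : V, v ≠ w → a ≤ ∑ T ∈ univ.filter (fun T : Finset V => #T ≤ S),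
      gnpP p (fun G => PendAt k G ((v, w), T)))
    (hb : ∀ v w : V, v ≠ w → ∑ T ∈ univ.filter (fun T : Finset V => #T ≤ S),
      gnpP p (fun G => PendAt k G ((v, w), T)) ≤ b)
    (hc : ∀ q ∈ places V S, c ≤ gnpP p (fun G => Hub D G q)) :
    (Fintype.card V * (Fintype.card V - 1) : ℝ) * (c * a) ≤
      ∑ q ∈ places V S, gnpP p (fun G => PendAt k G q ∧ Hub D G q) ∧
    ∑ q ∈ places V S, gnpP p (fun G => PendAt k G q ∧ Hub D G q) ≤
      (Fintype.card V * (Fintype.card V - 1) : ℝ) * b := by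
  have hcard : (#(univ : Finset V).offDiag : ℝ) = Fintype.card V * (Fintype.card V - 1) := by
    rw [offDiag_card, card_univ, Nat.cast_sub (Nat.le_mul_self _)]
    push_cast; ring
  rw [← hcard]
  constructor
  · calc (#(univ : Finset V).offDiag : ℝ) * (c * a)
        = ∑ o ∈ (univ : Finset V).offDiag, c * a := by rw [sum_const, nsmul_eq_mul]
      _ ≤ ∑ o ∈ (univ : Finset V).offDiag, c * ∑ T ∈ univ.filter (fun T : Finset V => #T ≤ S),
          gnpP p (fun G => PendAt k G (o, T)) :=
          sum_le_sum fun o ho => mul_le_mul_of_nonneg_left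
            (ha o.1 o.2 (mem_offDiag.1 ho).2.2) hc0
      _ = ∑ q ∈ places V S, c * gnpP p (fun G => PendAt k G q) := by
          rw [places, sum_product]
          exact sum_congr rfl fun o _ => by rw [mul_sum]
      _ ≤ _ := by
          refine sum_le_sum fun q hq => ?_
          rw [gnpP_pendAt_hub, mul_comm]
          exact mul_le_mul_of_nonneg_left (hc q hq) (gnpP_nonneg hp hp1 _)
  · calc ∑ q ∈ places V S, gnpP p (fun G => PendAt k G q ∧ Hub D G q)
        ≤ ∑ q ∈ places V S, gnpP p (fun G => PendAt k G q) :=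
          sum_le_sum fun q _ => gnpP_mono hp hp1 fun G h => h.1
      _ = ∑ o ∈ (univ : Finset V).offDiag, ∑ T ∈ univ.filter (fun T : Finset V => #T ≤ S),
          gnpP p (fun G => PendAt k G (o, T)) := by rw [places, sum_product]
      _ ≤ ∑ o ∈ (univ : Finset V).offDiag, b :=
          sum_le_sum fun o ho => hb o.1 o.2 (mem_offDiag.1 ho).2.2
      _ = _ := by rw [sum_const, nsmul_eq_mul]

end FirstMoment

/-! ### The lower bound on the diameter -/

section LowerBound

variable {lam m : ℝ}

theorem second_moment_ratio_le {μ κ η Q d : ℝ} (hd : 0 < d) (hd1 : d ≤ 1 / 2) (hμ : 1 / d ≤ μ)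
    (hκ : κ ≤ d) (hη : η ≤ d) (hQ : Q ≤ d) :
    (μ + (κ + 2 * η) * μ ^ 2 + Q) / (μ - 1) ^ 2 + Q ≤ 21 * d := by
  have h2 : 2 ≤ μ := by
    refine le_trans ?_ hμ
    rw [le_div_iff₀ hd]; linarith
  have h1 : 1 ≤ μ * d := (div_le_iff₀ hd).1 hμ
  have h3 : μ ≤ d * μ ^ 2 := by nlinarith
  have h4 : μ ^ 2 ≤ 4 * (μ - 1) ^ 2 := by nlinarith
  have h5 : (κ + 2 * η) * μ ^ 2 ≤ 3 * d * μ ^ 2 :=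
    mul_le_mul_of_nonneg_right (by linarith) (sq_nonneg μ)
  have h6 : Q ≤ d * μ ^ 2 := by nlinarith
  have h7 : (μ + (κ + 2 * η) * μ ^ 2 + Q) / (μ - 1) ^ 2 ≤ 20 * d := by
    rw [div_le_iff₀ (by have : 0 < μ - 1 := by linarith
                        positivity)]
    nlinarith
  linarith

/-- The second moment bound with explicit parameters: `b` and `a` are upper and lower bounds, both
of order `m ^ k / n`, for the probability of a pendant set at a given attaching edge. `hmean` makes
the expected number at least `1 / d`, and `hclose` makes the contribution of close pairs at most
`d`. -/
theorem gnpP_not_exists_far_pendant_le (hlam : 1 < lam) (hm : 0 < m) (hm1 : m < 1)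
    (hdual : m * Real.exp (-m) = lam * Real.exp (-lam)) {n S k D cap t l : ℕ} {c d ρ : ℝ}
    (hd : 0 < d) (hd1 : d ≤ 1 / 2) (hc0 : 0 < c) (hρ0 : 0 ≤ ρ) (hρ1 : ρ ≤ 1) (hρ : ρ ^ D ≤ d)
    (hn : 64 * (lam + 1) ^ 2 * (S + 1) ^ 2 ≤ n) (hn' : 2 * lam * (S + 1) ^ 2 ≤ d * n)
    (hn2 : 2 ≤ n)
    (hV : Fintype.card V = n) (hcap : 2 * S < cap) (ht : 2 * S ≤ t) (hl : 1 ≤ l)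
    (hτ : (m * Real.exp (1 - m)) ^ S * m⁻¹ ≤ (1 - m) ^ 2 / 2 * m ^ k)
    (hc : ∀ q ∈ places V S, c ≤ gnpP (lam / n) (fun G => Hub D G q))
    (hdie : ∀ q ∈ places V S, ∀ B ⊆ (insert q.1.2 q.2)ᶜ,
      gnpP (lam / n) (fun G => (grow cap t G B ((insert q.1.2 q.2)ᶜ \ B)).1 = ∅) ≤ ρ ^ #B)
    (hmean : 1 / d ≤ c * (m * (1 - m) ^ 2 / 16) * (n * m ^ k))
    (hclose : 8 * (n * m ^ k) ^ 2 * (1 + lam ^ (l + 1) / (lam - 1)) ≤ d * n) :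
    gnpP (lam / n) (fun G : SimpleGraph V => ¬ ∃ q q' : (V × V) × Finset V,
      (PendAt k G q ∧ Survives cap t G q) ∧ (PendAt k G q' ∧ Survives cap t G q') ∧ Apart q q' ∧
      ¬ G.edist q.1.2 q'.1.2 ≤ l) ≤ 21 * d := by
  have hlam0 : 0 < lam := by linarith
  have hlam1 : 0 < lam - 1 := by linarith
  have hS0 : (0 : ℝ) ≤ S := Nat.cast_nonneg S
  have hn2' : (2 : ℝ) ≤ n := by exact_mod_cast hn2
  have hn0 : (0 : ℝ) < n := by linarith
  set p := lam / n with hpdef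
  have hpn : p * n = lam := by rw [hpdef]; field_simp
  have hp : 0 ≤ p := by positivity
  have hsq : 2 * p * (S + 1) ^ 2 ≤ d := by
    have : 2 * p * (S + 1) ^ 2 = 2 * lam * (S + 1) ^ 2 / n := by rw [hpdef]; ring
    rw [this, div_le_iff₀ hn0]; exact hn'
  have hS1 : 1 ≤ ((S : ℝ) + 1) ^ 2 := one_le_pow₀ (by linarith)
  have hp2 : p ≤ 1 / 2 := by nlinarith
  have hp1 : p ≤ 1 := by linarith
  have hpS : 1 / 2 ≤ (1 - p) ^ S := by
    calc (1 : ℝ) / 2 ≤ 1 + S * (-p) := by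
          have : p * S ≤ p * (S + 1) ^ 2 := mul_le_mul_of_nonneg_left (by nlinarith) hp
          linarith
      _ ≤ (1 + -p) ^ S := one_add_mul_le_pow (by linarith) S
      _ = _ := by rw [← sub_eq_add_neg]
  have hκ : 1 ≤ (1 + d) * (1 - p) ^ ((S + 1) ^ 2) := by
    have h1 : 1 - d / 2 ≤ (1 - p) ^ ((S + 1) ^ 2) := by
      calc 1 - d / 2 ≤ 1 + (((S + 1) ^ 2 : ℕ) : ℝ) * (-p) := by push_cast; linarith
        _ ≤ (1 + -p) ^ ((S + 1) ^ 2) := one_add_mul_le_pow (by linarith) _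
        _ = _ := by rw [← sub_eq_add_neg]
    have := mul_le_mul_of_nonneg_left h1 (by linarith : 0 ≤ 1 + d)
    nlinarith
  set b := 2 * m ^ k / n with hb
  have hbb : ∀ v w : V, v ≠ w → ∑ T ∈ univ.filter (fun T : Finset V => #T ≤ S),
      gnpP p (fun G => PendAt k G ((v, w), T)) ≤ b := by
    intro v w hvw
    refine (sum_gnpP_pendAt_le hp hp1 k S hvw).trans ?_
    have h1 := (gnpP_diesSmall_bounds (k := k) hlam hm hm1 hdual hn hV hvw).1
    calc p * gnpP p (fun G => DiesSmall k S G {v} {v, w}ᶜ) ≤ p * (2 * (m / lam) * m ^ k) :=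
          mul_le_mul_of_nonneg_left h1 hp
      _ = m * b := by rw [hb, hpdef]; field_simp
      _ ≤ b := mul_le_of_le_one_left (by positivity) hm1.le
  set a := m * (1 - m) ^ 2 / 8 * m ^ k / n with ha
  have haa : ∀ v w : V, v ≠ w → a ≤ ∑ T ∈ univ.filter (fun T : Finset V => #T ≤ S),
      gnpP p (fun G => PendAt k G ((v, w), T)) := by
    intro v w hvw
    refine le_trans ?_ (le_sum_gnpP_pendAt hp hp1 k S hvw)
    have h1 := (gnpP_diesSmall_bounds (k := k) hlam hm hm1 hdual hn hV hvw).2 hτ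
    calc a = p * (1 / 2) * (m / lam * ((1 - m) ^ 2 / 4 * m ^ k)) := by
          rw [ha, hpdef]; field_simp; ring
      _ ≤ _ := by gcongr
  obtain ⟨hμ1, -⟩ := sum_places_pendAt_hub_bounds hp hp1 hc0.le haa hbb hc
  rw [hV] at hμ1
  set μ := ∑ q ∈ places V S, gnpP p (fun G => PendAt k G q ∧ Hub D G q) with hμ
  have hμd : 1 / d ≤ μ := by
    refine hmean.trans (le_trans ?_ hμ1)
    have : (n : ℝ) / 2 ≤ n - 1 := by linarith
    calc c * (m * (1 - m) ^ 2 / 16) * (n * m ^ k) = n * (n / 2) * (c * a) := by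
          rw [ha]; field_simp; ring
      _ ≤ _ := by gcongr
  have hμ2 : 1 < μ := by
    refine lt_of_lt_of_le ?_ hμd
    rw [lt_div_iff₀ hd]; linarith
  set β := p * lam ^ l / (lam - 1) with hβdef
  have hβ : ∀ x y : V, x ≠ y → gnpP p (fun G => G.edist x y ≤ l) ≤ β := by
    intro x y hxy
    have h := gnpP_edist_le hp hp1 (by rw [hV, hpn]; exact hlam) hxy l
    rwa [hV, hpn] at h
  have hβ0 : 0 ≤ β := by positivity
  refine (gnpP_not_exists_far_le hp hp1 (η := ρ ^ D) hcap ht hl hd.le hβ0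
    (fun q hq => le_gnpP_pendAt_hub_survives hp hp1 hρ0 hρ1 k D cap t q (hdie q hq)) hκ hbb hβ
    hμ hμ2 rfl).trans ?_
  refine second_moment_ratio_le hd hd1 hμd le_rfl hρ ?_
  rw [hV]
  calc (1 + d) * (b ^ 2 * (n ^ 3 * (1 + n * β)))
      ≤ 2 * (b ^ 2 * (n ^ 3 * (1 + n * β))) := by gcongr; linarith
    _ = 8 * (n * m ^ k) ^ 2 * (1 + lam ^ (l + 1) / (lam - 1)) / n := by
        rw [hb, hβdef, hpdef, pow_succ]; field_simp; ring
    _ ≤ d := by rw [div_le_iff₀ hn0]; exact hclose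

theorem eventually_sq_ceil_log_le (K A : ℝ) :
    ∀ᶠ n : ℕ in atTop, A * ((⌈K * Real.log n⌉₊ : ℝ) + 1) ^ 2 ≤ n := by
  filter_upwards [eventually_mul_log_le_rpow ((|K| + 2) * (|A| + 1))
    (by norm_num : (0 : ℝ) < 1 / 2), eventually_ge_atTop 3] with n h1 h3
  have hn : (3 : ℝ) ≤ n := by exact_mod_cast h3
  have hlog : 1 ≤ Real.log n := by
    rw [Real.le_log_iff_exp_le (by linarith)]
    linarith [Real.exp_one_lt_d9]
  have h4 : (⌈K * Real.log n⌉₊ : ℝ) + 1 ≤ (|K| + 2) * Real.log n := by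
    have h5 : (⌈K * Real.log n⌉₊ : ℝ) ≤ ⌈|K| * Real.log n⌉₊ := by
      exact_mod_cast Nat.ceil_mono (mul_le_mul_of_nonneg_right (le_abs_self K) (by linarith))
    have h6 := Nat.ceil_lt_add_one (show 0 ≤ |K| * Real.log n by positivity)
    linarith
  have h7 : (|A| + 1) * ((⌈K * Real.log n⌉₊ : ℝ) + 1) ≤ (n : ℝ) ^ (1 / 2 : ℝ) := by
    refine le_trans ?_ h1
    have := mul_le_mul_of_nonneg_left h4 (by positivity : 0 ≤ |A| + 1)
    linarith
  have h8 : ((|A| + 1) * ((⌈K * Real.log n⌉₊ : ℝ) + 1)) ^ 2 ≤ n := by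
    have h9 := pow_le_pow_left₀ (by positivity) h7 2
    rwa [← Real.rpow_natCast ((n : ℝ) ^ (1 / 2 : ℝ)), ← Real.rpow_mul (by linarith),
      show (1 / 2 : ℝ) * (2 : ℕ) = 1 by norm_num, Real.rpow_one] at h9
  refine le_trans ?_ h8
  rw [mul_pow]
  refine mul_le_mul_of_nonneg_right ?_ (sq_nonneg _)
  nlinarith [le_abs_self A, abs_nonneg A]

/-- Two distant pendant subgraphs attached to large components force a large diameter. -/
theorem le_finiteDiam_of_far {k cap t l : ℕ} (hcap : 2 ≤ cap) {G : SimpleGraph V}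
    (hfar : ¬ ∃ x y, (grow cap (t + 1) G {x} {x}ᶜ).1 ≠ ∅ ∧ (grow cap (t + 1) G {y} {y}ᶜ).1 ≠ ∅ ∧
      ¬ G.edist x y ≤ ((2 * (t + 1) + 1 : ℕ) : ℕ∞))
    (h : ∃ q q' : (V × V) × Finset V, (PendAt k G q ∧ Survives cap t G q) ∧
      (PendAt k G q' ∧ Survives cap t G q') ∧ Apart q q' ∧ ¬ G.edist q.1.2 q'.1.2 ≤ l) :
    l + 1 + 2 * k + 2 ≤ G.finiteDiam := by
  obtain ⟨q, q', ⟨h1, s1⟩, ⟨h2, s2⟩, hA, hl⟩ := h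
  have hd : G.edist q.1.2 q'.1.2 ≤ ((2 * (t + 1) + 1 : ℕ) : ℕ∞) := by
    by_contra hcon
    exact hfar ⟨_, _, h1.2.grow_ne_empty hcap s1, h2.2.grow_ne_empty hcap s2, hcon⟩
  refine h1.2.exists_dist h2.2 h1.1 h2.1 hA.1 hA.2.1
    (SimpleGraph.reachable_of_edist_ne_top (ne_top_of_le_ne_top (ENat.natCast_ne_top _) hd)) ?_
  intro hlt
  refine hl (ENat.lt_add_one_iff (ENat.natCast_ne_top l) |>.1 ?_)
  exact_mod_cast hlt

end LowerBound

/-! ### Bounds on the diameter in probability -/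

section Main

variable {lam m : ℝ}

theorem eventually_two_mul_ceil_lt_levelCap (K : ℝ) :
    ∀ᶠ n : ℕ in atTop, 2 * (⌈K * Real.log n⌉₊ + 1) ≤ levelCap n := by
  filter_upwards [eventually_sq_ceil_log_le K 4, eventually_ge_atTop 1] with n h1 hn1
  have hn : (1 : ℝ) ≤ n := by exact_mod_cast hn1
  have h2 : 2 * ((⌈K * Real.log n⌉₊ : ℝ) + 1) ≤ (n : ℝ) ^ (3 / 5 : ℝ) := by
    have h3 : (2 * ((⌈K * Real.log n⌉₊ : ℝ) + 1)) ^ 2 ≤ ((n : ℝ) ^ (3 / 5 : ℝ)) ^ 2 := by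
      rw [← Real.rpow_natCast ((n : ℝ) ^ (3 / 5 : ℝ)), ← Real.rpow_mul (by linarith)]
      calc (2 * ((⌈K * Real.log n⌉₊ : ℝ) + 1)) ^ 2 ≤ n := by linarith
        _ = (n : ℝ) ^ (1 : ℝ) := (Real.rpow_one _).symm
        _ ≤ _ := Real.rpow_le_rpow_of_exponent_le hn (by norm_num)
    exact le_of_sq_le_sq h3 (by positivity)
  have h4 := h2.trans (Nat.le_ceil ((n : ℝ) ^ (3 / 5 : ℝ)))
  rw [levelCap]
  exact_mod_cast h4

theorem lt_of_lt_pow_mul_log {x y : ℝ} {k : ℕ} (hx : 1 < x) (hy : 0 < y) (h : y < x ^ (k + 1)) :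
    Real.log y / Real.log x ≤ k + 1 := by
  rw [div_le_iff₀ (Real.log_pos hx)]
  have := Real.log_le_log hy h.le
  rw [Real.log_pow] at this
  exact_mod_cast this

-- The parameters are fixed in the order in which they depend on each other: the error `d`, the hub
-- size `D` and its probability `c`, the multiple `M` in the expected number of pendant sets, and
-- then `θ`, which makes roots within distance `l` rare. None of them depends on `n`, so the loss in
-- the diameter is bounded.
set_option maxHeartbeats 1000000 in
theorem eventually_gnpP_finiteDiam_lt_le (hlam : 1 < lam) (hm : 0 < m) (hm1 : m < 1)
    (hdual : m * Real.exp (-m) = lam * Real.exp (-lam)) {δ : ℝ} (hδ : 0 < δ) :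
    ∃ C : ℝ, ∀ᶠ n : ℕ in atTop, ∀ (V : Type) [Fintype V] [DecidableEq V], Fintype.card V = n →
      gnpP (lam / n) (fun G : SimpleGraph V => ¬ diamMainTerm lam m n - C ≤ G.finiteDiam) ≤ δ := by
  have hlam0 : 0 < lam := by linarith
  have hlam1 : 0 < lam - 1 := by linarith
  have h1m : 0 < 1 - m := by linarith
  have hminv : 1 < 1 / m := by rw [lt_div_iff₀ hm]; linarith
  have hlog : 0 < Real.log lam := Real.log_pos hlam
  have hlogm : 0 < Real.log (1 / m) := Real.log_pos hminv
  set d : ℝ := min (1 / 2) (δ / 42) with hd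
  have hd0 : 0 < d := by positivity
  have hd1 : d ≤ 1 / 2 := min_le_left _ _
  have hdδ : 21 * d ≤ δ / 2 := by have : d ≤ δ / 42 := min_le_right _ _
                                  linarith
  set ρ : ℝ := 2 / (1 + lam) with hρ
  have hρ0 : 0 ≤ ρ := by positivity
  have hρ1 : ρ < 1 := by rw [hρ, div_lt_one (by linarith)]; linarith
  obtain ⟨D, hD⟩ := exists_pow_lt_of_lt_one hd0 hρ1
  obtain ⟨c, hc0, hc⟩ := exists_le_gnpP_card_nbr hlam0 D
  set τ : ℝ := m * Real.exp (1 - m) with hτ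
  have hτ0 : 0 < τ := by positivity
  have hτ1 : τ < 1 := by
    have h1 := Real.add_one_lt_exp (x := m - 1) (by linarith)
    have h2 : Real.exp (m - 1) * Real.exp (1 - m) = 1 := by rw [← Real.exp_add]; simp
    calc τ < Real.exp (m - 1) * Real.exp (1 - m) :=
          mul_lt_mul_of_pos_right (by linarith) (Real.exp_pos _)
      _ = 1 := h2
  have hlogτ : Real.log τ < 0 := Real.log_neg hτ0 hτ1
  -- With `S ≥ K₁ * log n` the progeny tail `τ ^ S` is at most `n ^ (-2)`, negligible against `m ^ k
  -- ≥ 1 / n`.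
  set K₁ : ℝ := 2 / -Real.log τ with hK₁
  have hK₁0 : 0 < K₁ := div_pos two_pos (by linarith)
  set M : ℝ := max 1 (16 / (d * c * (m * (1 - m) ^ 2))) with hM
  have hM1 : 1 ≤ M := le_max_left _ _
  have hM2 : 16 / (d * c * (m * (1 - m) ^ 2)) ≤ M := le_max_right _ _
  have hM0 : 0 < M := by linarith
  -- With `lam ^ l ≤ θ * n` and `n * m ^ k ≤ M / m`, the part of the close-pair term that grows with
  -- `l` becomes `d * n / 2`.
  set θ : ℝ := d * (lam - 1) / (16 * lam * (M / m) ^ 2) with hθ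
  have hθ0 : 0 < θ := by positivity
  obtain ⟨C₀, hC₀⟩ := eventually_gnpP_exists_far_le hlam hm hm1 hdual (half_pos hδ)
  set cm : ℝ := 1 / Real.log lam + 2 / Real.log (1 / m) with hcm
  have hcm0 : 0 < cm := by positivity
  have hmain : ∀ n : ℕ, diamMainTerm lam m n = cm * Real.log n := fun n => by
    rw [diamMainTerm, hcm]; ring
  set K₂ : ℝ := 2 * K₁ + cm + |C₀| + 6 with hK₂
  refine ⟨2 * Real.log M / Real.log (1 / m) - Real.log θ / Real.log lam, ?_⟩
  filter_upwards [hC₀ K₂, hc, eventually_gnpP_grow_empty_le hlam K₂,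
    eventually_sq_ceil_log_le K₁ (64 * (lam + 1) ^ 2), eventually_sq_ceil_log_le K₁ (2 * lam / d),
    eventually_sq_ceil_log_le K₁ 4,
    eventually_two_mul_ceil_lt_levelCap K₁, eventually_ge_atTop 3,
    tendsto_natCast_atTop_atTop.eventually (eventually_ge_atTop (2 / (m * (1 - m) ^ 2))),
    tendsto_natCast_atTop_atTop.eventually (eventually_ge_atTop M),
    tendsto_natCast_atTop_atTop.eventually (eventually_ge_atTop (lam / θ)),
    tendsto_natCast_atTop_atTop.eventually (eventually_ge_atTop (16 * (M / m) ^ 2 / d)),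
    tendsto_natCast_atTop_atTop.eventually (eventually_ge_atTop lam)]
    with n hfar hc hdie hS1 hS2 hS3 hcap hn3 hnm hnM hnθ hnd hnlam V _ _ hV
  have hn3' : (3 : ℝ) ≤ n := by exact_mod_cast hn3
  have hn0 : (0 : ℝ) < n := by linarith
  have hlogn : 1 ≤ Real.log n := by
    rw [Real.le_log_iff_exp_le hn0]
    linarith [Real.exp_one_lt_d9]
  set S := ⌈K₁ * Real.log n⌉₊ with hS
  have hSle : (S : ℝ) ≤ K₁ * Real.log n + 1 := (Nat.ceil_lt_add_one (by positivity)).le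
  have hSge : K₁ * Real.log n ≤ S := Nat.le_ceil _
  -- The first argument forces searches trapped in small components to die; the second is the time
  -- after which surviving searches meet.
  set t := max (2 * S) ⌈diamMainTerm lam m n / 2 + C₀⌉₊ with ht
  have htK : ((t + 1 : ℕ) : ℝ) ≤ K₂ * Real.log n := by
    have h1 : (t : ℝ) ≤ 2 * S + ⌈diamMainTerm lam m n / 2 + C₀⌉₊ := by
      have : t ≤ 2 * S + ⌈diamMainTerm lam m n / 2 + C₀⌉₊ := by omega
      exact_mod_cast this
    have h2 : (⌈diamMainTerm lam m n / 2 + C₀⌉₊ : ℝ) ≤ cm * Real.log n + |C₀| + 1 := by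
      have h3 : (⌈diamMainTerm lam m n / 2 + C₀⌉₊ : ℝ) ≤ ⌈cm * Real.log n + |C₀|⌉₊ := by
        have h4 : 0 ≤ cm * Real.log n := by positivity
        have : diamMainTerm lam m n / 2 + C₀ ≤ cm * Real.log n + |C₀| := by
          rw [hmain]
          linarith [le_abs_self C₀]
        exact_mod_cast Nat.ceil_mono this
      exact h3.trans (Nat.ceil_lt_add_one (by positivity)).le
    have h5 := mul_le_mul_of_nonneg_left hlogn (abs_nonneg C₀)
    push_cast
    rw [hK₂]
    linarith
  have htK' : (t : ℝ) ≤ K₂ * Real.log n := by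
    refine le_trans ?_ htK
    push_cast; linarith
  have htfar : diamMainTerm lam m n / 2 + C₀ ≤ ((t + 1 : ℕ) : ℝ) := by
    have h1 := Nat.le_ceil (diamMainTerm lam m n / 2 + C₀)
    have h2 : (⌈diamMainTerm lam m n / 2 + C₀⌉₊ : ℝ) ≤ t := by
      exact_mod_cast le_max_right _ _
    push_cast; linarith
  -- The largest depth for which `n * m ^ k` is still at least `M`; it is then at most `M / m`.
  obtain ⟨k, hk1, hk2⟩ := exists_nat_pow_near (x := (n : ℝ) / M) ((one_le_div hM0).2 hnM) hminv
  have hlamθ : lam ≤ θ * n := by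
    rw [div_le_iff₀ hθ0] at hnθ
    linarith
  obtain ⟨l, hl1, hl2⟩ := exists_nat_pow_near (x := θ * n) (by linarith) hlam
  have hl : 1 ≤ l := by
    by_contra hcon
    rw [show l = 0 by omega, zero_add, pow_one] at hl2
    linarith
  have hmk : 0 < m ^ k := by positivity
  have hk1' : M ≤ n * m ^ k := by
    rw [one_div, inv_pow, inv_le_iff_one_le_mul₀ hmk, div_mul_eq_mul_div, le_div_iff₀ hM0] at hk1
    linarith
  have hk2' : n * m ^ k ≤ M / m := by
    rw [one_div, inv_pow, lt_inv_comm₀ (by positivity) (by positivity), inv_div, pow_succ,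
      lt_div_iff₀ hn0] at hk2
    rw [le_div_iff₀ hm]
    linarith
  have hnotfar : gnpP (lam / n) (fun G : SimpleGraph V => ¬ ∃ q q' : (V × V) × Finset V,
      (PendAt k G q ∧ Survives (levelCap n) t G q) ∧
      (PendAt k G q' ∧ Survives (levelCap n) t G q') ∧ Apart q q' ∧
      ¬ G.edist q.1.2 q'.1.2 ≤ l) ≤ 21 * d := by
    have hins : ∀ q ∈ places V S, n ≤ #((insert q.1.2 q.2)ᶜ : Finset V) + (S + 1) := by
      intro q hq
      have h1 := card_le_of_mem_places hq
      have h2 := card_insert_le q.1.2 q.2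
      rw [card_compl, hV]
      omega
    refine gnpP_not_exists_far_pendant_le hlam hm hm1 hdual (D := D) (ρ := ρ) hd0 hd1 hc0 hρ0 hρ1.le
      hD.le hS1 ?_ (by omega) hV (by omega) (le_max_left _ _) hl ?_ (fun q hq => ?_)
      (fun q hq B hB => ?_) ?_ ?_
    · rw [div_mul_eq_mul_div, div_le_iff₀ hd0] at hS2
      linarith
    · have h1 : τ ^ S ≤ (n : ℝ)⁻¹ ^ 2 := by
        rw [← Real.rpow_natCast τ S, Real.rpow_def_of_pos hτ0]
        have h2 : Real.log τ * S ≤ -(2 * Real.log n) := by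
          have h3 := mul_le_mul_of_nonneg_left hSge (by linarith : 0 ≤ -Real.log τ)
          have h4 : -Real.log τ * (K₁ * Real.log n) = 2 * Real.log n := by
            rw [hK₁]
            have := hlogτ.ne
            field_simp
          linarith
        refine (Real.exp_le_exp.2 h2).trans (le_of_eq ?_)
        rw [Real.exp_neg, inv_pow, ← Real.log_rpow hn0, Real.exp_log (by positivity)]
        norm_cast
      rw [div_le_iff₀ (by positivity)] at hnm
      calc τ ^ S * m⁻¹ ≤ (n : ℝ)⁻¹ ^ 2 * m⁻¹ := by gcongr
        _ ≤ (1 - m) ^ 2 / 2 * (1 / n) := by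
            rw [inv_pow, ← mul_inv, inv_le_iff_one_le_mul₀ (by positivity)]
            have : (1 - m) ^ 2 / 2 * (1 / n) * (n ^ 2 * m) = n * (m * (1 - m) ^ 2) / 2 := by
              field_simp
            rw [this]
            linarith
        _ ≤ _ := by
            refine mul_le_mul_of_nonneg_left ?_ (by positivity)
            rw [div_le_iff₀ hn0]
            linarith
    · refine hc V hV q.1.2 (insert q.1.2 q.2)ᶜ (by simp) ?_
      have h1 := hins q hq
      have h2 : 2 * (S + 1) ≤ n := by
        have h3 : (S : ℝ) + 1 ≤ (S + 1) ^ 2 := by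
          have : (0 : ℝ) ≤ S := Nat.cast_nonneg S
          nlinarith
        have : ((2 * (S + 1) : ℕ) : ℝ) ≤ n := by push_cast; linarith
        exact_mod_cast this
      omega
    · refine hdie V hV t htK' B _ disjoint_sdiff ?_
      rw [union_sdiff_of_subset hB]
      have := hins q hq
      omega
    · calc 1 / d = c * (m * (1 - m) ^ 2 / 16) * (16 / (d * c * (m * (1 - m) ^ 2))) := by
            field_simp
        _ ≤ _ := by
            refine mul_le_mul_of_nonneg_left (hM2.trans hk1') (by positivity)
    · have h1 : lam ^ (l + 1) / (lam - 1) ≤ lam * (θ * n) / (lam - 1) := by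
        rw [pow_succ, mul_comm]
        gcongr
      have h2 : 0 ≤ lam ^ (l + 1) / (lam - 1) := by positivity
      rw [div_le_iff₀ hd0] at hnd
      calc 8 * (n * m ^ k) ^ 2 * (1 + lam ^ (l + 1) / (lam - 1))
          ≤ 8 * (M / m) ^ 2 * (1 + lam * (θ * n) / (lam - 1)) := by gcongr
        _ = 8 * (M / m) ^ 2 + d * n / 2 := by
            rw [hθ]; field_simp; ring
        _ ≤ d * n := by linarith
  have hfar' := hfar V hV (t + 1) htfar htK
  have hn1 : lam / n ≤ 1 := (div_le_one hn0).2 hnlam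
  have hp : 0 ≤ lam / n := by positivity
  refine le_trans ((gnpP_mono hp hn1 fun G hG => ?_).trans (gnpP_or_le hp hn1 _ _))
    ((add_le_add hfar' hnotfar).trans (by linarith))
  by_contra hcon
  rw [not_or, not_not] at hcon
  apply hG
  have h1 := le_finiteDiam_of_far (by omega) hcon.1 hcon.2
  have h2 : ((l + 1 + 2 * k + 2 : ℕ) : ℝ) ≤ G.finiteDiam := by exact_mod_cast h1
  push_cast at h2
  -- By maximality, `k + 1` and `l + 1` reach the logarithms of `n / M` and `θ * n`; the diameter
  -- bound is exactly `(l + 1) + 2 * (k + 1)`.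
  have h3 := lt_of_lt_pow_mul_log hminv (by positivity) hk2
  have h4 := lt_of_lt_pow_mul_log hlam (by positivity) hl2
  rw [Real.log_div (by positivity) (by positivity), sub_div] at h3
  rw [Real.log_mul (by positivity) (by positivity), add_div] at h4
  have h5 : diamMainTerm lam m n =
      Real.log n / Real.log lam + 2 * (Real.log n / Real.log (1 / m)) := rfl
  have h6 : 2 * Real.log M / Real.log (1 / m) = 2 * (Real.log M / Real.log (1 / m)) := by ring
  linarith

/-- Take two vertices of one component realising the diameter. If either search dies within `t`
steps, the distance is at most `t`; if both survive, it is at most `2 * t + 1` outside an event of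
probability `δ`. Rounding `t` up costs the additive `3`. -/
theorem eventually_gnpP_lt_finiteDiam_le (hlam : 1 < lam) (hm : 0 < m) (hm1 : m < 1)
    (hdual : m * Real.exp (-m) = lam * Real.exp (-lam)) {δ : ℝ} (hδ : 0 < δ) :
    ∃ C : ℝ, ∀ᶠ n : ℕ in atTop, ∀ (V : Type) [Fintype V] [DecidableEq V], Fintype.card V = n →
      gnpP (lam / n) (fun G : SimpleGraph V => ¬ G.finiteDiam ≤ diamMainTerm lam m n + C) ≤ δ := by
  have hlam0 : 0 < lam := by linarith
  have hlog : 0 < Real.log lam := Real.log_pos hlam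
  have hlogm : 0 < Real.log (1 / m) := Real.log_pos (by rw [lt_div_iff₀ hm]; linarith)
  obtain ⟨C₀, hC₀⟩ := eventually_gnpP_exists_far_le hlam hm hm1 hdual hδ
  set cm : ℝ := 1 / Real.log lam + 2 / Real.log (1 / m) with hcm
  have hcm0 : 0 < cm := by positivity
  have hmain : ∀ n : ℕ, diamMainTerm lam m n = cm * Real.log n := fun n => by
    rw [diamMainTerm, hcm]; ring
  refine ⟨2 * |C₀| + 3, ?_⟩
  filter_upwards [hC₀ (cm + |C₀| + 1), eventually_ge_atTop 3,
    tendsto_natCast_atTop_atTop.eventually (eventually_ge_atTop lam)]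
    with n hfar hn3 hnlam V _ _ hV
  have hn3' : (3 : ℝ) ≤ n := by exact_mod_cast hn3
  have hn0 : (0 : ℝ) < n := by linarith
  have hlogn : 1 ≤ Real.log n := by
    rw [Real.le_log_iff_exp_le hn0]
    linarith [Real.exp_one_lt_d9]
  have hc0 : 0 ≤ cm * Real.log n := by positivity
  set t := ⌈diamMainTerm lam m n / 2 + |C₀|⌉₊ with ht
  have ht1 : diamMainTerm lam m n / 2 + |C₀| ≤ t := Nat.le_ceil _
  have ht2 : (t : ℝ) ≤ diamMainTerm lam m n / 2 + |C₀| + 1 := by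
    refine (Nat.ceil_lt_add_one ?_).le
    rw [hmain]; positivity
  have hp : 0 ≤ lam / n := by positivity
  have hp1 : lam / n ≤ 1 := (div_le_one hn0).2 hnlam
  have htK : (t : ℝ) ≤ (cm + |C₀| + 1) * Real.log n := by
    rw [hmain] at ht2
    have h5 := mul_le_mul_of_nonneg_left hlogn (abs_nonneg C₀)
    linarith
  refine le_trans (gnpP_mono hp hp1 fun G hG => ?_)
    (hfar V hV t (by linarith [le_abs_self C₀]) htK)
  by_contra hcon
  apply hG
  have : Nonempty V := Fintype.card_pos_iff.1 (by omega)
  obtain ⟨x, y, hxy, hd⟩ := G.isGreatest_finiteDiam.1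
  have hle : G.edist x y ≤ ((2 * t + 1 : ℕ) : ℕ∞) := by
    have hmono : ((t : ℕ) : ℕ∞) ≤ ((2 * t + 1 : ℕ) : ℕ∞) := by
      exact_mod_cast (by omega : t ≤ 2 * t + 1)
    by_contra hlt
    refine hcon ⟨x, y, fun h => hlt ?_, fun h => hlt ?_, hlt⟩
    · exact (edist_le_of_grow_empty _ t h hxy).trans hmono
    · rw [G.edist_comm]
      exact (edist_le_of_grow_empty _ t h hxy.symm).trans hmono
  rw [← hxy.coe_dist_eq_edist, hd] at hle
  have h1 : (G.finiteDiam : ℝ) ≤ ((2 * t + 1 : ℕ) : ℝ) := by exact_mod_cast hle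
  push_cast at h1
  linarith

end Main

/-! ### Transfer to the random graph measure -/

section Transfer

theorem sparseRandomGraph_le {lam : ℝ} (hlam : 0 < lam) {n : ℕ} (hn : lam ≤ n)
    (A : Set (SimpleGraph (Fin n))) :
    sparseRandomGraph lam n A ≤ ENNReal.ofReal (gnpP (lam / n) fun G => G ∈ A) := by
  have hn0 : (0 : ℝ) < n := by linarith
  have hmem : lam / (n : ℝ) ∈ Set.Icc (0 : ℝ) 1 := ⟨by positivity, (div_le_one hn0).2 hn⟩
  refine (binomialRandom_le_gnpP _ A).trans (le_of_eq ?_)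
  rw [Set.projIcc_of_mem zero_le_one hmem]

theorem boundedInProbability_finiteDiam {lam lamStar : ℝ} (hlam : 1 < lam) (h0 : 0 < lamStar)
    (h1 : lamStar < 1) (hdual : lamStar * Real.exp (-lamStar) = lam * Real.exp (-lam)) :
    BoundedInProbability (sparseRandomGraph lam)
      (fun n G => (G.finiteDiam : ℝ) - diamMainTerm lam lamStar n) := by
  intro δ hδ
  rcases eq_or_ne δ ⊤ with rfl | htop
  · exact ⟨0, Eventually.of_forall fun _ => le_top⟩
  have hδ' : 0 < δ.toReal := ENNReal.toReal_pos hδ.ne' htop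
  obtain ⟨C₁, hC₁⟩ := eventually_gnpP_finiteDiam_lt_le hlam h0 h1 hdual (half_pos hδ')
  obtain ⟨C₂, hC₂⟩ := eventually_gnpP_lt_finiteDiam_le hlam h0 h1 hdual (half_pos hδ')
  refine ⟨max C₁ C₂, ?_⟩
  filter_upwards [hC₁, hC₂, tendsto_natCast_atTop_atTop.eventually (eventually_ge_atTop lam)]
    with n hn1 hn2 hnlam
  have hn0 : (0 : ℝ) < n := by linarith
  have hp : 0 ≤ lam / n := div_nonneg (by linarith) hn0.le
  have hp1 : lam / n ≤ 1 := (div_le_one hn0).2 hnlam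
  refine (sparseRandomGraph_le (by linarith) hnlam _).trans
    (ENNReal.ofReal_le_of_le_toReal ?_)
  have e1 := hn1 (Fin n) (Fintype.card_fin n)
  have e2 := hn2 (Fin n) (Fintype.card_fin n)
  refine ((gnpP_mono hp hp1 fun G hG => ?_).trans (gnpP_or_le hp hp1 _ _)).trans
    ((add_le_add e1 e2).trans (add_halves _).le)
  by_contra hcon
  rw [not_or, not_not, not_not] at hcon
  have hG' : max C₁ C₂ < |(G.finiteDiam : ℝ) - diamMainTerm lam lamStar n| := hG
  refine absurd hG' (not_lt.2 (abs_le.2 ⟨?_, ?_⟩))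
  · linarith [hcon.1, le_max_left C₁ C₂]
  · linarith [hcon.2, le_max_right C₁ C₂]

/-- A sequence that is bounded in probability is at most `K n` with high probability, if `K n` tends
to infinity. -/
theorem _root_.BoundedInProbability.holdsWhp {Ω : ℕ → Type*} [∀ n, MeasurableSpace (Ω n)]
    {μ : ∀ n, Measure (Ω n)} [∀ n, IsProbabilityMeasure (μ n)] {X : ∀ n, Ω n → ℝ}
    (h : BoundedInProbability μ X) {K : ℕ → ℝ} (hK : Tendsto K atTop atTop) :
    HoldsWhp μ (fun n => {ω | |X n ω| ≤ K n}) := by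
  refine (ENNReal.tendsto_nhds ENNReal.one_ne_top).2 fun δ hδ => ?_
  obtain ⟨C, hC⟩ := h δ hδ
  filter_upwards [hC, hK.eventually (eventually_ge_atTop C)] with n hn hKn
  refine ⟨?_, prob_le_one.trans le_self_add⟩
  rw [tsub_le_iff_right]
  calc (1 : ℝ≥0∞) = μ n Set.univ := measure_univ.symm
    _ ≤ μ n ({ω | |X n ω| ≤ K n} ∪ {ω | C < |X n ω|}) := by
        refine measure_mono fun ω _ => ?_
        rcases le_or_gt |X n ω| (K n) with h | h
        · exact Or.inl h
        · exact Or.inr (lt_of_le_of_lt hKn h)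
    _ ≤ μ n {ω | |X n ω| ≤ K n} + μ n {ω | C < |X n ω|} := measure_union_le _ _
    _ ≤ _ := by gcongr

end Transfer

end SparseDiam

/-! ### The theorem -/

theorem mainTheorem1 (lam lamStar : ℝ) (hlam : 1 < lam) (hlamStar : lamStar < 1)
    (hdual : lamStar * Real.exp (-lamStar) = lam * Real.exp (-lam)) :
    BoundedInProbability (sparseRandomGraph lam)
        (fun n G => (G.finiteDiam : ℝ) - diamMainTerm lam lamStar n) ∧
      ∀ K : ℕ → ℝ, Tendsto K atTop atTop →
        HoldsWhp (sparseRandomGraph lam)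
          (fun n => {G | |(G.finiteDiam : ℝ) - diamMainTerm lam lamStar n| ≤ K n}) := by
  -- Positivity is forced by the equation, whose right-hand side is positive.
  have h0 : 0 < lamStar := by
    have h1 : 0 < lamStar * Real.exp (-lamStar) := by
      rw [hdual]
      exact mul_pos (by linarith) (Real.exp_pos _)
    exact pos_of_mul_pos_left h1 (Real.exp_pos _).le
  have hbdd := SparseDiam.boundedInProbability_finiteDiam hlam h0 hlamStar hdual
  have hprob : ∀ n, IsProbabilityMeasure (sparseRandomGraph lam n) := fun n => by
    rw [sparseRandomGraph]
    infer_instance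
  exact ⟨hbdd, fun K hK => hbdd.holdsWhp hK⟩
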